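/- Let $X$ be a normal, irreducible (and reduced) projective variety over $\mathbb C$, with function field $\mathbb C(X)$, whose sheaf of Kähler differentials $\Omega_X=\Omega_{X/\mathbb C}$ is reflexive. Here a coherent sheaf $\mathcal F$ is called reflexive if the canonical map $\mathcal F\to\mathcal F^{\vee\vee}$ is an isomorphism. Let $\Lambda\subset\operatorname{CDiv}(X)$ be a finitely generated free group of Cartier divisors; write $D_\lambda$ for $\lambda\in\Lambda$ regarded as a divisor. Assume that $\Lambda$ contains an ample divisor and that the first Chern class map $c_1:\Lambda\to H^1(X,\Omega_X)$ is injective; here, if $D_\lambda$ has local equations $f_i^\lambda$ on an open covering $(U_i)$, chosen additively in $\lambda$, then $c_1(\lambda)$ is the class of the cocycle $\psi_{ij}(\lambda)=d\log(f_j^\lambda/f_i^\lambda)$. Define the following objects. * The Cox ring $\mathcal S_\Lambda=\bigoplus_{\lambda\in\Lambda}S^\lambda$, where $S^\lambda=H^0(X,\mathcal O_X(D_\lambda))=\{h\in\mathbb C(X)^*:\operatorname{div}(h)+D_\lambda\ge 0\}\cup\{0\}$, with the multiplication of $\mathbb C(X)$; it is a $\Lambda$-graded $\mathbb C$-algebra.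 * For a coherent sheaf $\mathcal F$, the $\Lambda$-graded $\mathcal S_\Lambda$-module $\Gamma_\Lambda(\mathcal F)=\bigoplus_{\lambda\in\Lambda}H^0(X,\mathcal F\otimes\mathcal O_X(D_\lambda))$. * The sheaf $\mathcal R_\Lambda$, the middle term of the extension $0\to\Omega_X\to\mathcal R_\Lambda\to\Lambda\otimes_{\mathbb Z}\mathcal O_X\to0$ with class given by $c_1$. Explicitly, a section of $\mathcal R_\Lambda$ is given on each $U_i$ by a pair $(\omega_i,\ell)$, where $\omega_i$ is a section of $\Omega_X$ and $\ell$ a section of $\Lambda\otimes_{\mathbb Z}\mathcal O_X$, with $\omega_j=\omega_i+\psi_{ij}(\ell)$ on $U_i\cap U_j$, where $\psi_{ij}$ is extended $\mathcal O_X$-linearly. Then the following conditions are equivalent: 1. $\mathcal S_\Lambda$ is a finitely generated $\mathbb C$-algebra. 2. $\Gamma_\Lambda(\mathcal R_\Lambda)$ is a finitely generated $\mathcal S_\Lambda$-module. 3. For every reflexive sheaf $\mathcal F$ on $X$, $\Gamma_\Lambda(\mathcal F)$ is a finitely generated $\mathcal S_\Lambda$-module. -/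

import Mathlib

open CategoryTheory AlgebraicGeometry TopologicalSpace Opposite

noncomputable section
namespace CoxEuler

section Dual
variable {X : Scheme.{0}}

/-- Restriction of regular functions. -/
def resFun {U V : X.Opens} (h : V ≤ U) : Γ(X, U) →+* Γ(X, V) :=
  (X.presheaf.map (homOfLE h).op).hom

lemma resFun_resFun {U V W : X.Opens} (h : V ≤ U) (h' : W ≤ V) (r : Γ(X, U)) :
    resFun h' (resFun h r) = resFun (h'.trans h) r := by
  change (X.presheaf.map _ ≫ X.presheaf.map _).hom r = _
  rw [← Functor.map_comp]; rfl

lemma resFun_self {U : X.Opens} (r : Γ(X, U)) : resFun le_rfl r = r := by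
  change (X.presheaf.map (𝟙 _)).hom r = _
  rw [X.presheaf.map_id]; rfl

variable (M : PresheafOfModules.{0} (X.presheaf ⋙ forget₂ CommRingCat RingCat))

instance sectionsModule (V : X.Opens) : Module Γ(X, V) (M.obj (op V)) := (M.obj (op V)).isModule

/-- Restriction of sections. -/
def resSec {U V : X.Opens} (h : V ≤ U) : M.obj (op U) →+ M.obj (op V) :=
  (M.restrictₛₗ (homOfLE h).op).toAddMonoidHom

lemma resSec_smul {U V : X.Opens} (h : V ≤ U) (r : Γ(X, U)) (m : M.obj (op U)) :
    resSec M h (r • m) = resFun h r • resSec M h m := M.map_smul (homOfLE h).op r m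

lemma resSec_resSec {U V W : X.Opens} (h : V ≤ U) (h' : W ≤ V) (m : M.obj (op U)) :
    resSec M h' (resSec M h m) = resSec M (h'.trans h) m :=
  (M.map_comp_apply (homOfLE h).op (homOfLE h').op m).symm

lemma resSec_self {U : X.Opens} (m : M.obj (op U)) : resSec M le_rfl m = m := by
  change M.map (𝟙 _) m = m
  rw [M.map_id]; rfl

/-- Sections over `U` of the dual `Hom(M, 𝒪_X)`: families of `Γ(X, V)`-linear maps
`M(V) → Γ(X, V)`, for all open `V ⊆ U`, that commute with restriction. -/
def dualSections (U : X.Opens) :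
    AddSubgroup (∀ V : {V : X.Opens // V ≤ U}, M.obj (op V.1) →ₗ[Γ(X, V.1)] Γ(X, V.1)) where
  carrier := {φ | ∀ (V W : {V : X.Opens // V ≤ U}) (h : W.1 ≤ V.1) (m : M.obj (op V.1)),
    φ W (resSec M h m) = resFun h (φ V m)}
  zero_mem' := fun V W h m => by simp
  add_mem' := fun {φ ψ} hφ hψ V W h m => by
    simp only [Pi.add_apply, LinearMap.add_apply, map_add, hφ V W h m, hψ V W h m]
  neg_mem' := fun {φ} hφ V W h m => by
    simp only [Pi.neg_apply, LinearMap.neg_apply, map_neg, hφ V W h m]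

/-- The `Γ(X, U)`-module structure on the sections of the dual over `U`. -/
@[reducible] def dualModule (U : X.Opens) : Module Γ(X, U) (dualSections M U) where
  smul r φ := ⟨fun V => resFun V.2 r • φ.1 V, fun V W h m => by
    simp only [LinearMap.smul_apply, φ.2 V W h m, smul_eq_mul, map_mul, resFun_resFun]⟩
  one_smul φ := Subtype.ext <| funext fun V => by
    change resFun V.2 1 • φ.1 V = _; rw [map_one, one_smul]
  mul_smul r s φ := Subtype.ext <| funext fun V => by
    change resFun V.2 (r * s) • φ.1 V = resFun V.2 r • resFun V.2 s • φ.1 V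
    rw [map_mul, mul_smul]
  smul_zero r := Subtype.ext <| funext fun V => smul_zero (resFun _ r)
  smul_add r φ ψ := Subtype.ext <| funext fun V => smul_add (resFun _ r) _ _
  add_smul r s φ := Subtype.ext <| funext fun V => by
    change resFun V.2 (r + s) • φ.1 V = resFun V.2 r • φ.1 V + resFun V.2 s • φ.1 V
    rw [map_add, add_smul]
  zero_smul φ := Subtype.ext <| funext fun V => by
    change resFun V.2 0 • φ.1 V = 0; rw [map_zero, zero_smul]

/-- The dual `M^∨ = Hom(M, 𝒪_X)`, as a presheaf of `𝒪_X`-modules (it is a sheaf). -/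
def dual : PresheafOfModules.{0} (X.presheaf ⋙ forget₂ CommRingCat RingCat) :=
  letI (U : X.Opensᵒᵖ) : Module ((X.presheaf ⋙ forget₂ CommRingCat RingCat).obj U)
      ((AddCommGrpCat.of (dualSections M U.unop) : Type 0)) := dualModule M U.unop
  PresheafOfModules.ofPresheaf
    { obj := fun U => AddCommGrpCat.of (dualSections M U.unop)
      map := fun {U V} i => AddCommGrpCat.ofHom
        { toFun := fun φ => ⟨fun W => φ.1 ⟨W.1, W.2.trans i.unop.le⟩,
            fun W W' h m => φ.2 ⟨W.1, W.2.trans i.unop.le⟩ ⟨W'.1, W'.2.trans i.unop.le⟩ h m⟩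
          map_zero' := rfl
          map_add' := fun _ _ => rfl } }
    (fun U V i r φ => Subtype.ext <| funext fun W =>
      congrArg (· • φ.1 ⟨W.1, W.2.trans i.unop.le⟩) (resFun_resFun i.unop.le W.2 r).symm)


/-- Evaluation `φ ↦ φ(m)` at a section `m` over `U`. -/
def evalAt {U : X.Opens} (m : M.obj (op U)) :
    (dual M).obj (op U) →ₗ[Γ(X, U)] Γ(X, U) where
  toFun := fun φ : dualSections M U => φ.1 ⟨U, le_rfl⟩ m
  map_add' := fun _ _ => rfl
  map_smul' := fun r φ => congrArg (· * (φ : dualSections M U).1 ⟨U, le_rfl⟩ m) (resFun_self r)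

lemma evalAt_add {U : X.Opens} (m n : M.obj (op U)) :
    evalAt M (m + n) = evalAt M m + evalAt M n :=
  LinearMap.ext fun φ => map_add ((φ : dualSections M U).1 ⟨U, le_rfl⟩) m n

lemma evalAt_smul {U : X.Opens} (r : Γ(X, U)) (m : M.obj (op U)) :
    evalAt M (r • m) = r • evalAt M m :=
  LinearMap.ext fun φ => map_smul ((φ : dualSections M U).1 ⟨U, le_rfl⟩) r m

/-- The section `φ ↦ φ(m)` of the bidual defined by a section `m`. -/
def bidualSection {U : X.Opens} (m : M.obj (op U)) : dualSections (dual M) U :=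
  ⟨fun V => evalAt M (resSec M V.2 m), fun V W h φ =>
    (congrArg ((φ : dualSections M V.1).1 ⟨W.1, h⟩) (resSec_resSec M V.2 h m).symm).trans
      ((φ : dualSections M V.1).2 ⟨V.1, le_rfl⟩ ⟨W.1, h⟩ h _)⟩

/-- The canonical morphism to the bidual, `m ↦ (φ ↦ φ(m))`. -/
def toBidual : M ⟶ dual (dual M) where
  app U := ModuleCat.ofHom (Y := (dual (dual M)).obj U)
    { toFun := fun m => bidualSection M m
      map_add' := fun m n => Subtype.ext <| funext fun V => by
        change evalAt M (resSec M V.2 (m + n)) =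
          evalAt M (resSec M V.2 m) + evalAt M (resSec M V.2 n)
        rw [map_add, evalAt_add]
      map_smul' := fun r m => Subtype.ext <| funext fun V => by
        change evalAt M (resSec M V.2 ((r : Γ(X, U.unop)) • (m : M.obj (op U.unop)))) =
          resFun V.2 r • evalAt M (resSec M V.2 m)
        rw [resSec_smul, evalAt_smul] }
  naturality {U V} i := by
    ext m
    exact Subtype.ext <| funext fun W =>
      congrArg (evalAt M) (resSec_resSec M i.unop.le W.2 m)

end Dual

variable {X : Scheme.{0}}

/-- Presheaves of `𝒪_X`-modules. -/
abbrev PMod (X : Scheme.{0}) := PresheafOfModules.{0} (X.presheaf ⋙ forget₂ CommRingCat RingCat)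

/-- The presheaf of modules underlying a sheaf of modules. -/
def toPMod (F : X.Modules) : PMod X := F.val

/-- Sheafification of a presheaf of `𝒪_X`-modules. -/
def sheafify (M : PMod X) : X.Modules :=
  (PresheafOfModules.sheafification (𝟙 X.ringCatSheaf.obj)).obj M

/-- The canonical map from sections of a presheaf to sections of its sheafification. -/
def toSheafify (M : PMod X) (U : X.Opens) : M.obj (op U) →+ (toPMod (sheafify M)).obj (op U) :=
  (((PresheafOfModules.sheafificationAdjunction (𝟙 X.ringCatSheaf.obj)).unit.app M).app (op U)).hom.toAddMonoidHom

/-- Coherent sheaves on a locally noetherian scheme: the sheaf is locally the cokernel of a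
morphism between free sheaves of finite rank. -/
def IsCoherent (F : X.Modules) : Prop := SheafOfModules.IsFinitePresentation.{0} F

/-- A coherent sheaf is reflexive if the canonical map to its bidual is an isomorphism. -/
structure IsReflexive (F : X.Modules) : Prop where
  coherent : IsCoherent F
  isIso : IsIso (toBidual (toPMod F))

/-- `F` is generated by global sections: some family of global sections defines an epimorphism from
a free sheaf onto `F`. -/
def IsGloballyGenerated (F : X.Modules) : Prop := Nonempty (SheafOfModules.GeneratingSections F)

section Differentials

variable (f : X ⟶ Spec (.of ℂ))

/-- The structure map `ℂ → Γ(X, U)`. -/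
def constHom (U : X.Opens) : ℂ →+* Γ(X, U) :=
  (resFun le_top).comp (f.appTop.hom.comp (Scheme.ΓSpecIso (.of ℂ)).inv.hom)

/-- The structure map from the constant presheaf `ℂ` to `𝒪_X`. -/
def constMap : (Functor.const X.Opensᵒᵖ).obj (CommRingCat.of ℂ) ⟶ X.presheaf where
  app U := CommRingCat.ofHom (constHom f U.unop)
  naturality U V i := by
    ext z
    exact (resFun_resFun le_top i.unop.le _).symm

/-- The sheaf `Ω_X` of Kähler differentials of `X` over `ℂ`: the sheafification of
`U ↦ Ω_{Γ(X, U)/ℂ}`. -/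
def Omega : X.Modules :=
  sheafify (PresheafOfModules.DifferentialsConstruction.relativeDifferentials' (constMap f))

/-- The universal derivation `d : 𝒪_X → Ω_X`. -/
def diff (U : X.Opens) : Γ(X, U) →+ (toPMod (Omega f)).obj (op U) :=
  (toSheafify _ U).comp
    (PresheafOfModules.DifferentialsConstruction.derivation' (constMap f)).d

lemma diff_mul (U : X.Opens) (a b : Γ(X, U)) :
    diff f U (a * b) = a • diff f U b + b • diff f U a := by
  let D := PresheafOfModules.DifferentialsConstruction.derivation' (constMap f)
  change toSheafify _ U (D.d (X := op U) (a * b)) = _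
  rw [D.d_mul, map_add]
  let t := (((PresheafOfModules.sheafificationAdjunction (𝟙 X.ringCatSheaf.obj)).unit.app (PresheafOfModules.DifferentialsConstruction.relativeDifferentials' (constMap f))).app (op U)).hom
  exact congrArg₂ (· + ·) (t.map_smul a (D.d b)) (t.map_smul b (D.d a))

lemma resSec_diff {U V : X.Opens} (h : V ≤ U) (a : Γ(X, U)) :
    resSec (toPMod (Omega f)) h (diff f U a) = diff f V (resFun h a) := by
  let D := PresheafOfModules.DifferentialsConstruction.derivation' (constMap f)
  refine Eq.trans ?_ (congrArg (toSheafify _ V) (D.d_map (homOfLE h).op a).symm)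
  exact (PresheafOfModules.naturality_apply ((PresheafOfModules.sheafificationAdjunction
    (𝟙 X.ringCatSheaf.obj)).unit.app
      (PresheafOfModules.DifferentialsConstruction.relativeDifferentials' (constMap f)))
      (homOfLE h).op (D.d (X := op U) a)).symm

/-- The logarithmic derivative `dlog u = u⁻¹ du` of an invertible function. -/
def dlog (U : X.Opens) : Additive (Γ(X, U))ˣ →+ (toPMod (Omega f)).obj (op U) where
  toFun u := ((u.toMul⁻¹ : (Γ(X, U))ˣ) : Γ(X, U)) • diff f U (u.toMul : Γ(X, U))
  map_zero' := by
    have h : diff f U (1 : Γ(X, U)) = 0 := by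
      have := diff_mul f U 1 1
      rw [mul_one, one_smul] at this
      simpa using this
    change _ • diff f U (1 : Γ(X, U)) = 0
    rw [h, smul_zero]
  map_add' u v := by
    change (((u.toMul * v.toMul)⁻¹ : (Γ(X, U))ˣ) : Γ(X, U)) • diff f U (u.toMul * v.toMul : Γ(X, U)) = _
    rw [diff_mul, smul_add, smul_smul, smul_smul, add_comm]
    congr 2
    · rw [mul_inv_rev, Units.val_mul, mul_right_comm, Units.inv_mul, one_mul]
    · rw [mul_inv_rev, Units.val_mul, mul_assoc, Units.inv_mul, mul_one]

end Differentials

section Divisors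
variable (X) [IsIntegral X]

/-- The image of `𝒪_{X,x}ˣ` in the multiplicative group of the function field. -/
def localUnits (x : X) : Subgroup (X.functionField)ˣ :=
  (Units.map (algebraMap (X.presheaf.stalk x) X.functionField).toMonoidHom).range

/-- Cartier divisors: global sections of the sheaf `𝒦ˣ/𝒪ˣ`, written as families of germs in
`K(X)ˣ/𝒪_{X,x}ˣ` that are locally given by one rational function. -/
def CDiv : AddSubgroup (∀ x : X, Additive ((X.functionField)ˣ ⧸ localUnits X x)) where
  carrier := {D | ∀ x : X, ∃ U : X.Opens, x ∈ U ∧ ∃ f : (X.functionField)ˣ,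
    ∀ y ∈ U, D y = Additive.ofMul (QuotientGroup.mk f)}
  zero_mem' := fun x => ⟨⊤, trivial, 1, fun _ _ => rfl⟩
  add_mem' := by
    intro D E hD hE x
    obtain ⟨U, hxU, f, hf⟩ := hD x
    obtain ⟨V, hxV, g, hg⟩ := hE x
    exact ⟨U ⊓ V, ⟨hxU, hxV⟩, f * g, fun y hy => by
      rw [Pi.add_apply, hf y hy.1, hg y hy.2]; rfl⟩
  neg_mem' := by
    intro D hD x
    obtain ⟨U, hxU, f, hf⟩ := hD x
    exact ⟨U, hxU, f⁻¹, fun y hy => by rw [Pi.neg_apply, hf y hy]; rfl⟩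

variable {X}

/-- The rational function `f` is a local equation of `D` at `x`. -/
def IsLocalEquationAt (D : CDiv X) (x : X) (f : (X.functionField)ˣ) : Prop :=
  D.1 x = Additive.ofMul (QuotientGroup.mk f)

/-- The rational function `h` is regular at `x`. -/
def IsRegularAt (x : X) (h : X.functionField) : Prop :=
  h ∈ (algebraMap (X.presheaf.stalk x) X.functionField).range

/-- The rational function `h` lies in the stalk of `𝒪_X(D)` at `x`: the product of `h` with a local
equation of `D` is regular at `x`, that is, `div h + D ≥ 0` at `x`. -/
def IsSectionAt (D : CDiv X) (x : X) (h : X.functionField) : Prop :=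
  ∀ f : (X.functionField)ˣ, IsLocalEquationAt D x f → IsRegularAt x (h * f)

lemma exists_isLocalEquationAt (D : CDiv X) (x : X) : ∃ f, IsLocalEquationAt D x f := by
  obtain ⟨U, hxU, f, hf⟩ := D.2 x
  exact ⟨f, hf x hxU⟩

lemma IsLocalEquationAt.add {D E : CDiv X} {x : X} {f g : (X.functionField)ˣ}
    (hf : IsLocalEquationAt D x f) (hg : IsLocalEquationAt E x g) :
    IsLocalEquationAt (D + E) x (f * g) := by
  change D.1 x + E.1 x = _
  rw [hf, hg]; rfl

lemma IsLocalEquationAt.div_mem {D : CDiv X} {x : X} {f g : (X.functionField)ˣ}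
    (hf : IsLocalEquationAt D x f) (hg : IsLocalEquationAt D x g) :
    f⁻¹ * g ∈ localUnits X x :=
  QuotientGroup.eq.mp (Additive.ofMul.injective (hf.symm.trans hg))

lemma isSectionAt_of {D : CDiv X} {x : X} {h : X.functionField} {f : (X.functionField)ˣ}
    (hf : IsLocalEquationAt D x f) (hh : IsRegularAt x (h * f)) : IsSectionAt D x h := by
  intro g hg
  obtain ⟨u, hu⟩ := hf.div_mem hg
  have hu' : algebraMap (X.presheaf.stalk x) X.functionField u = (f : X.functionField)⁻¹ * g := by
    simpa using congrArg Units.val hu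
  have : h * g = (h * f) * ((f : X.functionField)⁻¹ * g) := by
    have := f.ne_zero
    field_simp
  rw [this, ← hu']
  exact (RingHom.range _).mul_mem hh ⟨_, rfl⟩

lemma IsSectionAt.mul {D E : CDiv X} {x : X} {h k : X.functionField}
    (hh : IsSectionAt D x h) (hk : IsSectionAt E x k) : IsSectionAt (D + E) x (h * k) := by
  obtain ⟨f, hf⟩ := exists_isLocalEquationAt D x
  obtain ⟨g, hg⟩ := exists_isLocalEquationAt E x
  refine isSectionAt_of (hf.add hg) ?_
  have := (RingHom.range _).mul_mem (hh f hf) (hk g hg)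
  rw [mul_mul_mul_comm] at this
  exact this

variable (X) in
lemma isSectionAt_one (x : X) : IsSectionAt (0 : CDiv X) x 1 :=
  isSectionAt_of (f := 1) rfl (by simpa using! (RingHom.range _).one_mem)

lemma IsSectionAt.regular_mul {D : CDiv X} {x : X} {h r : X.functionField}
    (hr : IsRegularAt x r) (hh : IsSectionAt D x h) : IsSectionAt D x (r * h) := fun f hf => by
  rw [mul_assoc]; exact (RingHom.range _).mul_mem hr (hh f hf)

/-- The space `{h : div h + D ≥ 0} ∪ {0}` of rational functions, that is, `H⁰(X, 𝒪_X(D))`. -/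
def sectionSpace (D : CDiv X) : AddSubgroup X.functionField where
  carrier := {h | ∀ x : X, IsSectionAt D x h}
  zero_mem' := fun x f _ => by rw [zero_mul]; exact (RingHom.range _).zero_mem
  add_mem' := fun {h k} hh hk x f hf => by
    rw [add_mul]; exact (RingHom.range _).add_mem (hh x f hf) (hk x f hf)
  neg_mem' := fun {h} hh x f hf => by
    rw [neg_mul]; exact (RingHom.range _).neg_mem (hh x f hf)

/-- The rational function defined by a regular function on `U`, computed through its germ at a point
`x` of `U` (it does not depend on `x`). -/
def toFunctionField (U : X.Opens) (x : U) : Γ(X, U) →+* X.functionField :=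
  (algebraMap (X.presheaf.stalk x.1) X.functionField).comp (X.presheaf.germ U x.1 x.2).hom

lemma toFunctionField_const {U : X.Opens} (x y : U) (r : Γ(X, U)) :
    toFunctionField U x r = toFunctionField U y r := by
  have : Nonempty U := ⟨x⟩
  exact (X.algebraMap_germ_eq_germToFunctionField x.2 r).trans
    (X.algebraMap_germ_eq_germToFunctionField y.2 r).symm

lemma toFunctionField_resFun {U V : X.Opens} (h : V ≤ U) (x : V) (r : Γ(X, U)) :
    toFunctionField V x (resFun h r) = toFunctionField U ⟨x.1, h x.2⟩ r := by
  unfold toFunctionField resFun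
  simp only [RingHom.comp_apply]
  congr 1
  exact X.presheaf.germ_res_apply (homOfLE h) x.1 x.2 r

/-- Sections of `𝒪_X(D)` over `U`: rational functions `h` with `div h + D ≥ 0` on `U`. They are
written as constant functions on the set of points of `U`, so that there is just one section over
the empty set. -/
def divisorSections (D : CDiv X) (U : X.Opens) : AddSubgroup (U → X.functionField) where
  carrier := {s | (∀ x y, s x = s y) ∧ ∀ x, IsSectionAt D x.1 (s x)}
  zero_mem' := ⟨fun _ _ => rfl, fun x => (fun f _ => by
    rw [Pi.zero_apply, zero_mul]; exact (RingHom.range _).zero_mem)⟩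
  add_mem' := fun {s t} hs ht => ⟨fun x y => congrArg₂ (· + ·) (hs.1 x y) (ht.1 x y),
    fun x f hf => by
      rw [Pi.add_apply, add_mul]; exact (RingHom.range _).add_mem (hs.2 x f hf) (ht.2 x f hf)⟩
  neg_mem' := fun {s} hs => ⟨fun x y => congrArg (- ·) (hs.1 x y), fun x f hf => by
    rw [Pi.neg_apply, neg_mul]; exact (RingHom.range _).neg_mem (hs.2 x f hf)⟩

/-- Sections of `𝒪_X(D)` over `U` form a module over `Γ(X, U)`. -/
@[reducible] def divisorSectionsModule (D : CDiv X) (U : X.Opens) :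
    Module Γ(X, U) (divisorSections D U) where
  smul r s := ⟨fun x => toFunctionField U x r * s.1 x,
    fun x y => congrArg₂ (· * ·) (toFunctionField_const x y r) (s.2.1 x y),
    fun x => (s.2.2 x).regular_mul ⟨_, rfl⟩⟩
  one_smul s := Subtype.ext <| funext fun x => by
    change toFunctionField U x 1 * s.1 x = _; rw [map_one, one_mul]
  mul_smul r t s := Subtype.ext <| funext fun x => by
    change toFunctionField U x (r * t) * s.1 x = toFunctionField U x r * (toFunctionField U x t * s.1 x)
    rw [map_mul, mul_assoc]
  smul_zero r := Subtype.ext <| funext fun x => mul_zero (toFunctionField U x r)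
  smul_add r s t := Subtype.ext <| funext fun x => mul_add (toFunctionField U x r) _ _
  add_smul r t s := Subtype.ext <| funext fun x => by
    change toFunctionField U x (r + t) * s.1 x = toFunctionField U x r * s.1 x + toFunctionField U x t * s.1 x
    rw [map_add, add_mul]
  zero_smul s := Subtype.ext <| funext fun x => by
    change toFunctionField U x 0 * s.1 x = 0; rw [map_zero, zero_mul]

/-- The sheaf `𝒪_X(D)` (as a presheaf of modules) of a Cartier divisor `D`. -/
def divisorSheaf (D : CDiv X) : PMod X :=
  letI (U : X.Opensᵒᵖ) : Module ((X.presheaf ⋙ forget₂ CommRingCat RingCat).obj U)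
      ((AddCommGrpCat.of (divisorSections D U.unop) : Type 0)) := divisorSectionsModule D U.unop
  PresheafOfModules.ofPresheaf
    { obj := fun U => AddCommGrpCat.of (divisorSections D U.unop)
      map := fun {U V} i => AddCommGrpCat.ofHom
        { toFun := fun s => ⟨fun x => s.1 ⟨x.1, i.unop.le x.2⟩, fun x y => s.2.1 _ _,
            fun x => s.2.2 ⟨x.1, i.unop.le x.2⟩⟩
          map_zero' := rfl
          map_add' := fun _ _ => rfl } }
    (fun U V i r s => Subtype.ext <| funext fun x =>
      congrArg (· * s.1 ⟨x.1, i.unop.le x.2⟩) (toFunctionField_resFun i.unop.le x r).symm)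

/-- Multiplication by a rational function `h`, as a morphism `𝒪_X(D) ⟶ 𝒪_X(E)`. -/
def mulHom {D E : CDiv X} (h : X.functionField)
    (hh : ∀ x : X, ∀ k, IsSectionAt D x k → IsSectionAt E x (h * k)) :
    divisorSheaf D ⟶ divisorSheaf E where
  app U := ModuleCat.ofHom (X := (divisorSheaf D).obj U) (Y := (divisorSheaf E).obj U)
    { toFun := fun s : divisorSections D U.unop => (⟨fun x => h * s.1 x,
        fun x y => congrArg (h * ·) (s.2.1 x y), fun x => hh _ _ (s.2.2 x)⟩ : divisorSections E U.unop)
      map_add' := fun s t => Subtype.ext <| funext fun x =>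
        mul_add h ((s : divisorSections D U.unop).1 x) ((t : divisorSections D U.unop).1 x)
      map_smul' := fun r s => Subtype.ext <| funext fun x =>
        mul_left_comm h (toFunctionField U.unop x r) ((s : divisorSections D U.unop).1 x) }
  naturality _ := rfl

end Divisors

section Twist
open MonoidalCategory
/-- The tensor product `F ⊗ L` of sheaves of modules: the sheafification of the tensor product of
presheaves. -/
def tensor (F : X.Modules) (L : PMod X) : X.Modules := sheafify (toPMod F ⊗ L)

/-- Functoriality of the tensor product in the second factor. -/
def tensorMap (F : X.Modules) {L L' : PMod X} (φ : L ⟶ L') : tensor F L ⟶ tensor F L' :=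
  (PresheafOfModules.sheafification (𝟙 X.ringCatSheaf.obj)).map (toPMod F ◁ φ)

lemma tensorMap_id (F : X.Modules) (L : PMod X) : tensorMap F (𝟙 L) = 𝟙 _ := by
  unfold tensorMap
  rw [MonoidalCategory.whiskerLeft_id]
  exact (PresheafOfModules.sheafification (𝟙 X.ringCatSheaf.obj)).map_id _

lemma tensorMap_comp (F : X.Modules) {L L' L'' : PMod X} (φ : L ⟶ L') (ψ : L' ⟶ L'') :
    tensorMap F (φ ≫ ψ) = tensorMap F φ ≫ tensorMap F ψ := by
  unfold tensorMap
  rw [MonoidalCategory.whiskerLeft_comp]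
  exact (PresheafOfModules.sheafification (𝟙 X.ringCatSheaf.obj)).map_comp _ _

instance : (PresheafOfModules.sheafification (𝟙 X.ringCatSheaf.obj)).Additive :=
  (PresheafOfModules.sheafificationAdjunction (𝟙 X.ringCatSheaf.obj)).left_adjoint_additive

lemma tensorMap_add (F : X.Modules) {L L' : PMod X} (φ ψ : L ⟶ L') :
    tensorMap F (φ + ψ) = tensorMap F φ + tensorMap F ψ := by
  have h : toPMod F ◁ (φ + ψ) = toPMod F ◁ φ + toPMod F ◁ ψ := by
    ext1 U
    exact MonoidalPreadditive.whiskerLeft_add (C := ModuleCat (X.presheaf.obj U)) (φ.app U) (ψ.app U)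
  unfold tensorMap
  rw [h]
  exact (PresheafOfModules.sheafification (𝟙 X.ringCatSheaf.obj)).map_add

end Twist

section Cox
variable [IsIntegral X]

/-- Multiplication by `h` carries `𝒪_X(D)` into `𝒪_X(E)`. -/
def Multiplies (D E : CDiv X) (h : X.functionField) : Prop :=
  ∀ x : X, ∀ k, IsSectionAt D x k → IsSectionAt E x (h * k)

lemma multiplies_of_mem {D E : CDiv X} {h : X.functionField} (hh : h ∈ sectionSpace E) :
    Multiplies D (E + D) h := fun x _ hk => (hh x).mul hk

/-- The twist `F(D) = F ⊗ 𝒪_X(D)`. -/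
def twist (F : X.Modules) (D : CDiv X) : X.Modules := tensor F (divisorSheaf D)

/-- Global sections `H⁰(X, F)`. -/
abbrev H0 (F : X.Modules) : Type := (toPMod F).obj (op ⊤)

/-- Multiplication by a rational function, `H⁰(X, F(D)) → H⁰(X, F(E))`. -/
def twistMul (F : X.Modules) {D E : CDiv X} (h : X.functionField) (hh : Multiplies D E h) :
    H0 (twist F D) →+ H0 (twist F E) :=
  ((tensorMap F (mulHom h hh)).val.app (op ⊤)).hom.toAddMonoidHom

lemma twistMul_one (F : X.Modules) {D : CDiv X} (hh : Multiplies D D 1) (x : H0 (twist F D)) :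
    twistMul F 1 hh x = x := by
  have h : mulHom 1 hh = 𝟙 (divisorSheaf D) := by
    ext U s
    exact Subtype.ext <| funext fun x => one_mul ((s : divisorSections D U.unop).1 x)
  unfold twistMul
  rw [h, tensorMap_id]; rfl

lemma twistMul_twistMul (F : X.Modules) {D E G : CDiv X} {h k : X.functionField}
    (hh : Multiplies D E h) (hk : Multiplies E G k) (hkh : Multiplies D G (k * h))
    (x : H0 (twist F D)) : twistMul F k hk (twistMul F h hh x) = twistMul F (k * h) hkh x := by
  have e : mulHom (k * h) hkh = mulHom h hh ≫ mulHom k hk := by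
    ext U s
    exact Subtype.ext <| funext fun x => mul_assoc k h ((s : divisorSections D U.unop).1 x)
  unfold twistMul
  rw [e, tensorMap_comp]; rfl

lemma twistMul_add (F : X.Modules) {D E : CDiv X} {h k : X.functionField}
    (hh : Multiplies D E h) (hk : Multiplies D E k) (hkh : Multiplies D E (h + k))
    (x : H0 (twist F D)) : twistMul F (h + k) hkh x = twistMul F h hh x + twistMul F k hk x := by
  have e : mulHom (h + k) hkh = mulHom h hh + mulHom k hk := by
    ext U s
    exact Subtype.ext <| funext fun x => add_mul h k ((s : divisorSections D U.unop).1 x)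
  unfold twistMul
  rw [e, tensorMap_add]; rfl

lemma twistMul_zero (F : X.Modules) {D E : CDiv X} (h0 : Multiplies D E 0)
    (x : H0 (twist F D)) : twistMul F 0 h0 x = 0 := by
  have e : mulHom 0 h0 = 0 := by
    ext U s
    exact Subtype.ext <| funext fun x => zero_mul ((s : divisorSections D U.unop).1 x)
  have e' : tensorMap F (0 : divisorSheaf D ⟶ divisorSheaf E) = 0 := by
    simpa using tensorMap_add F (0 : divisorSheaf D ⟶ divisorSheaf E) 0
  unfold twistMul
  rw [e, e']; rfl

variable (Λ : AddSubgroup (CDiv X))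

/-- The graded piece `S^l = H⁰(X, 𝒪_X(D_l))` of the Cox ring. -/
abbrev coxPiece (l : Λ) : AddSubgroup X.functionField := sectionSpace l.1

instance coxPiece_gradedMonoid : SetLike.GradedMonoid (coxPiece Λ) where
  one_mem := isSectionAt_one X
  mul_mem _ _ _ _ hh hk := fun x => (hh x).mul (hk x)

open Classical DirectSum in
/-- The Cox ring `S_Λ = ⨁ S^l`, multiplied as in the function field. -/
abbrev CoxRing : Type := ⨁ l : Λ, coxPiece Λ l

open scoped DirectSum

open Classical in
instance : CommRing (CoxRing Λ) := inferInstanceAs (CommRing (⨁ l : Λ, coxPiece Λ l))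

/-- The graded piece `H⁰(X, F(D_l))` of the module of sections of `F`. -/
abbrev gradedSections (F : X.Modules) (l : Λ) : Type := H0 (twist F l.1)

lemma mk_twistMul_eq (F : X.Modules) {l m m' : Λ} (e : m = m') {h : X.functionField}
    (hh : Multiplies l.1 m.1 h) (hh' : Multiplies l.1 m'.1 h) (x : gradedSections Λ F l) :
    (⟨m, twistMul F h hh x⟩ : GradedMonoid (gradedSections Λ F)) = ⟨m', twistMul F h hh' x⟩ := by
  subst e; rfl

/-- The action `S^l × H⁰(X, F(D_m)) → H⁰(X, F(D_{l+m}))`, by multiplication of sections. -/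
instance gradedSections_gmodule (F : X.Modules) :
    DirectSum.Gmodule (fun l : Λ => coxPiece Λ l) (gradedSections Λ F) where
  smul {l m} h x := twistMul F h.1 (multiplies_of_mem h.2) x
  one_smul := by
    rintro ⟨l, x⟩
    have h1 : Multiplies l.1 l.1 1 := fun x k hk => by rwa [one_mul]
    refine (mk_twistMul_eq Λ F (zero_add l) _ h1 x).trans ?_
    rw [twistMul_one]
  mul_smul := by
    rintro ⟨l, h⟩ ⟨m, k⟩ ⟨n, x⟩
    have hm : Multiplies n.1 (l + (m + n)).1 (h.1 * k.1) := by
      rw [← add_assoc]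
      exact multiplies_of_mem (fun x => (h.2 x).mul (k.2 x))
    refine (mk_twistMul_eq Λ F (add_assoc l m n) _ hm x).trans ?_
    exact congrArg (Sigma.mk (l + (m + n)))
      (twistMul_twistMul F (multiplies_of_mem k.2) (multiplies_of_mem h.2) hm x).symm
  smul_add h x y := map_add _ _ _
  smul_zero h := map_zero _
  add_smul h k x := twistMul_add F _ _ _ x
  zero_smul x := twistMul_zero F _ x

/-- The `S_Λ`-module `Γ_Λ(F) = ⨁ H⁰(X, F(D_l))`. -/
abbrev SectionModule (F : X.Modules) : Type := ⨁ l : Λ, gradedSections Λ F l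

open Classical in
instance (F : X.Modules) : Module (CoxRing Λ) (SectionModule Λ F) :=
  DirectSum.Gmodule.module (fun l : Λ => coxPiece Λ l) (gradedSections Λ F)


section Structure
variable {Λ}
variable (f : X ⟶ Spec (.of ℂ))

/-- Constants, as rational functions. -/
def constFun : ℂ →+* X.functionField :=
  (toFunctionField ⊤ ⟨genericPoint X, trivial⟩).comp (constHom f ⊤)

lemma constFun_mem (z : ℂ) : constFun f z ∈ coxPiece Λ 0 := fun x => by
  have h : IsRegularAt x (constFun f z) := by
    change IsRegularAt x (toFunctionField ⊤ _ _)
    rw [toFunctionField_const _ (⟨x, trivial⟩ : (⊤ : X.Opens))]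
    exact ⟨_, rfl⟩
  have := (isSectionAt_one X x).regular_mul h
  rwa [mul_one] at this

variable (Λ) in
open Classical in
/-- The `ℂ`-algebra structure of the Cox ring: constants, placed in degree `0`. -/
def coxStructure : ℂ →+* CoxRing Λ where
  toFun z := DirectSum.of (fun l : Λ => coxPiece Λ l) 0 ⟨constFun f z, constFun_mem f z⟩
  map_one' := congrArg (DirectSum.of (fun l : Λ => coxPiece Λ l) 0)
    (Subtype.ext (map_one (constFun f)))
  map_mul' z w := by
    rw [DirectSum.of_mul_of]
    refine DirectSum.of_eq_of_gradedMonoid_eq (Sigma.subtype_ext (zero_add 0).symm ?_)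
    exact map_mul (constFun f) z w
  map_zero' := by
    exact (congrArg (DirectSum.of (fun l : Λ => coxPiece Λ l) 0)
      (Subtype.ext (map_zero (constFun f)))).trans (AddMonoidHom.map_zero _)
  map_add' z w := by
    exact (congrArg (DirectSum.of (fun l : Λ => coxPiece Λ l) 0)
      (Subtype.ext (map_add (constFun f) z w))).trans (AddMonoidHom.map_add
        (DirectSum.of (fun l : Λ => coxPiece Λ l) 0)
        ⟨constFun f z, constFun_mem f z⟩ ⟨constFun f w, constFun_mem f w⟩)

end Structure
end Cox

section Euler
variable [IsIntegral X]

lemma exists_section {U : X.Opens} [Nonempty U] (h : X.functionField)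
    (hh : ∀ x ∈ U, IsRegularAt x h) : ∃ r : Γ(X, U), X.germToFunctionField U r = h := by
  have key : ∀ x : U, ∃ V : X.Opens, ∃ hx : x.1 ∈ V, V ≤ U ∧ ∃ r : Γ(X, V),
      algebraMap (X.presheaf.stalk x.1) X.functionField (X.presheaf.germ V x.1 hx r) = h := by
    intro x
    obtain ⟨a, ha⟩ := hh x.1 x.2
    obtain ⟨V, hV, r, hr⟩ := X.presheaf.exists_germ_eq a
    refine ⟨V ⊓ U, ⟨hV, x.2⟩, inf_le_right, resFun inf_le_left r, ?_⟩
    rw [← ha, ← hr]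
    congr 1
    exact X.presheaf.germ_res_apply (homOfLE inf_le_left) x.1 ⟨hV, x.2⟩ r
  choose V hxV hVU r hr using key
  have hne : ∀ x, Nonempty (V x) := fun x => ⟨⟨x.1, hxV x⟩⟩
  have hr' : ∀ x, X.germToFunctionField (V x) (r x) = h := fun x => by
    rw [← hr x]; exact (X.algebraMap_germ_eq_germToFunctionField (hxV x) (r x)).symm
  have hres : ∀ {A B : X.Opens} [Nonempty A] [Nonempty B] (hBA : B ≤ A) (s : Γ(X, A)),
      X.germToFunctionField B (resFun hBA s) = X.germToFunctionField A s := by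
    intro A B _ _ hBA s
    exact X.presheaf.germ_res_apply (homOfLE hBA) _ _ s
  obtain ⟨s, hs, -⟩ := X.sheaf.existsUnique_gluing' V U (fun x => homOfLE (hVU x))
    (fun x hx => Opens.mem_iSup.mpr ⟨⟨x, hx⟩, hxV ⟨x, hx⟩⟩) r (by
      intro x y
      have : Nonempty (V x ⊓ V y : X.Opens) := by
        refine ⟨⟨genericPoint X, ?_, ?_⟩⟩
        · exact ((genericPoint_spec X).mem_open_set_iff (V x).isOpen).mpr (by simpa using hne x)
        · exact ((genericPoint_spec X).mem_open_set_iff (V y).isOpen).mpr (by simpa using hne y)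
      apply X.germToFunctionField_injective (V x ⊓ V y)
      exact (hres inf_le_left (r x)).trans (((hr' x).trans (hr' y).symm).trans
        (hres inf_le_right (r y)).symm))
  refine ⟨s, ?_⟩
  obtain ⟨x⟩ := ‹Nonempty U›
  have := hne x
  rw [← hr' x, ← hs x]
  exact (hres (hVU x) s).symm

lemma exists_unit {U : X.Opens} [Nonempty U] (g : (X.functionField)ˣ)
    (hg : ∀ x ∈ U, g ∈ localUnits X x) :
    ∃ u : (Γ(X, U))ˣ, Units.map (X.germToFunctionField U).hom.toMonoidHom u = g := by
  obtain ⟨r, hr⟩ := exists_section (U := U) (g : X.functionField) (fun x hx => by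
    obtain ⟨u, hu⟩ := hg x hx
    exact ⟨u, congrArg Units.val hu⟩)
  obtain ⟨s, hs⟩ := exists_section (U := U) ((g⁻¹ : (X.functionField)ˣ) : X.functionField) (fun x hx => by
    obtain ⟨u, hu⟩ := (localUnits X x).inv_mem (hg x hx)
    exact ⟨u, congrArg Units.val hu⟩)
  have hrs : r * s = 1 := by
    apply X.germToFunctionField_injective U
    rw [map_mul, map_one, hr, hs, Units.mul_inv]
  exact ⟨⟨r, s, hrs, by rw [mul_comm, hrs]⟩, Units.ext hr⟩

variable (Λ : AddSubgroup (CDiv X))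

/-- A nonempty affine open set `V` on which the divisors of `Λ` are principal, with local equations
`f_V^l` chosen additively in `l ∈ Λ`. If `Λ` is free of finite rank, such sets `V` cover `X`; all of
them together are the open covering that is used for Čech cochains below. -/
structure Trivialization where
  V : X.Opens
  isAffineOpen : IsAffineOpen V
  nonempty : Nonempty V
  eqn : Λ →+ Additive (X.functionField)ˣ
  isLocalEquationAt : ∀ (l : Λ) (x : X), x ∈ V → IsLocalEquationAt l.1 x (eqn l).toMul

variable {Λ}

instance (s t : Trivialization Λ) : Nonempty (s.V ⊓ t.V : X.Opens) :=
  ⟨⟨genericPoint X,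
    ((genericPoint_spec X).mem_open_set_iff s.V.isOpen).mpr (by simpa using s.nonempty),
    ((genericPoint_spec X).mem_open_set_iff t.V.isOpen).mpr (by simpa using t.nonempty)⟩⟩

lemma units_germ_injective (U : X.Opens) [Nonempty U] :
    Function.Injective (Units.map (X.germToFunctionField U).hom.toMonoidHom) :=
  Units.map_injective (X.germToFunctionField_injective U)

lemma exists_transition (s t : Trivialization Λ) (l : Λ) :
    ∃ u : (Γ(X, s.V ⊓ t.V))ˣ, Units.map (X.germToFunctionField (s.V ⊓ t.V)).hom.toMonoidHom u =
      (s.eqn l).toMul⁻¹ * (t.eqn l).toMul :=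
  exists_unit _ fun x hx =>
    (s.isLocalEquationAt l x hx.1).div_mem (t.isLocalEquationAt l x hx.2)

/-- The transition functions `g_{st} = f_t / f_s`, invertible on `V_s ∩ V_t`. -/
def transition (s t : Trivialization Λ) : Λ →+ Additive (Γ(X, s.V ⊓ t.V))ˣ where
  toFun l := Additive.ofMul (exists_transition s t l).choose
  map_zero' := by
    apply Additive.toMul.injective
    apply units_germ_injective
    refine (exists_transition s t 0).choose_spec.trans ?_
    simp
  map_add' l m := by
    apply Additive.toMul.injective
    apply units_germ_injective
    refine (exists_transition s t (l + m)).choose_spec.trans ?_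
    refine Eq.trans ?_ (((Units.map (X.germToFunctionField (s.V ⊓ t.V)).hom.toMonoidHom).map_mul _ _).trans
      (congrArg₂ (· * ·) (exists_transition s t l).choose_spec (exists_transition s t m).choose_spec)).symm
    rw [s.eqn.map_add, t.eqn.map_add, toMul_add, toMul_add, mul_inv, mul_mul_mul_comm]

lemma transition_spec (s t : Trivialization Λ) (l : Λ) :
    Units.map (X.germToFunctionField (s.V ⊓ t.V)).hom.toMonoidHom (transition s t l).toMul =
      (s.eqn l).toMul⁻¹ * (t.eqn l).toMul :=
  (exists_transition s t l).choose_spec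

variable (f : X ⟶ Spec (.of ℂ))

/-- The cocycle `ψ_{st}(l) = dlog g_{st}^l`, a 1-form on `V_s ∩ V_t`. -/
def psi (s t : Trivialization Λ) : Λ →+ (toPMod (Omega f)).obj (op (s.V ⊓ t.V)) :=
  (dlog f (s.V ⊓ t.V)).comp (transition s t)

end Euler
section Euler2
variable {X : Scheme.{0}}

section Cech
variable (M : PMod X) {ι : Type} (U : ι → X.Opens)

/-- Čech 1-cocycles `c_{ik} = c_{ij} + c_{jk}` of `M` for the family `U` of open sets. -/
def cechZ1 : AddSubgroup (∀ i j : ι, M.obj (op (U i ⊓ U j))) where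
  carrier := {c | ∀ i j k : ι,
    resSec M (V := U i ⊓ U j ⊓ U k) (inf_le_inf_right _ inf_le_left) (c i k) =
      resSec M (V := U i ⊓ U j ⊓ U k) inf_le_left (c i j) +
      resSec M (V := U i ⊓ U j ⊓ U k) (inf_le_inf_right _ inf_le_right) (c j k)}
  zero_mem' := fun i j k => by simp
  add_mem' := fun {c d} hc hd i j k => by
    simp only [Pi.add_apply, map_add, hc i j k, hd i j k]
    abel
  neg_mem' := fun {c} hc i j k => by
    simp only [Pi.neg_apply, map_neg, hc i j k]
    abel

/-- The Čech coboundary `(b_i) ↦ (b_j - b_i)`. -/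
def cechD0 : (∀ i : ι, M.obj (op (U i))) →+ (∀ i j : ι, M.obj (op (U i ⊓ U j))) where
  toFun b i j := resSec M inf_le_right (b j) - resSec M inf_le_left (b i)
  map_zero' := by ext i j; simp
  map_add' b c := by
    ext i j
    simp only [Pi.add_apply, map_add]
    abel

/-- Čech cohomology `Ȟ¹(U, M)`. For a quasi-coherent sheaf and an affine open covering of a
separated scheme it is `H¹(X, M)`. -/
abbrev CechH1 : Type := cechZ1 M U ⧸ (cechD0 M U).range.addSubgroupOf (cechZ1 M U)
end Cech

section
variable (f : X ⟶ Spec (.of ℂ))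

/-- Restriction of invertible functions, in additive notation. -/
def resUnits {U V : X.Opens} (h : V ≤ U) : Additive (Γ(X, U))ˣ →+ Additive (Γ(X, V))ˣ :=
  (Units.map (resFun h).toMonoidHom).toAdditive

lemma resSec_dlog {U V : X.Opens} (h : V ≤ U) (u : Additive (Γ(X, U))ˣ) :
    resSec (toPMod (Omega f)) h (dlog f U u) = dlog f V (resUnits h u) := by
  change resSec (toPMod (Omega f)) h (((u.toMul⁻¹ : (Γ(X, U))ˣ) : Γ(X, U)) • diff f U (u.toMul : Γ(X, U))) = _
  rw [resSec_smul, resSec_diff]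
  rfl
end

variable [IsIntegral X] {Λ : AddSubgroup (CDiv X)} 

/-- Invertible functions as rational functions, in additive notation. -/
def germUnits (U : X.Opens) [Nonempty U] : Additive (Γ(X, U))ˣ →+ Additive (X.functionField)ˣ :=
  (Units.map (X.germToFunctionField U).hom.toMonoidHom).toAdditive

lemma germUnits_resUnits {U V : X.Opens} [Nonempty U] [Nonempty V] (h : V ≤ U)
    (u : Additive (Γ(X, U))ˣ) : germUnits V (resUnits h u) = germUnits U u := by
  apply Additive.toMul.injective
  apply Units.ext
  exact X.presheaf.germ_res_apply (homOfLE h) _ _ (u.toMul : Γ(X, U))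

lemma germUnits_transition (s t : Trivialization Λ) (l : Λ) :
    germUnits (s.V ⊓ t.V) (transition s t l) = t.eqn l - s.eqn l := by
  apply Additive.toMul.injective
  refine (transition_spec s t l).trans ?_
  rw [toMul_sub, div_eq_inv_mul]

variable (f : X ⟶ Spec (.of ℂ))

lemma genericPoint_mem_trivialization (t : Trivialization Λ) : genericPoint X ∈ t.V :=
  ((genericPoint_spec X).mem_open_set_iff t.V.isOpen).mpr (by simpa using t.nonempty)

lemma psi_cocycle (l : Λ) : (fun s t => psi f s t l) ∈
    cechZ1 (toPMod (Omega f)) (Trivialization.V (Λ := Λ)) := by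
  intro r s t
  have : Nonempty (r.V ⊓ s.V ⊓ t.V : X.Opens) :=
    ⟨⟨genericPoint X, ⟨genericPoint_mem_trivialization r, genericPoint_mem_trivialization s⟩,
      genericPoint_mem_trivialization t⟩⟩
  change resSec _ _ (dlog f _ (transition r t l)) = resSec _ _ (dlog f _ (transition r s l)) +
    resSec _ _ (dlog f _ (transition s t l))
  rw [resSec_dlog, resSec_dlog, resSec_dlog, ← map_add]
  congr 1
  apply Additive.toMul.injective
  apply units_germ_injective
  apply Additive.ofMul.injective
  change germUnits _ _ = germUnits _ _
  rw [map_add, germUnits_resUnits, germUnits_resUnits, germUnits_resUnits,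
    germUnits_transition, germUnits_transition, germUnits_transition]
  abel

/-- The first Chern class `c₁ : Λ → H¹(X, Ω_X)`, sending `l` to the class of `dlog g_{st}^l`. The
cohomology is computed by the affine open covering of `X` by trivializations of `Λ`. -/
def c1 : Λ →+ CechH1 (toPMod (Omega f)) (Trivialization.V (Λ := Λ)) :=
  (QuotientAddGroup.mk' _).comp
    { toFun := fun l => ⟨fun s t => psi f s t l, psi_cocycle f l⟩
      map_zero' := by
        ext s t; exact map_zero (psi f s t)
      map_add' := fun l m => by
        ext s t; exact map_add (psi f s t) l m }


end Euler2

section Extension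
open TensorProduct
variable {X : Scheme.{0}} (F : X.Modules) {T : Type} (V : T → X.Opens) {L : Type} [AddCommGroup L]
  (ψ : ∀ s t : T, L →+ (toPMod F).obj (op (V s ⊓ V t)))

variable (L) in
/-- Restriction of sections of `𝒪_X ⊗ L`. -/
def resTensor {U W : X.Opens} (h : W ≤ U) : Γ(X, U) ⊗[ℤ] L →+ Γ(X, W) ⊗[ℤ] L :=
  ((resFun h).toAddMonoidHom.toIntLinearMap.rTensor L).toAddMonoidHom

lemma resTensor_smul {U W : X.Opens} (h : W ≤ U) (r : Γ(X, U)) (x : Γ(X, U) ⊗[ℤ] L) :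
    resTensor L h (r • x) = resFun h r • resTensor L h x := by
  induction x with
  | zero => simp
  | add x y hx hy => simp only [smul_add, map_add, hx, hy]
  | tmul a l =>
    change resFun h (r * a) ⊗ₜ[ℤ] l = (resFun h r * resFun h a) ⊗ₜ[ℤ] l
    rw [map_mul]

lemma resTensor_resTensor {U W Y : X.Opens} (h : W ≤ U) (h' : Y ≤ W) (x : Γ(X, U) ⊗[ℤ] L) :
    resTensor L h' (resTensor L h x) = resTensor L (h'.trans h) x := by
  induction x with
  | zero => simp
  | add x y hx hy => simp only [map_add, hx, hy]
  | tmul a l => exact congrArg (· ⊗ₜ[ℤ] l) (resFun_resFun h h' a)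

lemma resTensor_self {U : X.Opens} (x : Γ(X, U) ⊗[ℤ] L) : resTensor L le_rfl x = x := by
  induction x with
  | zero => simp
  | add x y hx hy => simp only [map_add, hx, hy]
  | tmul a l => exact congrArg (· ⊗ₜ[ℤ] l) (resFun_self a)

/-- The `𝒪_X`-linear extension `𝒪_X ⊗ L → F` of `ψ_{st}`, on an open set `W ⊆ V_s ∩ V_t`. -/
def psiTensor (s t : T) {W : X.Opens} (hW : W ≤ V s ⊓ V t) :
    Γ(X, W) ⊗[ℤ] L →ₗ[Γ(X, W)] (toPMod F).obj (op W) :=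
  LinearMap.liftBaseChange Γ(X, W) ((resSec (toPMod F) hW).comp (ψ s t)).toIntLinearMap

lemma resSec_psiTensor (s t : T) {W W' : X.Opens} (h : W' ≤ W) (hW : W ≤ V s ⊓ V t)
    (x : Γ(X, W) ⊗[ℤ] L) :
    resSec (toPMod F) h (psiTensor F V ψ s t hW x) =
      psiTensor F V ψ s t (h.trans hW) (resTensor L h x) := by
  induction x with
  | zero => simp
  | add x y hx hy => simp only [map_add, hx, hy]
  | tmul a l =>
    change resSec _ h (a • resSec _ hW (ψ s t l)) = resFun h a • resSec _ _ (ψ s t l)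
    rw [resSec_smul, resSec_resSec]

/-- Sections over `U` of the extension of `𝒪_X ⊗ L` by `F` with cocycle `ψ`: they are given on
`U ∩ V_t` by pairs `(ω_t, λ)`, where `ω_t` is a section of `F` and `λ` one of `𝒪_X ⊗ L`, and the pairs
are glued by the rule `ω_t = ω_s + ψ_{st}(λ)` on `U ∩ V_s ∩ V_t`. -/
def extSections (U : X.Opens) : AddSubgroup
    ((∀ t : T, (toPMod F).obj (op (U ⊓ V t))) × Γ(X, U) ⊗[ℤ] L) where
  carrier := {x | ∀ s t : T,
    resSec (toPMod F) (V := U ⊓ (V s ⊓ V t)) (inf_le_inf_left _ inf_le_right) (x.1 t) =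
      resSec (toPMod F) (V := U ⊓ (V s ⊓ V t)) (inf_le_inf_left _ inf_le_left) (x.1 s) +
        psiTensor F V ψ s t inf_le_right (resTensor L inf_le_left x.2)}
  zero_mem' := fun s t => by simp
  add_mem' := fun {x y} hx hy s t => by
    simp only [Prod.fst_add, Prod.snd_add, Pi.add_apply, map_add, hx s t, hy s t]
    abel
  neg_mem' := fun {x} hx s t => by
    simp only [Prod.fst_neg, Prod.snd_neg, Pi.neg_apply, map_neg, hx s t]
    abel

/-- Multiplication of a section of the extension by a function. -/
def extSmul {U : X.Opens} (r : Γ(X, U)) (x : extSections F V ψ U) : extSections F V ψ U :=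
  ⟨(fun t => resFun (V := U ⊓ V t) inf_le_left r • x.1.1 t, r • x.1.2), fun s t => by
    change resSec _ _ (resFun (V := U ⊓ V t) inf_le_left r • x.1.1 t) =
      resSec _ _ (resFun (V := U ⊓ V s) inf_le_left r • x.1.1 s) +
        psiTensor F V ψ s t inf_le_right (resTensor L inf_le_left (r • x.1.2))
    rw [resSec_smul, resSec_smul, resTensor_smul, map_smul, x.2 s t, smul_add, resFun_resFun,
      resFun_resFun]⟩

/-- Sections of the extension over `U` form a module over `Γ(X, U)`. -/
@[reducible] def extModule (U : X.Opens) : Module Γ(X, U) (extSections F V ψ U) where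
  smul r x := extSmul F V ψ r x
  one_smul x := Subtype.ext <| Prod.ext (funext fun t => by
    change resFun (V := U ⊓ V t) inf_le_left 1 • x.1.1 t = x.1.1 t
    rw [map_one, one_smul]) (one_smul Γ(X, U) x.1.2)
  mul_smul r q x := Subtype.ext <| Prod.ext (funext fun t => by
    change resFun (V := U ⊓ V t) inf_le_left (r * q) • x.1.1 t =
      resFun (V := U ⊓ V t) inf_le_left r • resFun (V := U ⊓ V t) inf_le_left q • x.1.1 t
    rw [map_mul, mul_smul]) (mul_smul r q x.1.2)
  smul_zero r := Subtype.ext <| Prod.ext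
    (funext fun t => smul_zero (resFun (V := U ⊓ V t) inf_le_left r)) (smul_zero r)
  smul_add r x y := Subtype.ext <| Prod.ext
    (funext fun t => smul_add (resFun (V := U ⊓ V t) inf_le_left r) (x.1.1 t) (y.1.1 t))
    (smul_add r x.1.2 y.1.2)
  add_smul r q x := Subtype.ext <| Prod.ext (funext fun t => by
    change resFun (V := U ⊓ V t) inf_le_left (r + q) • x.1.1 t =
      resFun (V := U ⊓ V t) inf_le_left r • x.1.1 t + resFun (V := U ⊓ V t) inf_le_left q • x.1.1 t
    rw [map_add, add_smul]) (add_smul r q x.1.2)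
  zero_smul x := Subtype.ext <| Prod.ext (funext fun t => by
    change resFun (V := U ⊓ V t) inf_le_left 0 • x.1.1 t = 0
    rw [map_zero, zero_smul]) (zero_smul Γ(X, U) x.1.2)

/-- Restriction of sections of the extension. -/
def extRes {U W : X.Opens} (h : W ≤ U) : extSections F V ψ U →+ extSections F V ψ W where
  toFun x := ⟨(fun t => resSec (toPMod F) (inf_le_inf_right (V t) h) (x.1.1 t), resTensor L h x.1.2), fun s t => by
    have := congrArg (resSec (toPMod F) (inf_le_inf_right (V s ⊓ V t) h)) (x.2 s t)
    simp only [map_add, resSec_psiTensor, resSec_resSec, resTensor_resTensor] at this ⊢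
    exact this⟩
  map_zero' := Subtype.ext <| Prod.ext (funext fun _ => map_zero _) (map_zero _)
  map_add' x y := Subtype.ext <| Prod.ext (funext fun _ => map_add _ _ _) (map_add _ _ _)


lemma extRes_self {U : X.Opens} (x : extSections F V ψ U) : extRes F V ψ le_rfl x = x :=
  Subtype.ext <| Prod.ext (funext fun t => resSec_self (toPMod F) (x.1.1 t))
    (resTensor_self x.1.2)

lemma extRes_extRes {U W Y : X.Opens} (h : W ≤ U) (h' : Y ≤ W) (x : extSections F V ψ U) :
    extRes F V ψ h' (extRes F V ψ h x) = extRes F V ψ (h'.trans h) x :=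
  Subtype.ext <| Prod.ext (funext fun t => resSec_resSec (toPMod F) _ _ (x.1.1 t))
    (resTensor_resTensor h h' x.1.2)

lemma extRes_smul {U W : X.Opens} (h : W ≤ U) (r : Γ(X, U)) (x : extSections F V ψ U) :
    extRes F V ψ h (extSmul F V ψ r x) = extSmul F V ψ (resFun h r) (extRes F V ψ h x) := by
  refine Subtype.ext <| Prod.ext (funext fun t => ?_) (resTensor_smul h r x.1.2)
  change resSec (toPMod F) _ (resFun (V := U ⊓ V t) inf_le_left r • x.1.1 t) =
    resFun (V := W ⊓ V t) inf_le_left (resFun h r) • resSec (toPMod F) _ (x.1.1 t)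
  rw [resSec_smul, resFun_resFun, resFun_resFun]

/-- The extension of `𝒪_X ⊗ L` by `F` with cocycle `ψ`, as a presheaf of modules. -/
def extPresheaf : PMod X :=
  letI (U : X.Opensᵒᵖ) : Module ((X.presheaf ⋙ forget₂ CommRingCat RingCat).obj U)
      ((AddCommGrpCat.of (extSections F V ψ U.unop) : Type 0)) := extModule F V ψ U.unop
  PresheafOfModules.ofPresheaf
    { obj := fun U => AddCommGrpCat.of (extSections F V ψ U.unop)
      map := fun {A B} i => AddCommGrpCat.ofHom (extRes F V ψ i.unop.le)
      map_id := fun U => AddCommGrpCat.hom_ext (AddMonoidHom.ext fun x => extRes_self F V ψ x)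
      map_comp := fun i j => AddCommGrpCat.hom_ext (AddMonoidHom.ext fun x =>
        (extRes_extRes F V ψ i.unop.le j.unop.le x).symm) }
    (fun A B i r x => extRes_smul F V ψ i.unop.le r x)

section Sheaf

lemma existsUnique_glue (F : X.Modules) {ι : Type} (U : ι → X.Opens) (W : X.Opens)
    (hU : ∀ i, U i ≤ W) (hW : W ≤ iSup U) (s : ∀ i, (toPMod F).obj (op (U i)))
    (hs : ∀ i j, resSec (toPMod F) (V := U i ⊓ U j) inf_le_left (s i) =
      resSec (toPMod F) (V := U i ⊓ U j) inf_le_right (s j)) :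
    ∃! x : (toPMod F).obj (op W), ∀ i, resSec (toPMod F) (hU i) x = s i :=
  by
  obtain ⟨x, hx, hx'⟩ := TopCat.Sheaf.existsUnique_gluing'
    (⟨F.presheaf, F.isSheaf⟩ : TopCat.Sheaf Ab X) U W (fun i => homOfLE (hU i)) hW
    (fun i => (s i : (toPMod F).obj (op (U i)))) (fun i j => hs i j)
  exact ⟨x, fun i => hx i, fun y hy => hx' y fun i => hy i⟩

lemma eq_of_locally (F : X.Modules) {ι : Type} (U : ι → X.Opens) (W : X.Opens)
    (hU : ∀ i, U i ≤ W) (hW : W ≤ iSup U) (x y : (toPMod F).obj (op W))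
    (h : ∀ i, resSec (toPMod F) (hU i) x = resSec (toPMod F) (hU i) y) : x = y :=
  (existsUnique_glue F U W hU hW (fun i => resSec (toPMod F) (hU i) y) fun i j => by
    rw [resSec_resSec, resSec_resSec]).unique h fun _ => rfl

lemma existsUnique_glueFun {ι : Type} (U : ι → X.Opens) (W : X.Opens)
    (hU : ∀ i, U i ≤ W) (hW : W ≤ iSup U) (s : ∀ i, Γ(X, U i))
    (hs : ∀ i j, resFun (V := U i ⊓ U j) inf_le_left (s i) =
      resFun (V := U i ⊓ U j) inf_le_right (s j)) :
    ∃! x : Γ(X, W), ∀ i, resFun (hU i) x = s i :=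
  X.sheaf.existsUnique_gluing' U W (fun i => homOfLE (hU i)) hW s (fun i j => hs i j)

variable [Module.Free ℤ L] [Module.Finite ℤ L]

lemma existsUnique_glueTensor {ι : Type} (U : ι → X.Opens) (W : X.Opens)
    (hU : ∀ i, U i ≤ W) (hW : W ≤ iSup U) (s : ∀ i, Γ(X, U i) ⊗[ℤ] L)
    (hs : ∀ i j, resTensor L (W := U i ⊓ U j) inf_le_left (s i) =
      resTensor L (W := U i ⊓ U j) inf_le_right (s j)) :
    ∃! x : Γ(X, W) ⊗[ℤ] L, ∀ i, resTensor L (hU i) x = s i := by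
  classical
  let b := Module.Free.chooseBasis ℤ L
  have nat : ∀ {A B : X.Opens} (h : B ≤ A) (x : Γ(X, A) ⊗[ℤ] L) k,
      (b.baseChange Γ(X, B)).repr (resTensor L h x) k = resFun h ((b.baseChange Γ(X, A)).repr x k) := by
    intro A B h x k
    induction x with
    | zero => simp
    | add x y hx hy => simp only [map_add, Finsupp.add_apply, hx, hy]
    | tmul a l =>
      change (b.baseChange Γ(X, B)).repr (resFun h a ⊗ₜ[ℤ] l) k = _
      simp [Module.Basis.baseChange_repr_tmul]
  have key : ∀ k, ∃! x : Γ(X, W), ∀ i, resFun (hU i) x = (b.baseChange Γ(X, U i)).repr (s i) k := by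
    intro k
    refine existsUnique_glueFun U W hU hW _ fun i j => ?_
    rw [← nat, ← nat, hs]
  choose y hy hy' using key
  refine ⟨(b.baseChange Γ(X, W)).equivFun.symm y, fun i => ?_, fun z hz => ?_⟩
  · apply (b.baseChange Γ(X, U i)).repr.injective
    ext k
    rw [nat, ← hy k i]
    congr 1
    exact congrFun ((b.baseChange Γ(X, W)).equivFun.apply_symm_apply y) k
  · apply (b.baseChange Γ(X, W)).equivFun.injective
    rw [LinearEquiv.apply_symm_apply]
    funext k
    refine hy' k _ fun i => ?_
    rw [← hz i, nat]; rfl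

lemma extPresheaf_isSheaf : TopCat.Presheaf.IsSheaf (extPresheaf F V ψ).presheaf := by
  rw [TopCat.Presheaf.isSheaf_iff_isSheafUniqueGluing]
  intro ι U sf hsf
  change ∀ i, extSections F V ψ (U i) at sf
  have hsf' : ∀ i j, extRes F V ψ (W := U i ⊓ U j) inf_le_left (sf i) =
      extRes F V ψ (W := U i ⊓ U j) inf_le_right (sf j) := hsf
  suffices h : ∃! x : extSections F V ψ (iSup U), ∀ i, extRes F V ψ (le_iSup U i) x = sf i from h
  have hle : ∀ i, U i ≤ iSup U := le_iSup U
  have hcov : ∀ A : X.Opens, iSup U ⊓ A ≤ ⨆ i, U i ⊓ A := fun A => (iSup_inf_eq U A).le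
  have h1 := fun t => existsUnique_glue F (fun i => U i ⊓ V t) (iSup U ⊓ V t)
    (fun i => inf_le_inf_right _ (hle i)) (hcov _) (fun i => (sf i).1.1 t) (fun i j => by
      have e : U i ⊓ V t ⊓ (U j ⊓ V t) ≤ U i ⊓ U j ⊓ V t :=
        le_inf (inf_le_inf inf_le_left inf_le_left) (inf_le_left.trans inf_le_right)
      have := congrArg (fun x : extSections F V ψ (U i ⊓ U j) =>
        resSec (toPMod F) e (x.1.1 t)) (hsf' i j)
      refine Eq.trans ?_ (this.trans ?_)
      · exact (resSec_resSec (toPMod F) _ e _).symm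
      · exact resSec_resSec (toPMod F) _ e _)
  have h2 := existsUnique_glueTensor U (iSup U) hle le_rfl (fun i => (sf i).1.2)
    (fun i j => congrArg (fun x : extSections F V ψ (U i ⊓ U j) => x.1.2) (hsf' i j))
  choose ω hω hω' using h1
  obtain ⟨l, hl, hl'⟩ := h2
  refine ⟨⟨(ω, l), fun s t => ?_⟩, fun i => ?_, fun y hy => ?_⟩
  · refine eq_of_locally F (fun i => U i ⊓ (V s ⊓ V t)) _ (fun i => inf_le_inf_right _ (hle i))
      (hcov _) _ _ fun i => ?_
    have := (sf i).2 s t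
    rw [← hω t i, ← hω s i, ← hl i] at this
    simp only [map_add, resSec_psiTensor, resSec_resSec, resTensor_resTensor] at this ⊢
    exact this
  · exact Subtype.ext <| Prod.ext (funext fun t => hω t i) (hl i)
  · refine Subtype.ext <| Prod.ext (funext fun t => ?_) ?_
    · exact hω' t _ fun i => congrArg (fun x : extSections F V ψ (U i) => x.1.1 t) (hy i)
    · exact hl' _ fun i => congrArg (fun x : extSections F V ψ (U i) => x.1.2) (hy i)

/-- The extension `0 → F → extSheaf → 𝒪_X ⊗ L → 0` with cocycle `ψ`. -/
def extSheaf : X.Modules := ⟨extPresheaf F V ψ, extPresheaf_isSheaf F V ψ⟩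

end Sheaf

end Extension
section Main
attribute [local instance] MvPolynomial.gradedAlgebra

variable {X : Scheme.{0}}

/-- The sheaf `R_Λ`, the middle term of the generalized Euler sequence
`0 → Ω_X → R_Λ → 𝒪_X ⊗ Λ → 0` whose extension class is the inclusion `c₁` of `Λ` into `H¹(X, Ω_X)`: the
extension with cocycle `dlog g_{st}`. -/
def eulerSheaf [IsIntegral X] (f : X ⟶ Spec (.of ℂ)) (Λ : AddSubgroup (CDiv X))
    [Module.Free ℤ Λ] [Module.Finite ℤ Λ] : X.Modules :=
  extSheaf (Omega f) (Trivialization.V (Λ := Λ)) (L := Λ) (psi f)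

/-- A Cartier divisor `D` is ample if, for every coherent sheaf `F`, all the twists `F(nD)` with `n`
large enough are generated by global sections. -/
def IsAmple [IsIntegral X] (D : CDiv X) : Prop :=
  ∀ F : X.Modules, IsCoherent F → ∃ n₀ : ℕ, ∀ n : ℕ, n₀ ≤ n → IsGloballyGenerated (twist F (n • D))

/-- The projective space `ℙⁿ` over `ℂ`. -/
abbrev projSpace (n : ℕ) : Scheme.{0} :=
  Proj (MvPolynomial.homogeneousSubmodule (Fin (n + 1)) ℂ)

/-- The structure morphism of `ℙⁿ`. -/
def projSpaceHom (n : ℕ) : projSpace n ⟶ Spec (.of ℂ) :=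
  Proj.toSpecZero (MvPolynomial.homogeneousSubmodule (Fin (n + 1)) ℂ) ≫
    Spec.map (CommRingCat.ofHom
      (algebraMap ℂ (MvPolynomial.homogeneousSubmodule (Fin (n + 1)) ℂ 0)))

/-- A scheme over `ℂ` is projective if it is isomorphic to a closed subscheme of some `ℙⁿ`. -/
def IsProjective (f : X ⟶ Spec (.of ℂ)) : Prop :=
  ∃ (n : ℕ) (i : X ⟶ projSpace n), IsClosedImmersion i ∧ i ≫ projSpaceHom n = f

/-- A scheme is normal if its local rings are integrally closed domains (for an integral scheme
they are always domains). -/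
def IsNormal (X : Scheme.{0}) : Prop := ∀ x : X, IsIntegrallyClosed (X.presheaf.stalk x)

end Main

end CoxEuler

end

/-! Write S for the Cox ring, R for the sheaf `eulerSheaf f Λ` and K for the function field.

(1) implies (3). A reflexive sheaf F embeds in its bidual, so its sections are separated by linear
functionals with values in K (`genericDual`, `separates_of_isReflexive`). These form a
finite-dimensional K-vector space, because F is generated by finitely many sections near the generic
point. Each functional has bounded poles, and ampleness supplies a nonzero q such that q times the
functional maps F into the sheaf of some divisor in Λ (`exists_mapsInto`,
`exists_denominator_ample`). Finitely many such functionals embed the module of sections of F into a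
power of S, linearly and with a shift of degrees (`finite_sectionModule`). If S is a finitely
generated algebra it is noetherian, so this submodule is finitely generated.

(3) implies (2). Over each trivializing open set R is the direct sum of the sheaf of differentials
and a free sheaf of finite rank, and reflexivity is a local property stable under such sums
(`isReflexive_of_localSplitting`).

(2) implies (1). Countably many nonzero classes avoid the kernel of a suitable complex linear
functional on cohomology. Composed with c₁ it gives an additive L : Λ → ℂ with L(l) ≠ 0 for l ≠ 0,
because c₁ is injective (`exists_chern_functional`). The morphism (ω, ℓ) ↦ L(ℓ) from R to the
structure sheaf induces an S-linear map from the sections of R to S, and its image is exactly the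
sum of the pieces of nonzero degree:

In degree l, let h be a section of the sheaf of D_l and let f_t be local equations. The generalized
Euler formula says that the local sections (d(h f_t), h f_t ⊗ l) ⊗ f_t⁻¹ glue, because d(gp) = g (dp
+ p dlog g). The glued section maps to L(l) h (`exists_eulerDual_eq`).

In degree 0, global regular functions are constant, so a section of R gives an element of Λ ⊗ ℂ
whose class in cohomology is zero, and L kills it (`globalVal_eulerDual_zero`).

Hence the ideal of elements without component of degree 0 is generated by finitely many homogeneous
elements h_k of degrees l_k ≠ 0. As S⁰ = ℂ, it remains to see that repeatedly writing an element as
a combination of the h_k terminates, although Λ has no positive grading. Since c₁(l_k) ≠ 0, each h_k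
has a zero x_k (`exists_zero`). For a divisor D, the least N such that no nonzero section of D
vanishes to order N at x_k exists by finite-dimensionality and Krull's intersection theorem. It does
not grow when an effective divisor is subtracted from D, and it drops when the divisor of h_k is
subtracted and D has nonzero sections (`exists_measure`). The sum over k of these numbers is the
induction parameter in `mem_of_generators`. -/

noncomputable section
namespace CoxEuler

/-! ### Finite presentations and free direct summands -/

section Presentations
open Limits SheafOfModules

variable {C : Type} [Category.{0} C] {J : GrothendieckTopology C} {R : Sheaf J RingCat.{0}}
  [HasSheafify J AddCommGrpCat.{0}] [J.WEqualsLocallyBijective AddCommGrpCat.{0}]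

lemma free_hom_ext {I : Type} {M : SheafOfModules.{0} R} {f g : free I ⟶ M}
    (h : ∀ i, ιFree i ≫ f = ιFree i ≫ g) : f = g :=
  Cofan.IsColimit.hom_ext (isColimitFreeCofan I) _ _ h

/-- The morphism from a free sheaf given by a family of morphisms from the unit. -/
def freeDesc {I : Type} {M : SheafOfModules.{0} R} (f : I → (unit R ⟶ M)) : free I ⟶ M :=
  Cofan.IsColimit.desc (isColimitFreeCofan I) f

@[simp]
lemma ιFree_freeDesc {I : Type} {M : SheafOfModules.{0} R} (f : I → (unit R ⟶ M)) (i : I) :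
    ιFree i ≫ freeDesc f = f i :=
  Cofan.IsColimit.fac (isColimitFreeCofan I) f i

@[simp]
lemma ιFree_freeDesc_assoc {I : Type} {M N : SheafOfModules.{0} R} (f : I → (unit R ⟶ M)) (i : I)
    (g : M ⟶ N) : ιFree i ≫ freeDesc f ≫ g = f i ≫ g := by
  rw [← Category.assoc, ιFree_freeDesc]

/-- A direct sum decomposition `E ≅ A ⊕ Rᵏ` in the category of sheaves of modules. -/
structure FreeComplement (A E : SheafOfModules.{0} R) (κ : Type) [Fintype κ] where
  i : A ⟶ E
  p : E ⟶ A
  q : κ → (E ⟶ unit R)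
  s : κ → (unit R ⟶ E)
  i_p : i ≫ p = 𝟙 A
  i_q : ∀ k, i ≫ q k = 0
  s_p : ∀ k, s k ≫ p = 0
  s_q_self : ∀ k, s k ≫ q k = 𝟙 _
  s_q_ne : ∀ k l, k ≠ l → s k ≫ q l = 0
  total : p ≫ i + ∑ k, q k ≫ s k = 𝟙 E

variable {A E : SheafOfModules.{0} R} {κ : Type} [Fintype κ]

/-- The generators of A and a basis of the free summand generate E, and the relations of A are still
all the relations. -/
lemma FreeComplement.exists_presentation (D : FreeComplement A E κ) (P : A.Presentation) [P.IsFinite] :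
    ∃ Q : E.Presentation, Q.IsFinite := by
  classical
  let a : free P.relations.I ⟶ free P.generators.I :=
    (freeHomEquiv _).symm P.relations.s ≫ kernel.ι _
  let a' : free P.relations.I ⟶ free (P.generators.I ⊕ κ) := a ≫ freeMap Sum.inl
  let g : free (P.generators.I ⊕ κ) ⟶ E := freeDesc (Sum.elim
    (fun j => ιFree j ≫ P.generators.π ≫ D.i) D.s)
  have hg1 : freeMap Sum.inl ≫ g = P.generators.π ≫ D.i := free_hom_ext fun j => by simp [g]
  have hg2 : ∀ k, ιFree (Sum.inr k) ≫ g = D.s k := fun k => by simp [g]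
  have ha : a ≫ P.generators.π = 0 := by simp [a]
  have H : a' ≫ g = 0 := by
    rw [Category.assoc, hg1, reassoc_of% ha, zero_comp]
  have hcol := P.isColimit
  have hg : Epi g := ⟨fun {Z} x y hxy => by
    have h1 : D.i ≫ x = D.i ≫ y := by
      rw [← cancel_epi P.generators.π, ← reassoc_of% hg1, hxy, reassoc_of% hg1]
    have h2 : ∀ k, D.s k ≫ x = D.s k ≫ y := fun k => by
      rw [← hg2, Category.assoc, hxy, Category.assoc]
    rw [← Category.id_comp x, ← Category.id_comp y, ← D.total, Preadditive.add_comp,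
      Preadditive.add_comp, Preadditive.sum_comp, Preadditive.sum_comp]
    simp only [Category.assoc, h1, h2]⟩
  have hd {Z : SheafOfModules.{0} R} (k : free (P.generators.I ⊕ κ) ⟶ Z) (hk : a' ≫ k = 0) :
      ∃ d : A ⟶ Z, P.generators.π ≫ d = freeMap Sum.inl ≫ k := by
    have h0 : a ≫ freeMap Sum.inl ≫ k = 0 := by
      rw [← hk]; exact (Category.assoc _ _ _).symm
    exact ⟨_, Cofork.IsColimit.π_desc' hcol (freeMap Sum.inl ≫ k) (h0.trans zero_comp.symm)⟩
  have hdesc {Z : SheafOfModules.{0} R} (k : free (P.generators.I ⊕ κ) ⟶ Z) (hk : a' ≫ k = 0) :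
      ∃ l : E ⟶ Z, g ≫ l = k := by
    obtain ⟨d, hd⟩ := hd k hk
    -- On the summand A the descended morphism is d, which exists since k kills the relations of A;
    -- on the free summand it is read off from the values of k on the added generators.
    refine ⟨D.p ≫ d + ∑ j, D.q j ≫ ιFree (Sum.inr j) ≫ k, free_hom_ext ?_⟩
    rintro (j | j)
    · have : ιFree (R := R) (Sum.inl j : P.generators.I ⊕ κ) ≫ g =
          ιFree j ≫ P.generators.π ≫ D.i := by simp [g]
      rw [reassoc_of% this, Preadditive.comp_add, Preadditive.comp_sum, reassoc_of% D.i_p,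
        Finset.sum_eq_zero fun l _ => by rw [reassoc_of% D.i_q l, zero_comp], add_zero, hd,
        ιFree_freeMap_assoc]
    · rw [reassoc_of% hg2 j, Preadditive.comp_add, Preadditive.comp_sum, reassoc_of% D.s_p j,
        zero_comp, zero_add, Finset.sum_eq_single j, reassoc_of% D.s_q_self j]
      · intro l _ hl
        rw [reassoc_of% D.s_q_ne j l hl.symm, zero_comp]
      · simp
  have hcolim : IsColimit (CokernelCofork.ofπ g H) :=
    CokernelCofork.IsColimit.ofπ' g H fun k hk => ⟨_, (hdesc k hk).choose_spec⟩
  exact ⟨presentationOfIsCokernelFree a' g H hcolim,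
    { isFiniteType_generators := ⟨inferInstanceAs (Finite (P.generators.I ⊕ κ))⟩
      isFiniteType_relations := ⟨inferInstanceAs (Finite P.relations.I)⟩ }⟩

/-- The unit is free on one generator. The presentation map is then a monomorphism, its kernel is
zero, and an empty set of relations suffices. -/
lemma exists_presentation_unit : ∃ Q : (unit R).Presentation, Q.IsFinite := by
  let P : (free (R := R) PUnit).Presentation :=
    { generators := free.generatingSections PUnit
      relations :=
        { I := Empty
          s := Empty.elim
          epi := IsZero.epi (IsZero.of_iso (isZero_zero _) (Limits.kernel.ofMono _)) _ } }
  have : P.IsFinite :=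
    { isFiniteType_generators := ⟨inferInstanceAs (Finite PUnit)⟩
      isFiniteType_relations := ⟨inferInstanceAs (Finite Empty)⟩ }
  let e : free (R := R) PUnit ⟶ unit R := freeDesc fun _ => 𝟙 _
  have : IsIso e := ⟨ιFree PUnit.unit, free_hom_ext fun i => by simp [e], by simp [e]⟩
  exact ⟨P.ofIsIso e, inferInstance⟩

end Presentations
end CoxEuler
end

noncomputable section
namespace CoxEuler

/-! ### Sheaves that are locally a sum of a given sheaf and a free sheaf -/

section LocalSplitting
open SheafOfModules

variable {X : Scheme.{0}}

/-- A morphism of restricted sheaves, from its components on the open subsets of `V`. -/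
def overHom {M N : X.Modules} {V : X.Opens}
    (φ : ∀ W : X.Opens, W ≤ V → (toPMod M).obj (op W) →ₗ[Γ(X, W)] (toPMod N).obj (op W))
    (hφ : ∀ (W W' : X.Opens) (h : W ≤ V) (h' : W' ≤ W) (m : (toPMod M).obj (op W)),
      φ W' (h'.trans h) (resSec (toPMod M) h' m) = resSec (toPMod N) h' (φ W h m)) :
    SheafOfModules.over (R := X.ringCatSheaf) M V ⟶ SheafOfModules.over (R := X.ringCatSheaf) N V :=
  ⟨{ app := fun Y => ModuleCat.ofHom (X := ((SheafOfModules.over (R := X.ringCatSheaf) M V).val.obj Y))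
        (Y := ((SheafOfModules.over (R := X.ringCatSheaf) N V).val.obj Y))
        { toFun := fun m => φ Y.unop.left Y.unop.hom.le m
          map_add' := fun m n => map_add (φ Y.unop.left Y.unop.hom.le) m n
          map_smul' := fun r m => (φ Y.unop.left Y.unop.hom.le).map_smul r m }
     naturality := fun {Y Y'} f => by
      ext m
      exact hφ Y.unop.left Y'.unop.left Y.unop.hom.le f.unop.left.le m }⟩

lemma overHom_ext {V : X.Opens} {M N : SheafOfModules (X.ringCatSheaf.over V)} {f g : M ⟶ N}
    (h : ∀ (W : X.Opens) (hW : W ≤ V) (m : M.val.obj (op (Over.mk (homOfLE hW)))),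
      f.val.app (op (Over.mk (homOfLE hW))) m = g.val.app (op (Over.mk (homOfLE hW))) m) : f = g := by
  ext Y m
  exact h Y.unop.left Y.unop.hom.le m

/-- Evaluation of morphisms at a section. -/
def evalHom {C : Type} [Category.{0} C] {J : GrothendieckTopology C} {R : Sheaf J RingCat.{0}}
    (M N : SheafOfModules.{0} R) (Y : Cᵒᵖ) (m : M.val.obj Y) : (M ⟶ N) →+ N.val.obj Y where
  toFun f := f.val.app Y m
  map_zero' := rfl
  map_add' _ _ := rfl

/-- A direct sum decomposition `E ≅ A ⊕ 𝒪ᵏ` over the open set `V`, in terms of sections. -/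
structure LocalSplitting (A E : X.Modules) (V : X.Opens) (κ : Type) [Fintype κ] where
  p : ∀ W : X.Opens, W ≤ V → (toPMod E).obj (op W) →ₗ[Γ(X, W)] (toPMod A).obj (op W)
  i : ∀ W : X.Opens, W ≤ V → (toPMod A).obj (op W) →ₗ[Γ(X, W)] (toPMod E).obj (op W)
  q : ∀ W : X.Opens, W ≤ V → κ → (toPMod E).obj (op W) →ₗ[Γ(X, W)] Γ(X, W)
  s : κ → (toPMod E).obj (op V)
  p_res : ∀ (W W' : X.Opens) (h : W ≤ V) (h' : W' ≤ W) (m : (toPMod E).obj (op W)),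
    p W' (h'.trans h) (resSec (toPMod E) h' m) = resSec (toPMod A) h' (p W h m)
  i_res : ∀ (W W' : X.Opens) (h : W ≤ V) (h' : W' ≤ W) (m : (toPMod A).obj (op W)),
    i W' (h'.trans h) (resSec (toPMod A) h' m) = resSec (toPMod E) h' (i W h m)
  q_res : ∀ (W W' : X.Opens) (h : W ≤ V) (h' : W' ≤ W) (k : κ) (m : (toPMod E).obj (op W)),
    q W' (h'.trans h) k (resSec (toPMod E) h' m) = resFun h' (q W h k m)
  p_i : ∀ W h a, p W h (i W h a) = a
  q_i : ∀ W h k a, q W h k (i W h a) = 0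
  p_s : ∀ W h k, p W h (resSec (toPMod E) h (s k)) = 0
  q_s_self : ∀ W h k, q W h k (resSec (toPMod E) h (s k)) = 1
  q_s_ne : ∀ W h k l, k ≠ l → q W h l (resSec (toPMod E) h (s k)) = 0
  total : ∀ W h m, i W h (p W h m) + ∑ k, q W h k m • resSec (toPMod E) h (s k) = m

variable {A E : X.Modules} {V : X.Opens} {κ : Type} [Fintype κ]

/-- The structure sheaf as a sheaf of modules. -/
def unitModule (X : Scheme.{0}) : X.Modules := SheafOfModules.unit X.ringCatSheaf

/-- The decomposition of the restricted sheaves defined by a local splitting. -/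
def LocalSplitting.freeComplement (D : LocalSplitting A E V κ) :
    FreeComplement (SheafOfModules.over (R := X.ringCatSheaf) A V)
      (SheafOfModules.over (R := X.ringCatSheaf) E V) κ where
  i := overHom D.i D.i_res
  p := overHom D.p D.p_res
  q k := overHom (N := unitModule X) (fun W h => D.q W h k) (fun W W' h h' m => D.q_res W W' h h' k m)
  s k := overHom (M := unitModule X)
    (fun W h => LinearMap.toSpanSingleton Γ(X, W) _ (resSec (toPMod E) h (D.s k)))
    (fun W W' h h' (r : Γ(X, W)) => by
      change resFun h' r • resSec (toPMod E) (h'.trans h) (D.s k) =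
        resSec (toPMod E) h' (r • resSec (toPMod E) h (D.s k))
      rw [resSec_smul, resSec_resSec])
  i_p := overHom_ext fun W h a => D.p_i W h a
  i_q k := overHom_ext fun W h a => D.q_i W h k a
  s_p k := overHom_ext fun W h (r : Γ(X, W)) =>
    ((D.p W h).map_smul r _).trans ((congrArg (r • ·) (D.p_s W h k)).trans (smul_zero (A := (toPMod A).obj (op W)) r))
  s_q_self k := overHom_ext fun W h (r : Γ(X, W)) =>
    ((D.q W h k).map_smul r _).trans ((congrArg (r • ·) (D.q_s_self W h k)).trans (mul_one r))
  s_q_ne k l hkl := overHom_ext fun W h (r : Γ(X, W)) =>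
    ((D.q W h l).map_smul r _).trans ((congrArg (r • ·) (D.q_s_ne W h k l hkl)).trans (mul_zero r))
  total := overHom_ext fun W h m => by
    refine Eq.trans ?_ (D.total W h m)
    exact congrArg (D.i W h (D.p W h m) + ·) (map_sum (evalHom _ _ _ m) _ _)

/-- Restriction of a local splitting to a smaller open set. -/
def LocalSplitting.restrict (D : LocalSplitting A E V κ) {V' : X.Opens} (hV : V' ≤ V) :
    LocalSplitting A E V' κ where
  p W h := D.p W (h.trans hV)
  i W h := D.i W (h.trans hV)
  q W h := D.q W (h.trans hV)
  s k := resSec (toPMod E) hV (D.s k)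
  p_res W W' h := D.p_res W W' (h.trans hV)
  i_res W W' h := D.i_res W W' (h.trans hV)
  q_res W W' h := D.q_res W W' (h.trans hV)
  p_i W h := D.p_i W (h.trans hV)
  q_i W h := D.q_i W (h.trans hV)
  p_s W h k := by rw [resSec_resSec]; exact D.p_s W (h.trans hV) k
  q_s_self W h k := by rw [resSec_resSec]; exact D.q_s_self W (h.trans hV) k
  q_s_ne W h k := by rw [resSec_resSec]; exact D.q_s_ne W (h.trans hV) k
  total W h m := by simp only [resSec_resSec]; exact D.total W (h.trans hV) m

lemma exists_presentation_restrict {M : X.Modules} {U V : X.Opens} (h : V ≤ U)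
    (P : (SheafOfModules.over (R := X.ringCatSheaf) M U).Presentation) [P.IsFinite] :
    ∃ Q : (SheafOfModules.over (R := X.ringCatSheaf) M V).Presentation, Q.IsFinite := by
  let Q := P.map (overMap X.ringCatSheaf (homOfLE h)) (overMapUnitIso (R := X.ringCatSheaf) (homOfLE h)).symm
  have : Q.IsFinite :=
    { isFiniteType_generators := ⟨inferInstanceAs (Finite P.generators.I)⟩
      isFiniteType_relations := ⟨inferInstanceAs (Finite P.relations.I)⟩ }
  exact ⟨Q.ofIsIso ((overFunctorMap X.ringCatSheaf (homOfLE h)).app M).hom, inferInstance⟩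

/-- The presentations of A restrict to the intersections of its presenting cover with the sets V_t,
where the free summand can be added. -/
lemma isCoherent_of_localSplitting {T : Type} {V : T → X.Opens} (hV : ∀ x, ∃ t, x ∈ V t)
    (D : ∀ t, LocalSplitting A E (V t) κ) (hA : IsCoherent A) : IsCoherent E := by
  obtain ⟨σ, hσ⟩ := hA.exists_quasicoherentData
  have key (t : T) (j : σ.I) :
      ∃ Q : (SheafOfModules.over (R := X.ringCatSheaf) E (V t ⊓ σ.X j)).Presentation, Q.IsFinite := by
    have := hσ.isFinite_presentation j
    obtain ⟨P, hP⟩ := exists_presentation_restrict (inf_le_right : V t ⊓ σ.X j ≤ σ.X j)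
      (σ.presentation j)
    exact ((D t).restrict inf_le_left).freeComplement.exists_presentation P
  choose Q hQ using key
  let τ : QuasicoherentData (R := X.ringCatSheaf) E :=
    { I := T × σ.I
      X := fun a => V a.1 ⊓ σ.X a.2
      coversTop := by
        have h := σ.coversTop
        rw [Opens.coversTop_iff] at h ⊢
        refine IsOpenCover.mk (top_le_iff.mp fun x _ => ?_)
        obtain ⟨t, ht⟩ := hV x
        obtain ⟨j, hj⟩ := h.exists_mem x
        exact Opens.mem_iSup.mpr ⟨(t, j), ht, hj⟩
      presentation := fun a => Q a.1 a.2 }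
  have : τ.IsFinitePresentation := ⟨fun a => hQ a.1 a.2⟩
  exact ⟨⟨τ, this⟩⟩

lemma isCoherent_unitModule : IsCoherent (unitModule X) := by
  obtain ⟨P, hP⟩ := exists_presentation_unit (R := X.ringCatSheaf)
  refine ⟨⟨P.quasicoherentData, ⟨fun U => ?_⟩⟩⟩
  exact
    { isFiniteType_generators := ⟨inferInstanceAs (Finite P.generators.I)⟩
      isFiniteType_relations := ⟨inferInstanceAs (Finite P.relations.I)⟩ }

end LocalSplitting
end CoxEuler
end

noncomputable section
namespace CoxEuler

/-! ### Local generators and local representatives in sheafifications -/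

section LocallyGenerated
open SheafOfModules Limits

section Site
variable {C : Type} [Category.{0} C] {J : GrothendieckTopology C} {R : Sheaf J RingCat.{0}}
  [HasSheafify J AddCommGrpCat.{0}] [J.WEqualsLocallyBijective AddCommGrpCat.{0}]

/-- The canonical map from a presheaf to its sheafification, on sections. -/
def unitApp (Q : PresheafOfModules.{0} R.obj) (Y : Cᵒᵖ) :
    Q.obj Y →+ ((PresheafOfModules.sheafification (𝟙 R.obj)).obj Q).val.obj Y :=
  (((PresheafOfModules.sheafificationAdjunction (𝟙 R.obj)).unit.app Q).app Y).hom.toAddMonoidHom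

lemma exists_cover_of_unitApp_eq (Q : PresheafOfModules.{0} R.obj) (Y : C) (x y : Q.obj (op Y))
    (h : unitApp Q (op Y) x = unitApp Q (op Y) y) :
    ∃ S ∈ J Y, ∀ ⦃Z : C⦄ (g : Z ⟶ Y), S g → Q.map g.op x = Q.map g.op y := by
  have := Presheaf.equalizerSieve_mem J (CategoryTheory.toSheafify J Q.presheaf) (X := op Y) x y h
  exact ⟨_, this, fun Z g hg => hg⟩

lemma exists_cover_eq_unitApp (Q : PresheafOfModules.{0} R.obj) (Y : C)
    (x : ((PresheafOfModules.sheafification (𝟙 R.obj)).obj Q).val.obj (op Y)) :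
    ∃ S ∈ J Y, ∀ ⦃Z : C⦄ (g : Z ⟶ Y), S g → ∃ z : Q.obj (op Z), unitApp Q (op Z) z =
      ((PresheafOfModules.sheafification (𝟙 R.obj)).obj Q).val.map g.op x := by
  have := Presheaf.imageSieve_mem J (CategoryTheory.toSheafify J Q.presheaf) (U := op Y) x
  exact ⟨_, this, fun Z g hg => hg⟩

/-- The composite of a morphism to a presheaf with the map to its sheafification. -/
def homSheafify {M : SheafOfModules.{0} R} {Q : PresheafOfModules.{0} R.obj} (f : M.val ⟶ Q) :
    M ⟶ (PresheafOfModules.sheafification (𝟙 R.obj)).obj Q :=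
  ⟨{ app := fun Y => ModuleCat.ofHom
        (Y := ((PresheafOfModules.sheafification (𝟙 R.obj)).obj Q).val.obj Y)
        { toFun := fun m => unitApp Q Y (f.app Y m)
          map_add' := fun m n => by rw [map_add, map_add]
          map_smul' := fun r m => by
            rw [map_smul]
            exact (((PresheafOfModules.sheafificationAdjunction (𝟙 R.obj)).unit.app Q).app Y).hom.map_smul r _ }
     naturality := fun {Y Y'} g => by
      ext m
      refine (congrArg (unitApp Q Y') (PresheafOfModules.naturality_apply f g m)).trans ?_
      exact PresheafOfModules.naturality_apply ((PresheafOfModules.sheafificationAdjunction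
        (𝟙 R.obj)).unit.app Q) g (f.app Y m) }⟩

omit [HasSheafify J AddCommGrpCat.{0}] [J.WEqualsLocallyBijective AddCommGrpCat.{0}] in
-- Cokernels of presheaves are computed objectwise, because evaluation is exact.
lemma cokernel_ι_apply_eq_zero_iff {M : PresheafOfModules.{0} R.obj} (N : M.Submodule) (Y : Cᵒᵖ)
    (m : M.obj Y) : (cokernel.π N.ι).app Y m = 0 ↔ m ∈ N.obj Y := by
  let S : ShortComplex (PresheafOfModules.{0} R.obj) :=
    ShortComplex.mk N.ι (cokernel.π N.ι) (cokernel.condition _)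
  have hS : S.Exact := ShortComplex.exact_cokernel N.ι
  have hS' := hS.map (PresheafOfModules.evaluation R.obj Y)
  rw [ShortComplex.moduleCat_exact_iff] at hS'
  constructor
  · intro h
    obtain ⟨n, hn⟩ := hS' m h
    rw [← hn]
    exact n.2
  · intro h
    exact ConcreteCategory.congr_hom ((S.map (PresheafOfModules.evaluation R.obj Y)).zero) ⟨m, h⟩

/-- The value of a generating section on an object of the site. -/
def generatorAt {M : SheafOfModules.{0} R} (σ : M.GeneratingSections) (i : σ.I) (Y : Cᵒᵖ) :
    M.val.obj Y := (σ.s i).val Y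

/-- Sections in a sheaf generated by the sections `σ` are locally linear combinations of them. -/
lemma exists_cover_mem_span {M : SheafOfModules.{0} R} (σ : M.GeneratingSections) (Y : C)
    (m : M.val.obj (op Y)) :
    ∃ S ∈ J Y, ∀ ⦃Z : C⦄ (g : Z ⟶ Y), S g → M.val.restrictₛₗ g.op m ∈
      Submodule.span (R.obj.obj (op Z)) (Set.range (generatorAt σ · (op Z))) := by
  let N : M.val.Submodule :=
    { obj := fun Y => Submodule.span (R.obj.obj Y) (Set.range (generatorAt σ · Y))
      map := fun {Y Y'} f => by
        rw [Submodule.span_le]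
        rintro _ ⟨i, rfl⟩
        refine Submodule.subset_span ⟨i, ?_⟩
        exact ((σ.s i).property f).symm }
  -- The map from M to the sheafification of M/N kills the generators, so it is zero. Hence the
  -- class of m in the presheaf quotient vanishes locally, which puts m locally in the span.
  let f : M ⟶ _ := homSheafify (cokernel.π N.ι)
  have hf : f = 0 := by
    rw [← cancel_epi σ.π, comp_zero]
    apply (freeHomEquiv _).injective
    funext i
    rw [freeHomEquiv_comp_apply, Equiv.apply_symm_apply]
    refine Subtype.ext (funext fun Z => ?_)
    change unitApp _ Z ((cokernel.π N.ι).app Z (generatorAt σ i Z)) = 0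
    rw [(cokernel_ι_apply_eq_zero_iff N Z _).mpr (Submodule.subset_span ⟨i, rfl⟩), map_zero]
  have hm : unitApp _ (op Y) ((cokernel.π N.ι).app (op Y) m) = unitApp _ (op Y) 0 := by
    rw [map_zero]
    exact congrArg (fun h => h.val.app (op Y) m) hf
  obtain ⟨S, hS, h⟩ := exists_cover_of_unitApp_eq _ Y _ _ hm
  refine ⟨S, hS, fun Z g hg => ?_⟩
  have h' := h g hg
  rw [← PresheafOfModules.naturality_apply, map_zero] at h'
  exact (cokernel_ι_apply_eq_zero_iff N (op Z) _).mp h'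
lemma id_eq_zero_of_generatorAt {M : SheafOfModules.{0} R} (σ : M.GeneratingSections)
    (h : ∀ i Y, generatorAt σ i Y = 0) : 𝟙 M = 0 := by
  rw [← cancel_epi σ.π, comp_zero, Category.comp_id]
  apply (freeHomEquiv _).injective
  funext i
  refine Subtype.ext (funext fun Z => ?_)
  rw [Equiv.apply_symm_apply]
  exact h i Z
end Site

variable {X : Scheme.{0}}

/-- Local generation of a sheaf of modules by finitely many sections. -/
lemma exists_local_generators {F : X.Modules} (hF : IsCoherent F) (x : X) :
    ∃ U : X.Opens, x ∈ U ∧ ∃ (ι : Type) (_ : Finite ι) (s : ι → (toPMod F).obj (op U)),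
      ∀ (V : X.Opens) (hV : V ≤ U) (m : (toPMod F).obj (op V)) (y : X), y ∈ V →
        ∃ (W : X.Opens) (hW : W ≤ V), y ∈ W ∧ resSec (toPMod F) hW m ∈
          Submodule.span Γ(X, W) (Set.range fun i => resSec (toPMod F) (hW.trans hV) (s i)) := by
  obtain ⟨τ, hτ⟩ := hF.exists_quasicoherentData
  have hc := τ.coversTop
  rw [Opens.coversTop_iff] at hc
  obtain ⟨j, hj⟩ := hc.exists_mem x
  have := hτ.isFinite_presentation j
  let σ := (τ.presentation j).generators
  -- A section of a sheaf over the slice is determined by its value at the terminal object, that is,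
  -- over the whole open set.
  refine ⟨τ.X j, hj, σ.I, inferInstance, fun i => (σ.s i).val (op (Over.mk (𝟙 _))), ?_⟩
  intro V hV m y hy
  obtain ⟨S, hS, h⟩ := exists_cover_mem_span σ (Over.mk (homOfLE hV)) m
  rw [GrothendieckTopology.mem_over_iff] at hS
  obtain ⟨W, g, hg, hyW⟩ := hS y hy
  rw [Sieve.overEquiv_iff] at hg
  refine ⟨W, g.le, hyW, ?_⟩
  refine (congrArg (fun T => resSec (toPMod F) g.le m ∈ Submodule.span Γ(X, W) T) ?_).mp (h _ hg)
  refine congrArg Set.range (funext fun i => ?_)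
  exact ((σ.s i).property (Over.homMk (homOfLE (g.le.trans hV)) : Over.mk (homOfLE (g.le.trans hV)) ⟶ Over.mk (𝟙 (τ.X j))).op).symm

lemma toSheafify_res (M : PMod X) {U V : X.Opens} (h : V ≤ U) (m : M.obj (op U)) :
    toSheafify M V (resSec M h m) = resSec (toPMod (sheafify M)) h (toSheafify M U m) :=
  PresheafOfModules.naturality_apply ((PresheafOfModules.sheafificationAdjunction
        (𝟙 X.ringCatSheaf.obj)).unit.app M) (homOfLE h).op m

lemma toSheafify_smul (M : PMod X) {U : X.Opens} (r : Γ(X, U)) (m : M.obj (op U)) :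
    toSheafify M U (r • m) = r • toSheafify M U m :=
  (((PresheafOfModules.sheafificationAdjunction (𝟙 X.ringCatSheaf.obj)).unit.app M).app (op U)).hom.map_smul r m

lemma exists_res_eq_of_toSheafify_eq (M : PMod X) {U : X.Opens} {m n : M.obj (op U)}
    (h : toSheafify M U m = toSheafify M U n) {x : X} (hx : x ∈ U) :
    ∃ (V : X.Opens) (hV : V ≤ U), x ∈ V ∧ resSec M hV m = resSec M hV n := by
  obtain ⟨S, hS, h⟩ := exists_cover_of_unitApp_eq (R := X.ringCatSheaf) M U m n h
  obtain ⟨W, g, hg, hxW⟩ := hS x hx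
  exact ⟨W, g.le, hxW, h g hg⟩

lemma exists_toSheafify_eq_res (M : PMod X) {U : X.Opens} (m : (toPMod (sheafify M)).obj (op U))
    {x : X} (hx : x ∈ U) :
    ∃ (V : X.Opens) (hV : V ≤ U), x ∈ V ∧ ∃ n : M.obj (op V),
      toSheafify M V n = resSec (toPMod (sheafify M)) hV m := by
  obtain ⟨S, hS, h⟩ := exists_cover_eq_unitApp (R := X.ringCatSheaf) M U m
  obtain ⟨W, g, hg, hxW⟩ := hS x hx
  exact ⟨W, g.le, hxW, h g hg⟩

/-- A globally generated sheaf without nonzero global sections is zero. -/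
lemma eq_zero_of_isGloballyGenerated {F : X.Modules} (hF : IsGloballyGenerated F)
    (h0 : ∀ s : (toPMod F).obj (op ⊤), s = 0) {U : X.Opens} (m : (toPMod F).obj (op U)) : m = 0 := by
  obtain ⟨σ⟩ := hF
  have hs : ∀ i (V : X.Opensᵒᵖ), ((σ.s i).val V : (toPMod F).obj V) = 0 := fun i V => by
    refine ((σ.s i).property (homOfLE le_top : V.unop ⟶ ⊤).op).symm.trans ?_
    exact (congrArg (resSec (toPMod F) le_top) (h0 _)).trans (map_zero _)
  let F' : SheafOfModules X.ringCatSheaf := F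
  have hid : 𝟙 F' = 0 := id_eq_zero_of_generatorAt (R := X.ringCatSheaf) σ hs
  exact congrArg (fun h : F' ⟶ F' => h.val.app (op U) m) hid

end LocallyGenerated
end CoxEuler
end

noncomputable section
namespace CoxEuler

/-! ### Reflexivity is local and stable under adding free summands -/

section Reflexive
variable {X : Scheme.{0}}

lemma isIso_iff_bijective_app {M N : PMod X} (φ : M ⟶ N) :
    IsIso φ ↔ ∀ U : X.Opens, Function.Bijective (φ.app (op U)) := by
  rw [← isIso_iff_of_reflects_iso φ (PresheafOfModules.toPresheaf _), NatTrans.isIso_iff_isIso_app]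
  constructor
  · intro h U
    exact (ConcreteCategory.isIso_iff_bijective (((PresheafOfModules.toPresheaf _).map φ).app (op U))).mp (h (op U))
  · intro h U
    exact (ConcreteCategory.isIso_iff_bijective _).mpr (h U.unop)

lemma bijective_bidualSection_iff (M : PMod X) :
    IsIso (toBidual M) ↔ ∀ U : X.Opens, Function.Bijective (bidualSection M (U := U)) :=
  isIso_iff_bijective_app _

variable {A E : X.Modules} {V : X.Opens} {κ : Type} [Fintype κ]

/-- Composition of a linear form on `M` with a morphism `N → M` defined over `V`. -/
def dualComap {M N : PMod X} {V : X.Opens}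
    (φ : ∀ W : X.Opens, W ≤ V → N.obj (op W) →ₗ[Γ(X, W)] M.obj (op W))
    (hφ : ∀ (W W' : X.Opens) (h : W ≤ V) (h' : W' ≤ W) (m : N.obj (op W)),
      φ W' (h'.trans h) (resSec N h' m) = resSec M h' (φ W h m))
    {W : X.Opens} (hW : W ≤ V) : (dual M).obj (op W) →ₗ[Γ(X, W)] (dual N).obj (op W) where
  toFun := fun ψ : dualSections M W => (⟨fun Y => (ψ.1 Y).comp (φ Y.1 (Y.2.trans hW)), fun Y Z h m => by
    rw [LinearMap.comp_apply, LinearMap.comp_apply, hφ Y.1 Z.1 (Y.2.trans hW) h, ψ.2 Y Z h]⟩ :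
      dualSections N W)
  map_add' _ _ := rfl
  map_smul' _ _ := rfl

/-- The coordinate functions of a local splitting as sections of the dual sheaf. -/
def LocalSplitting.coord (D : LocalSplitting A E V κ) {W : X.Opens} (hW : W ≤ V) (k : κ) :
    dualSections (toPMod E) W :=
  ⟨fun Y => D.q Y.1 (Y.2.trans hW) k, fun Y Z h m => D.q_res Y.1 Z.1 (Y.2.trans hW) h k m⟩

/-- Duals commute with finite direct sums, so the bidual of A ⊕ 𝒪ᵏ splits into the bidual of A and a
free sheaf, which is its own bidual. -/
lemma LocalSplitting.bijective (D : LocalSplitting A E V κ)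
    (hA : ∀ W : X.Opens, Function.Bijective (bidualSection (toPMod A) (U := W)))
    (W : X.Opens) (hW : W ≤ V) : Function.Bijective (bidualSection (toPMod E) (U := W)) := by
  have inj : Function.Injective (bidualSection (toPMod E) (U := W)) := by
    intro m n hmn
    have ev (φ : dualSections (toPMod E) W) : φ.1 ⟨W, le_rfl⟩ m = φ.1 ⟨W, le_rfl⟩ n := by
      have := congrArg (fun α : dualSections (dual (toPMod E)) W => α.1 ⟨W, le_rfl⟩ φ) hmn
      change φ.1 ⟨W, le_rfl⟩ (resSec _ _ m) = φ.1 ⟨W, le_rfl⟩ (resSec _ _ n) at this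
      rwa [resSec_self, resSec_self] at this
    rw [← D.total W hW m, ← D.total W hW n]
    have hp : D.p W hW m = D.p W hW n := by
      apply (hA W).1
      refine Subtype.ext (funext fun Y => LinearMap.ext fun ψ => ?_)
      change (ψ : dualSections (toPMod A) Y.1).1 ⟨Y.1, le_rfl⟩ (resSec _ _ (D.p W hW m)) =
        (ψ : dualSections (toPMod A) Y.1).1 ⟨Y.1, le_rfl⟩ (resSec _ _ (D.p W hW n))
      rw [← D.p_res, ← D.p_res]
      exact congrArg (fun α : dualSections (dual (toPMod E)) W => α.1 Y
        (dualComap D.p D.p_res (Y.2.trans hW) ψ)) hmn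
    have hq : ∀ k, D.q W hW k m = D.q W hW k n := fun k => ev (D.coord hW k)
    rw [hp]
    simp only [hq]
  refine ⟨inj, fun α => ?_⟩
  -- Evaluating α on functionals that factor through the projection p gives its component in the
  -- bidual of A; the values c on the coordinate functions give the free component.
  let αA : dualSections (dual (toPMod A)) W :=
    ⟨fun Y => (α.1 Y).comp (dualComap D.p D.p_res (Y.2.trans hW)), fun Y Z h ψ =>
      α.2 Y Z h (dualComap D.p D.p_res (Y.2.trans hW) ψ)⟩
  obtain ⟨a, ha⟩ := (hA W).2 αA
  let c : κ → Γ(X, W) := fun k => α.1 ⟨W, le_rfl⟩ (D.coord hW k)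
  refine ⟨D.i W hW a + ∑ k, c k • resSec (toPMod E) hW (D.s k), ?_⟩
  refine Subtype.ext (funext fun Y => LinearMap.ext fun φ => ?_)
  have hY := Y.2.trans hW
  let φ' : dualSections (toPMod E) Y.1 := φ
  have e1 : α.1 Y (dualComap D.p D.p_res hY (dualComap D.i D.i_res hY φ)) =
      φ'.1 ⟨Y.1, le_rfl⟩ (D.i Y.1 hY (resSec (toPMod A) Y.2 a)) :=
    congrArg (fun β : dualSections (dual (toPMod A)) W => β.1 Y (dualComap D.i D.i_res hY φ)) ha.symm
  have e2 : ∀ k, α.1 Y (D.coord hY k) = resFun Y.2 (c k) := fun k =>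
    α.2 ⟨W, le_rfl⟩ Y Y.2 (D.coord hW k)
  let d : κ → Γ(X, Y.1) := fun k => φ'.1 ⟨Y.1, le_rfl⟩ (resSec (toPMod E) hY (D.s k))
  let co : κ → (dual (toPMod E)).obj (op Y.1) := fun k => D.coord hY k
  -- A functional on E is the sum of its restriction to A, extended by p, and a combination of the
  -- coordinate functions with its values on the basis as coefficients.
  have e3 : φ = dualComap D.p D.p_res hY (dualComap D.i D.i_res hY φ) +
      ∑ k, d k • co k := by
    refine Subtype.ext (funext fun Z => LinearMap.ext fun m => ?_)
    let evZ : (dual (toPMod E)).obj (op Y.1) →+ Γ(X, Z.1) :=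
      { toFun := fun β : dualSections (toPMod E) Y.1 => β.1 Z m
        map_zero' := rfl
        map_add' := fun _ _ => rfl }
    change φ'.1 Z m = evZ (_ + _)
    rw [map_add, map_sum]
    change _ = φ'.1 Z (D.i Z.1 _ (D.p Z.1 _ m)) + ∑ k, resFun Z.2 (d k) • D.q Z.1 _ k m
    conv_lhs => rw [← D.total Z.1 (Z.2.trans hY) m, map_add, map_sum]
    congr 1
    refine Finset.sum_congr rfl fun k _ => ?_
    rw [map_smul, smul_eq_mul, smul_eq_mul, mul_comm, ← φ'.2 ⟨Y.1, le_rfl⟩ Z Z.2, resSec_resSec]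
  change φ'.1 ⟨Y.1, le_rfl⟩ (resSec _ Y.2 _) = α.1 Y φ
  rw [e3, map_add (α.1 Y), map_sum (α.1 Y), e1, map_add, map_add, map_sum, map_sum,
    D.i_res W Y.1 hW Y.2]
  congr 1
  refine Finset.sum_congr rfl fun k _ => ?_
  rw [(α.1 Y).map_smul, show α.1 Y (co k) = _ from e2 k, resSec_smul,
    (φ'.1 ⟨Y.1, le_rfl⟩).map_smul, resSec_resSec, smul_eq_mul, smul_eq_mul, mul_comm]

lemma fun_eq_of_locally {ι : Type} (U : ι → X.Opens) (W : X.Opens)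
    (hU : ∀ i, U i ≤ W) (hW : W ≤ iSup U) (x y : Γ(X, W))
    (h : ∀ i, resFun (hU i) x = resFun (hU i) y) : x = y :=
  (existsUnique_glueFun U W hU hW (fun i => resFun (hU i) y) fun i j => by
    rw [resFun_resFun, resFun_resFun]).unique h fun _ => rfl

/-- The dual is separated for every presheaf M, since its sections take values in the sheaf of
functions. -/
lemma dualSections_eq_of_locally (M : PMod X) {ι : Type} (U : ι → X.Opens) (W : X.Opens)
    (hU : ∀ i, U i ≤ W) (hW : W ≤ iSup U) (α β : dualSections M W)
    (h : ∀ i, ∀ Y : {Y : X.Opens // Y ≤ U i}, α.1 ⟨Y.1, Y.2.trans (hU i)⟩ = β.1 ⟨Y.1, Y.2.trans (hU i)⟩) :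
    α = β := by
  refine Subtype.ext (funext fun Y => LinearMap.ext fun m => ?_)
  refine fun_eq_of_locally (fun i => Y.1 ⊓ U i) Y.1 (fun i => inf_le_left)
    (fun x hx => by
      obtain ⟨i, hi⟩ := Opens.mem_iSup.mp (hW (Y.2 hx))
      exact Opens.mem_iSup.mpr ⟨i, hx, hi⟩) _ _ fun i => ?_
  rw [← α.2 Y ⟨Y.1 ⊓ U i, inf_le_left.trans Y.2⟩ inf_le_left,
    ← β.2 Y ⟨Y.1 ⊓ U i, inf_le_left.trans Y.2⟩ inf_le_left]
  exact LinearMap.congr_fun (h i ⟨Y.1 ⊓ U i, inf_le_right⟩) _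

/-- Over subsets of the V_t the biduality map is bijective. Local preimages glue because E is a
sheaf and they are unique, and their bidual section is the given one because the bidual is
separated. -/
lemma isReflexive_of_localSplitting {T : Type} {V : T → X.Opens} (hV : ∀ x, ∃ t, x ∈ V t)
    (D : ∀ t, LocalSplitting A E (V t) κ) (hA : IsReflexive A) : IsReflexive E := by
  refine ⟨isCoherent_of_localSplitting hV D hA.coherent, ?_⟩
  rw [bijective_bidualSection_iff]
  have hA' := (bijective_bidualSection_iff _).mp hA.isIso
  have hloc : ∀ t W, W ≤ V t → Function.Bijective (bidualSection (toPMod E) (U := W)) :=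
    fun t => (D t).bijective hA'
  have hle : ∀ (U : X.Opens) (t : T), U ⊓ V t ≤ U := fun _ _ => inf_le_left
  have hcov : ∀ U : X.Opens, U ≤ ⨆ t, U ⊓ V t := fun U x hx => by
    obtain ⟨t, ht⟩ := hV x
    exact Opens.mem_iSup.mpr ⟨t, hx, ht⟩
  intro U
  have hres : ∀ {U U' : X.Opens} (h : U' ≤ U) (m : (toPMod E).obj (op U)),
      bidualSection (toPMod E) (resSec (toPMod E) h m) =
        resSec (dual (dual (toPMod E))) h (bidualSection (toPMod E) m : dualSections (dual (toPMod E)) U) :=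
    fun h m => PresheafOfModules.naturality_apply (toBidual (toPMod E)) (homOfLE h).op m
  constructor
  · intro m n hmn
    refine eq_of_locally E (fun t => U ⊓ V t) U (hle U) (hcov U) m n fun t => ?_
    apply (hloc t _ inf_le_right).1
    rw [hres, hres, hmn]
  · intro α
    have hα : ∀ t, ∃ m : (toPMod E).obj (op (U ⊓ V t)), bidualSection (toPMod E) m =
        resSec (dual (dual (toPMod E))) (hle U t) α := fun t => (hloc t _ inf_le_right).2 _
    choose m hm using hα
    obtain ⟨x, hx, -⟩ := existsUnique_glue E (fun t => U ⊓ V t) U (hle U) (hcov U) m (fun s t => by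
      apply (hloc s _ (inf_le_left.trans inf_le_right)).1
      rw [hres, hres, hm, hm]
      exact (resSec_resSec (dual (dual (toPMod E))) _ _ _).trans
        (resSec_resSec (dual (dual (toPMod E))) _ _ _).symm)
    refine ⟨x, dualSections_eq_of_locally _ (fun t => U ⊓ V t) U (hle U) (hcov U) _ _ fun t Y => ?_⟩
    have := hm t
    rw [← hx t, hres] at this
    exact congrArg (fun β : dualSections (dual (toPMod E)) (U ⊓ V t) => β.1 Y) this

end Reflexive
end CoxEuler
end

noncomputable section
namespace CoxEuler

/-! ### Local splittings of an extension given by a cocycle -/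

section ExtensionSplitting
open TensorProduct
variable {X : Scheme.{0}} (F : X.Modules) {T : Type} (V : T → X.Opens) {L : Type} [AddCommGroup L]
  (ψ : ∀ s t : T, L →+ (toPMod F).obj (op (V s ⊓ V t)))

lemma psiTensor_cocycle (hψ : ∀ l, (fun s t => ψ s t l) ∈ cechZ1 (toPMod F) V) (r s t : T)
    {W : X.Opens} (hrt : W ≤ V r ⊓ V t) (hrs : W ≤ V r ⊓ V s) (hst : W ≤ V s ⊓ V t)
    (x : Γ(X, W) ⊗[ℤ] L) :
    psiTensor F V ψ r t hrt x = psiTensor F V ψ r s hrs x + psiTensor F V ψ s t hst x := by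
  induction x with
  | zero => simp
  | add x y hx hy => simp only [map_add, hx, hy]; abel
  | tmul a l =>
    change a • resSec _ hrt (ψ r t l) = a • resSec _ hrs (ψ r s l) + a • resSec _ hst (ψ s t l)
    rw [← smul_add]
    congr 1
    have hW : W ≤ V r ⊓ V s ⊓ V t := le_inf hrs (hst.trans inf_le_right)
    have := congrArg (resSec (toPMod F) hW) (hψ l r s t)
    simpa only [map_add, resSec_resSec] using this

/-- The cocycle relation for (t, t, t) reads c = c + c. -/
lemma psiTensor_self (hψ : ∀ l, (fun s t => ψ s t l) ∈ cechZ1 (toPMod F) V) (t : T)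
    {W : X.Opens} (h : W ≤ V t ⊓ V t) (x : Γ(X, W) ⊗[ℤ] L) : psiTensor F V ψ t t h x = 0 :=
  left_eq_add.mp (psiTensor_cocycle F V ψ hψ t t t h h h x)

/-- Over `V_t`, a section of `F` and a section of `𝒪 ⊗ L` define a section of the extension. -/
def extOfPair (hψ : ∀ l, (fun s t => ψ s t l) ∈ cechZ1 (toPMod F) V) (t : T) {W : X.Opens}
    (hW : W ≤ V t) (a : (toPMod F).obj (op W)) (x : Γ(X, W) ⊗[ℤ] L) : extSections F V ψ W :=
  ⟨(fun s => resSec (toPMod F) inf_le_left a +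
    psiTensor F V ψ t s (inf_le_inf_right _ hW) (resTensor L inf_le_left x), x), fun r s => by
    simp only [map_add, resSec_resSec, resSec_psiTensor, resTensor_resTensor]
    rw [psiTensor_cocycle F V ψ hψ t r s _ _ _, add_assoc]⟩

variable {F V ψ}

/-- Inside V_t the gluing rule computes every component ω_s from ω_t and ℓ. -/
lemma extSections_ext (t : T) {W : X.Opens}
    (hW : W ≤ V t) {x y : extSections F V ψ W}
    (h1 : resSec (toPMod F) (le_inf le_rfl hW) (x.1.1 t) = resSec (toPMod F) (le_inf le_rfl hW) (y.1.1 t))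
    (h2 : x.1.2 = y.1.2) : x = y := by
  refine Subtype.ext (Prod.ext (funext fun s => ?_) h2)
  have key (z : extSections F V ψ W) : z.1.1 s =
      resSec (toPMod F) inf_le_left (resSec (toPMod F) (le_inf le_rfl hW) (z.1.1 t)) +
        psiTensor F V ψ t s (inf_le_inf_right _ hW) (resTensor L inf_le_left z.1.2) := by
    have hle : W ⊓ V s ≤ W ⊓ (V t ⊓ V s) := le_inf inf_le_left (inf_le_inf_right _ hW)
    have := congrArg (resSec (toPMod F) hle) (z.2 t s)
    simpa only [map_add, resSec_resSec, resSec_psiTensor, resTensor_resTensor, resSec_self] using this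
  rw [key x, key y, h1, h2]

lemma resSec_extOfPair (hψ : ∀ l, (fun s t => ψ s t l) ∈ cechZ1 (toPMod F) V) (t : T) {W W' : X.Opens}
    (hW : W ≤ V t) (h : W' ≤ W) (a : (toPMod F).obj (op W)) (x : Γ(X, W) ⊗[ℤ] L) :
    extRes F V ψ h (extOfPair F V ψ hψ t hW a x) =
      extOfPair F V ψ hψ t (h.trans hW) (resSec (toPMod F) h a) (resTensor L h x) := by
  refine Subtype.ext (Prod.ext (funext fun s => ?_) rfl)
  change resSec (toPMod F) _ (_ + _) = _ + _
  simp only [map_add, resSec_resSec, resSec_psiTensor, resTensor_resTensor]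

lemma extOfPair_fst (hψ : ∀ l, (fun s t => ψ s t l) ∈ cechZ1 (toPMod F) V) (t : T) {W : X.Opens}
    (hW : W ≤ V t) (a : (toPMod F).obj (op W)) (x : Γ(X, W) ⊗[ℤ] L) :
    resSec (toPMod F) (le_inf le_rfl hW) ((extOfPair F V ψ hψ t hW a x).1.1 t) = a := by
  change resSec (toPMod F) _ (_ + _) = _
  rw [psiTensor_self F V ψ hψ, add_zero, resSec_resSec, resSec_self]

lemma basis_repr_resTensor {ι : Type} (b : Module.Basis ι ℤ L) {U W : X.Opens} (h : W ≤ U)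
    (x : Γ(X, U) ⊗[ℤ] L) (k : ι) :
    (b.baseChange Γ(X, W)).repr (resTensor L h x) k =
      resFun h ((b.baseChange Γ(X, U)).repr x k) := by
  classical
  induction x with
  | zero => simp
  | add x y hx hy => simp only [map_add, Finsupp.add_apply, hx, hy]
  | tmul a l =>
    change (b.baseChange Γ(X, W)).repr (resFun h a ⊗ₜ[ℤ] l) k = _
    simp [Module.Basis.baseChange_repr_tmul]

lemma sum_coord_baseChange {ι : Type} [Fintype ι] (b : Module.Basis ι ℤ L) {W : X.Opens}
    (y : Γ(X, W) ⊗[ℤ] L) : ∑ k, (b.baseChange Γ(X, W)).coord k y • (1 ⊗ₜ[ℤ] b k) = y := by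
  have := (b.baseChange Γ(X, W)).sum_repr y
  simp only [Module.Basis.baseChange_apply] at this
  exact this

variable [Module.Free ℤ L] [Module.Finite ℤ L]

variable (F V ψ) in
/-- The `t`-component of a section of the extension over a subset of `V_t`. -/
def extFst (t : T) {W : X.Opens} (hW : W ≤ V t) :
    (toPMod (extSheaf F V ψ)).obj (op W) →ₗ[Γ(X, W)] (toPMod F).obj (op W) where
  toFun := fun m : extSections F V ψ W => resSec (toPMod F) (le_inf le_rfl hW) (m.1.1 t)
  map_add' := fun m n => map_add (resSec (toPMod F) (le_inf le_rfl hW)) _ _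
  map_smul' := fun r m => by
    refine (resSec_smul (toPMod F) (le_inf le_rfl hW) _ _).trans ?_
    rw [resFun_resFun, resFun_self]; rfl

variable (F V ψ) in
/-- The projection from the extension to `𝒪 ⊗ L`. -/
def extSnd (W : X.Opens) :
    (toPMod (extSheaf F V ψ)).obj (op W) →ₗ[Γ(X, W)] Γ(X, W) ⊗[ℤ] L where
  toFun := fun m : extSections F V ψ W => m.1.2
  map_add' _ _ := rfl
  map_smul' _ _ := rfl

lemma ext_hom_ext (t : T) {W : X.Opens} (hW : W ≤ V t)
    {x y : (toPMod (extSheaf F V ψ)).obj (op W)} (h1 : extFst F V ψ t hW x = extFst F V ψ t hW y)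
    (h2 : extSnd F V ψ W x = extSnd F V ψ W y) : x = y :=
  extSections_ext t hW h1 h2

variable (F V ψ) in
/-- `extOfPair` as a section of the sheaf `extSheaf`. -/
def extPair (hψ : ∀ l, (fun s t => ψ s t l) ∈ cechZ1 (toPMod F) V) (t : T) {W : X.Opens}
    (hW : W ≤ V t) (a : (toPMod F).obj (op W)) (x : Γ(X, W) ⊗[ℤ] L) :
    (toPMod (extSheaf F V ψ)).obj (op W) := extOfPair F V ψ hψ t hW a x

/-- Over `V_t`, the extension is the direct sum of `F` and a free sheaf. -/
def extSplitting (hψ : ∀ l, (fun s t => ψ s t l) ∈ cechZ1 (toPMod F) V) (t : T) :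
    LocalSplitting F (extSheaf F V ψ) (V t) (Module.Free.ChooseBasisIndex ℤ L) :=
  let b := Module.Free.chooseBasis ℤ L
  have hs : ∀ (W : X.Opens) (h : W ≤ V t) k,
      resSec (toPMod (extSheaf F V ψ)) h (extPair F V ψ hψ t le_rfl 0 (1 ⊗ₜ b k)) =
        extPair F V ψ hψ t h 0 (1 ⊗ₜ b k) := fun W h k => by
    refine (resSec_extOfPair hψ t le_rfl h 0 (1 ⊗ₜ b k)).trans ?_
    rw [map_zero]
    exact congrArg (fun a => extPair F V ψ hψ t h 0 (a ⊗ₜ b k)) (map_one (resFun h))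
  have hfst : ∀ (W : X.Opens) (h : W ≤ V t) a x,
    extFst F V ψ t h (extPair F V ψ hψ t h a x) = a := fun W h a x => extOfPair_fst hψ t h a x
  have hsnd : ∀ (W : X.Opens) (h : W ≤ V t) a x,
    extSnd F V ψ W (extPair F V ψ hψ t h a x) = x := fun W h a x => rfl
  { p := fun W hW => extFst F V ψ t hW
    i := fun W hW =>
      { toFun := fun a => extPair F V ψ hψ t hW a 0
        map_add' := fun a c => ext_hom_ext t hW
          (by rw [map_add, hfst, hfst, hfst]) (by rw [map_add, hsnd, hsnd, hsnd, add_zero])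
        map_smul' := fun r a => ext_hom_ext t hW
          (by rw [RingHom.id_apply, map_smul, hfst, hfst])
          (by rw [RingHom.id_apply, map_smul, hsnd, hsnd, smul_zero]) }
    q := fun W hW k => ((b.baseChange Γ(X, W)).coord k).comp (extSnd F V ψ W)
    s := fun k => extPair F V ψ hψ t le_rfl 0 (1 ⊗ₜ b k)
    p_res := fun W W' h h' (m : extSections F V ψ W) => by
      change resSec (toPMod F) _ (resSec (toPMod F) _ (m.1.1 t)) =
        resSec (toPMod F) _ (resSec (toPMod F) _ (m.1.1 t))
      rw [resSec_resSec, resSec_resSec]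
    i_res := fun W W' h h' a => by
      refine ((resSec_extOfPair hψ t h h' a 0).trans ?_).symm
      rw [map_zero]; rfl
    q_res := fun W W' h h' k (m : extSections F V ψ W) => basis_repr_resTensor b h' m.1.2 k
    p_i := fun W h a => extOfPair_fst hψ t h a 0
    q_i := fun W h k a => by
      change (b.baseChange Γ(X, W)).coord k 0 = 0
      rw [map_zero]
    p_s := fun W h k => by rw [hs]; exact hfst W h _ _
    q_s_self := fun W h k => by
      rw [hs]
      change (b.baseChange Γ(X, W)).coord k (1 ⊗ₜ b k) = 1
      simp [Module.Basis.baseChange_repr_tmul]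
    q_s_ne := fun W h k l hkl => by
      rw [hs]
      change (b.baseChange Γ(X, W)).coord l (1 ⊗ₜ b k) = 0
      simp [Module.Basis.baseChange_repr_tmul, hkl]
    total := fun W h m => by
      apply ext_hom_ext t h
      · rw [map_add, map_sum, Finset.sum_eq_zero fun k _ => by rw [map_smul, hs, hfst, smul_zero],
          add_zero]
        exact hfst W h _ _
      · have h1 : extSnd F V ψ W (extPair F V ψ hψ t h (extFst F V ψ t h m) 0) = 0 := hsnd W h _ _
        have h2 : ∀ k (c : Γ(X, W)), extSnd F V ψ W
            (c • resSec (toPMod (extSheaf F V ψ)) h (extPair F V ψ hψ t le_rfl 0 (1 ⊗ₜ b k))) =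
              c • (1 ⊗ₜ b k) := fun k c => by rw [map_smul, hs, hsnd]
        refine ((extSnd F V ψ W).map_add _ _).trans ?_
        refine (congrArg₂ (· + ·) h1 ((map_sum (extSnd F V ψ W) _ _).trans (Finset.sum_congr rfl fun k _ => h2 k _))).trans ?_
        exact (zero_add _).trans (sum_coord_baseChange b (extSnd F V ψ W m)) }

lemma isReflexive_extSheaf (hV : ∀ x, ∃ t, x ∈ V t)
    (hψ : ∀ l, (fun s t => ψ s t l) ∈ cechZ1 (toPMod F) V) (hF : IsReflexive F) :
    IsReflexive (extSheaf F V ψ) :=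
  isReflexive_of_localSplitting hV (extSplitting hψ) hF

end ExtensionSplitting

/-! ### Reflexivity of the Euler sheaf -/

section EulerReflexive
variable {X : Scheme.{0}} [IsIntegral X] {Λ : AddSubgroup (CDiv X)}

omit [IsIntegral X] in
lemma nonempty_of_mem {U : X.Opens} {x : X} (hx : x ∈ U) : Nonempty U := ⟨⟨x, hx⟩⟩

variable [Module.Free ℤ Λ] [Module.Finite ℤ Λ]

/-- A basis of Λ is finite, so its members have local equations on a common affine neighbourhood;
extending these equations from the basis makes the choice additive. -/
lemma exists_trivialization {U : X.Opens} {x : X} (hx : x ∈ U) :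
    ∃ t : Trivialization Λ, x ∈ t.V ∧ t.V ≤ U := by
  classical
  let b := Module.Free.chooseBasis ℤ Λ
  have h : ∀ k, ∃ U : X.Opens, x ∈ U ∧ ∃ f : (X.functionField)ˣ,
    ∀ y ∈ U, (b k).1.1 y = Additive.ofMul (QuotientGroup.mk f) := fun k => (b k).1.2 x
  choose W hW f hf using h
  have hx' : x ∈ U ⊓ Finset.univ.inf W := ⟨hx, by
    rw [Opens.coe_finset_inf]
    simpa using hW⟩
  obtain ⟨V, hV, hxV, hVU⟩ := exists_isAffineOpen_mem_and_subset hx'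
  let e : Λ →ₗ[ℤ] Additive (X.functionField)ˣ := b.constr ℤ fun k => Additive.ofMul (f k)
  refine ⟨⟨V, hV, nonempty_of_mem hxV, e.toAddMonoidHom, fun l y hy => ?_⟩, hxV, fun y hy => (hVU hy).1⟩
  have hyk : ∀ k, y ∈ W k := fun k => Finset.inf_le (f := W) (Finset.mem_univ k) (hVU hy).2
  refine Submodule.span_induction (p := fun l _ => IsLocalEquationAt l.1 y (e l).toMul)
    ?_ ?_ ?_ ?_ (b.span_eq ▸ Submodule.mem_top : l ∈ Submodule.span ℤ (Set.range b))
  · rintro _ ⟨k, rfl⟩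
    rw [b.constr_basis]
    exact hf k y (hyk k)
  · rw [map_zero]; rfl
  · intro l m _ _ hl hm
    rw [map_add]
    exact hl.add hm
  · intro n l _ hl
    rw [map_zsmul]
    change n • l.1.1 y = _
    rw [hl]; rfl

lemma isReflexive_eulerSheaf (f : X ⟶ Spec (.of ℂ)) (h : IsReflexive (Omega f)) :
    IsReflexive (eulerSheaf f Λ) :=
  isReflexive_extSheaf (fun x => by
      obtain ⟨t, ht, -⟩ := exists_trivialization (Λ := Λ) (U := ⊤) (x := x) trivial
      exact ⟨t, ht⟩)
    (fun l => psi_cocycle f l) h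

end EulerReflexive
end CoxEuler
end

noncomputable section
namespace CoxEuler

/-! ### Functionals with values in the function field, and their twists -/

section GenericFunctionals
open TensorProduct MonoidalCategory
variable {X : Scheme.{0}} [IsIntegral X]

lemma genericPoint_mem {U : X.Opens} {x : X} (hx : x ∈ U) : genericPoint X ∈ U :=
  ((genericPoint_spec X).mem_open_set_iff U.isOpen).mpr (by simpa using nonempty_of_mem hx)

/-- A regular function on a nonempty open set, as a rational function. -/
def ratFun {U : X.Opens} (hU : genericPoint X ∈ U) : Γ(X, U) →+* X.functionField :=
  toFunctionField U ⟨genericPoint X, hU⟩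

lemma ratFun_resFun {U V : X.Opens} (h : V ≤ U) (hV : genericPoint X ∈ V) (r : Γ(X, U)) :
    ratFun hV (resFun h r) = ratFun (h hV) r := toFunctionField_resFun h _ r

lemma ratFun_eq_germ {U : X.Opens} [Nonempty U] (hU : genericPoint X ∈ U) (r : Γ(X, U)) :
    ratFun hU r = X.germToFunctionField U r :=
  (X.algebraMap_germ_eq_germToFunctionField hU r)

lemma ratFun_injective {U : X.Opens} (hU : genericPoint X ∈ U) : Function.Injective (ratFun hU) := by
  have := nonempty_of_mem hU
  intro r s h
  rw [ratFun_eq_germ, ratFun_eq_germ] at h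
  exact X.germToFunctionField_injective U h

lemma isRegularAt_ratFun {U : X.Opens} (hU : genericPoint X ∈ U) (r : Γ(X, U)) {x : X} (hx : x ∈ U) :
    IsRegularAt x (ratFun hU r) := by
  rw [ratFun, toFunctionField_const _ (⟨x, hx⟩ : U)]
  exact ⟨_, rfl⟩

lemma exists_ratFun_eq {U : X.Opens} (hU : genericPoint X ∈ U) {h : X.functionField}
    (hh : ∀ x ∈ U, IsRegularAt x h) : ∃ r : Γ(X, U), ratFun hU r = h := by
  have := nonempty_of_mem hU
  obtain ⟨r, hr⟩ := exists_section h hh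
  exact ⟨r, by rw [ratFun_eq_germ, hr]⟩

/-- Nonempty open sets. -/
abbrev GenericOpens (X : Scheme.{0}) [IsIntegral X] := {U : X.Opens // genericPoint X ∈ U}

/-- Generic linear functionals on `M`: compatible families of semilinear maps from the sections over
the nonempty open sets to the function field. -/
def genericDual (M : PMod X) :
    Submodule X.functionField (∀ U : GenericOpens X, M.obj (op U.1) →+ X.functionField) where
  carrier := {θ | (∀ (U : GenericOpens X) (r : Γ(X, U.1)) (m : M.obj (op U.1)),
      θ U (r • m) = ratFun U.2 r * θ U m) ∧
    ∀ (U V : GenericOpens X) (h : V.1 ≤ U.1) (m : M.obj (op U.1)), θ V (resSec M h m) = θ U m}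
  zero_mem' := ⟨fun _ _ _ => (mul_zero _).symm, fun _ _ _ _ => rfl⟩
  add_mem' := fun {θ θ'} h h' => ⟨fun U r m => by
      simp only [Pi.add_apply, AddMonoidHom.add_apply, h.1, h'.1, mul_add],
    fun U V hUV m => by simp only [Pi.add_apply, AddMonoidHom.add_apply, h.2 U V, h'.2 U V]⟩
  smul_mem' := fun c θ h => ⟨fun U r m => by
      simp only [Pi.smul_apply, AddMonoidHom.smul_apply, h.1, smul_eq_mul]; ring,
    fun U V hUV m => by simp only [Pi.smul_apply, AddMonoidHom.smul_apply, h.2 U V]⟩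

variable {F : X.Modules} (D : CDiv X)

/-- Sections of `𝒪_X(D)` as rational functions. -/
def divVal {U : X.Opens} (hU : genericPoint X ∈ U) : (divisorSheaf D).obj (op U) →+ X.functionField where
  toFun := fun s : divisorSections D U => s.1 ⟨genericPoint X, hU⟩
  map_zero' := rfl
  map_add' _ _ := rfl

lemma divVal_smul {U : X.Opens} (hU : genericPoint X ∈ U) (r : Γ(X, U))
    (s : (divisorSheaf D).obj (op U)) : divVal D hU (r • s) = ratFun hU r * divVal D hU s := rfl

lemma divVal_resSec {U V : X.Opens} (h : V ≤ U) (hV : genericPoint X ∈ V)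
    (s : (divisorSheaf D).obj (op U)) : divVal D hV (resSec _ h s) = divVal D (h hV) s := rfl

lemma divVal_injective {U : X.Opens} (hU : genericPoint X ∈ U) : Function.Injective (divVal D hU) :=
  fun s t h => Subtype.ext (funext fun x =>
    ((s : divisorSections D U).2.1 x ⟨_, hU⟩).trans
      (h.trans ((t : divisorSections D U).2.1 ⟨_, hU⟩ x)))

lemma isSectionAt_divVal {U : X.Opens} (hU : genericPoint X ∈ U) (s : (divisorSheaf D).obj (op U))
    {x : X} (hx : x ∈ U) : IsSectionAt D x (divVal D hU s) := by
  have := (s : divisorSections D U).2.2 ⟨x, hx⟩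
  rwa [(s : divisorSections D U).2.1 ⟨x, hx⟩ ⟨_, hU⟩] at this

variable {D} in
/-- The section of `𝒪_X(D)` given by a rational function. -/
def divSec {U : X.Opens} (h : X.functionField) (hh : ∀ x ∈ U, IsSectionAt D x h) :
    (divisorSheaf D).obj (op U) := (⟨fun _ => h, fun _ _ => rfl, fun x => hh x.1 x.2⟩ : divisorSections D U)

/-- The value of a generic functional, on sections of the presheaf `M ⊗ 𝒪_X(D)`. -/
def preTwistVal {M : PMod X} (θ : genericDual M) {U : X.Opens} (hU : genericPoint X ∈ U) :
    (M ⊗ divisorSheaf D).obj (op U) →+ X.functionField :=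
  TensorProduct.liftAddHom (R := Γ(X, U)) (M := M.obj (op U)) (N := (divisorSheaf D).obj (op U))
    (AddMonoidHom.mul.compr₂ (AddMonoidHom.id _) |>.comp (θ.1 ⟨U, hU⟩) |>.flip.comp (divVal D hU) |>.flip)
    (fun r m s => by
      change θ.1 ⟨U, hU⟩ (r • m) * divVal D hU s = θ.1 ⟨U, hU⟩ m * divVal D hU (r • s)
      rw [θ.2.1, divVal_smul]; ring)

lemma preTwistVal_tmul {M : PMod X} (θ : genericDual M) {U : X.Opens} (hU : genericPoint X ∈ U)
    (m : M.obj (op U)) (s : (divisorSheaf D).obj (op U)) :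
    preTwistVal D θ hU (m ⊗ₜ[Γ(X, U)] s) = θ.1 ⟨U, hU⟩ m * divVal D hU s := rfl

omit [IsIntegral X] in
lemma resSec_tmul {M N : PMod X} {U V : X.Opens} (h : V ≤ U) (m : M.obj (op U)) (n : N.obj (op U)) :
    resSec (M ⊗ N) h (m ⊗ₜ[Γ(X, U)] n) = resSec M h m ⊗ₜ[Γ(X, V)] resSec N h n := rfl

omit [IsIntegral X] in
lemma tensor_induction {M N : PMod X} {U : X.Opens} {P : (M ⊗ N).obj (op U) → Prop}
    (z : (M ⊗ N).obj (op U)) (h0 : P 0) (ht : ∀ m n, P (m ⊗ₜ[Γ(X, U)] n))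
    (ha : ∀ x y, P x → P y → P (x + y)) : P z :=
  TensorProduct.induction_on (R := Γ(X, U)) (M := M.obj (op U)) (N := N.obj (op U)) z h0 ht ha

/-- The functional that `θ` induces on the presheaf `M ⊗ 𝒪_X(D)`. -/
def preTwist {M : PMod X} (θ : genericDual M) : genericDual (M ⊗ divisorSheaf D) := by
  refine ⟨fun U => preTwistVal D θ U.2, fun U r z => ?_, fun U V h z => ?_⟩
  · refine tensor_induction (P := fun z => preTwistVal D θ U.2 (r • z) =
      ratFun U.2 r * preTwistVal D θ U.2 z) z (by simp) (fun m s => ?_)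
      (fun x y hx hy => by rw [smul_add, map_add, map_add, hx, hy, mul_add])
    change preTwistVal D θ U.2 ((r • m) ⊗ₜ[Γ(X, U.1)] s) = _
    rw [preTwistVal_tmul, preTwistVal_tmul, θ.2.1]; ring
  · refine tensor_induction (P := fun z => preTwistVal D θ V.2 (resSec _ h z) =
      preTwistVal D θ U.2 z) z (by simp) (fun m s => ?_)
      (fun x y hx hy => by rw [map_add, map_add, map_add, hx, hy])
    rw [resSec_tmul, preTwistVal_tmul, preTwistVal_tmul, divVal_resSec, θ.2.2 U V h]

lemma preTwist_tmul {M : PMod X} (θ : genericDual M) (U : GenericOpens X)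
    (m : M.obj (op U.1)) (s : (divisorSheaf D).obj (op U.1)) :
    (preTwist D θ).1 U (m ⊗ₜ[Γ(X, U.1)] s) = θ.1 U m * divVal D U.2 s := rfl

lemma exists_generic_repr (M : PMod X) (U : GenericOpens X) (m : (toPMod (sheafify M)).obj (op U.1)) :
    ∃ (V : GenericOpens X) (hV : V.1 ≤ U.1) (n : M.obj (op V.1)),
      toSheafify M V.1 n = resSec (toPMod (sheafify M)) hV m := by
  obtain ⟨V, hV, hx, n, hn⟩ := exists_toSheafify_eq_res M m U.2
  exact ⟨⟨V, hx⟩, hV, n, hn⟩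

/-- Two presheaf representatives of one section agree on a smaller neighbourhood of the generic
point, and θ does not change under restriction. This makes θ well defined on the sheafification. -/
lemma genericDual_eq_of_toSheafify_eq {M : PMod X} (θ : genericDual M) (U V V' : GenericOpens X)
    (hV : V.1 ≤ U.1) (hV' : V'.1 ≤ U.1) (m : (toPMod (sheafify M)).obj (op U.1))
    (n : M.obj (op V.1)) (n' : M.obj (op V'.1))
    (hn : toSheafify M V.1 n = resSec (toPMod (sheafify M)) hV m)
    (hn' : toSheafify M V'.1 n' = resSec (toPMod (sheafify M)) hV' m) : θ.1 V n = θ.1 V' n' := by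
  have h : toSheafify M (V.1 ⊓ V'.1) (resSec M inf_le_left n) =
      toSheafify M (V.1 ⊓ V'.1) (resSec M inf_le_right n') := by
    rw [toSheafify_res, toSheafify_res, hn, hn', resSec_resSec, resSec_resSec]
  obtain ⟨W, hW, hx, e⟩ := exists_res_eq_of_toSheafify_eq M h (x := genericPoint X) ⟨V.2, V'.2⟩
  rw [resSec_resSec, resSec_resSec] at e
  rw [← θ.2.2 V ⟨W, hx⟩ (hW.trans inf_le_left), e, θ.2.2 V' ⟨W, hx⟩ (hW.trans inf_le_right)]

/-- The value of a generic functional on a section of the sheafification. -/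
def sheafifyVal {M : PMod X} (θ : genericDual M) (U : GenericOpens X)
    (m : (toPMod (sheafify M)).obj (op U.1)) : X.functionField :=
  θ.1 (exists_generic_repr M U m).choose (exists_generic_repr M U m).choose_spec.choose_spec.choose

lemma sheafifyVal_eq {M : PMod X} (θ : genericDual M) (U V : GenericOpens X)
    (hV : V.1 ≤ U.1) (m : (toPMod (sheafify M)).obj (op U.1)) (n : M.obj (op V.1))
    (hn : toSheafify M V.1 n = resSec (toPMod (sheafify M)) hV m) :
    sheafifyVal θ U m = θ.1 V n :=
  genericDual_eq_of_toSheafify_eq θ U _ V _ hV m _ n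
    (exists_generic_repr M U m).choose_spec.choose_spec.choose_spec hn

lemma sheafifyVal_add {M : PMod X} (θ : genericDual M) (U : GenericOpens X)
    (m m' : (toPMod (sheafify M)).obj (op U.1)) :
    sheafifyVal θ U (m + m') = sheafifyVal θ U m + sheafifyVal θ U m' := by
  obtain ⟨V, hV, n, hn⟩ := exists_generic_repr M U m
  obtain ⟨V', hV', n', hn'⟩ := exists_generic_repr M U m'
  let W : GenericOpens X := ⟨V.1 ⊓ V'.1, V.2, V'.2⟩
  have e : toSheafify M W.1 (resSec M inf_le_left n + resSec M inf_le_right n') =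
      resSec (toPMod (sheafify M)) (inf_le_left.trans hV) (m + m') := by
    rw [map_add, map_add]
    refine congrArg₂ (· + ·) ((toSheafify_res M inf_le_left n).trans ?_)
      ((toSheafify_res M inf_le_right n').trans ?_)
    · rw [hn]; exact resSec_resSec _ _ _ m
    · rw [hn']; exact resSec_resSec _ _ _ m'
  refine (sheafifyVal_eq θ U W (inf_le_left.trans hV) (m + m') _ e).trans ?_
  refine (map_add (θ.1 W) _ _).trans (congrArg₂ (· + ·) ?_ ?_)
  · exact (θ.2.2 V W inf_le_left n).trans (sheafifyVal_eq θ U V hV m n hn).symm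
  · exact (θ.2.2 V' W inf_le_right n').trans (sheafifyVal_eq θ U V' hV' m' n' hn').symm

lemma sheafifyVal_smul {M : PMod X} (θ : genericDual M) (U : GenericOpens X) (r : Γ(X, U.1))
    (m : (toPMod (sheafify M)).obj (op U.1)) :
    sheafifyVal θ U (r • m) = ratFun U.2 r * sheafifyVal θ U m := by
  obtain ⟨V, hV, n, hn⟩ := exists_generic_repr M U m
  have e : toSheafify M V.1 (resFun hV r • n) = resSec (toPMod (sheafify M)) hV (r • m) := by
    rw [toSheafify_smul, hn, resSec_smul]
  rw [sheafifyVal_eq θ U V hV m n hn, sheafifyVal_eq θ U V hV (r • m) _ e, θ.2.1, ratFun_resFun]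

/-- The functional induced on the sheafification. -/
def sheafifyDual {M : PMod X} (θ : genericDual M) : genericDual (toPMod (sheafify M)) :=
  ⟨fun U => AddMonoidHom.mk' (sheafifyVal θ U) (sheafifyVal_add θ U), sheafifyVal_smul θ,
    fun U V h m => by
      obtain ⟨W, hW, n, hn⟩ := exists_generic_repr M V (resSec _ h m)
      exact (sheafifyVal_eq θ V W hW _ n hn).trans
        (sheafifyVal_eq θ U W (hW.trans h) m n (hn.trans (resSec_resSec _ _ _ m))).symm⟩

lemma sheafifyDual_eq {M : PMod X} (θ : genericDual M) (U V : GenericOpens X)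
    (hV : V.1 ≤ U.1) (m : (toPMod (sheafify M)).obj (op U.1)) (n : M.obj (op V.1))
    (hn : toSheafify M V.1 n = resSec (toPMod (sheafify M)) hV m) :
    (sheafifyDual θ).1 U m = θ.1 V n := sheafifyVal_eq θ U V hV m n hn

/-- The functional that `θ` induces on the twist `F(D)`. -/
def twistDual (θ : genericDual (toPMod F)) : genericDual (toPMod (twist F D)) :=
  sheafifyDual (preTwist D θ)

/-- The generic functional `θ` carries `M` into `𝒪_X(E)`. -/
def MapsInto {M : PMod X} (θ : genericDual M) (E : CDiv X) : Prop :=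
  ∀ (U : GenericOpens X) (m : M.obj (op U.1)) (x : X), x ∈ U.1 → IsSectionAt E x (θ.1 U m)

lemma isSectionAt_add {x : X} {h k : X.functionField} (hh : IsSectionAt D x h)
    (hk : IsSectionAt D x k) : IsSectionAt D x (h + k) := fun f hf => by
  rw [add_mul]; exact (RingHom.range _).add_mem (hh f hf) (hk f hf)

lemma isSectionAt_zero (x : X) : IsSectionAt D x 0 := fun f _ => by
  rw [zero_mul]; exact (RingHom.range _).zero_mem

variable {D} in
-- The claim is local, so it may be checked on pure tensors, whose value is a product of a section
-- for E and one for D.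
lemma MapsInto.twistDual {θ : genericDual (toPMod F)} {E : CDiv X} (h : MapsInto θ E) :
    MapsInto (twistDual D θ) (E + D) := by
  intro U m x hx
  obtain ⟨V, hV, hxV, n, hn⟩ := exists_toSheafify_eq_res (toPMod F ⊗ divisorSheaf D) m hx
  let V' : GenericOpens X := ⟨V, genericPoint_mem hxV⟩
  have e : (CoxEuler.twistDual D θ).1 U m = (preTwist D θ).1 V' n := sheafifyDual_eq (preTwist D θ) U V' hV m n hn
  rw [e]
  refine tensor_induction (P := fun n => IsSectionAt (E + D) x ((preTwist D θ).1 V' n)) n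
    (by rw [map_zero]; exact isSectionAt_zero _ _) (fun m s => ?_)
    (fun _ _ ha hb => by rw [map_add]; exact isSectionAt_add _ ha hb)
  exact (h V' m x hxV).mul (isSectionAt_divVal D V'.2 s hxV)

/-- The inverse of a local equation is a free generator of the sheaf of D, so all second factors can
be moved to the left of the tensor sign. -/
lemma exists_eq_tmul {M : PMod X} {V : X.Opens} (hV : genericPoint X ∈ V) (f : (X.functionField)ˣ)
    (hf : ∀ x ∈ V, IsLocalEquationAt D x f) (n : (M ⊗ divisorSheaf D).obj (op V)) :
    ∃ m : M.obj (op V), n = m ⊗ₜ[Γ(X, V)] (divSec (D := D) ((f⁻¹ : (X.functionField)ˣ) : X.functionField)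
      (fun x hx => isSectionAt_of (hf x hx) (by
        rw [Units.inv_mul]; exact (RingHom.range _).one_mem))) := by
  refine tensor_induction (P := fun n => ∃ m : M.obj (op V), n = m ⊗ₜ[Γ(X, V)] _) n ?_ ?_ ?_
  · exact ⟨0, (TensorProduct.zero_tmul _ _).symm⟩
  · intro m s
    obtain ⟨r, hr⟩ := exists_ratFun_eq hV (h := divVal D hV s * f)
      (fun x hx => isSectionAt_divVal D hV s hx f (hf x hx))
    refine ⟨r • m, ?_⟩
    refine Eq.trans ?_ (TensorProduct.smul_tmul (R := Γ(X, V)) (R' := Γ(X, V)) (M := M.obj (op V))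
      (N := (divisorSheaf D).obj (op V)) r m _).symm
    congr 1
    apply divVal_injective D hV
    rw [divVal_smul, hr]
    change _ = _ * ((f⁻¹ : (X.functionField)ˣ) : X.functionField)
    rw [mul_assoc, Units.mul_inv, mul_one]
  · rintro x y ⟨m, rfl⟩ ⟨m', rfl⟩
    exact ⟨m + m', (TensorProduct.add_tmul _ _ _).symm⟩

/-- A family of generic functionals separates sections. -/
def Separates {M : PMod X} {κ : Type} (θ : κ → genericDual M) : Prop :=
  ∀ (U : GenericOpens X) (m : M.obj (op U.1)), (∀ a, (θ a).1 U m = 0) → m = 0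

lemma exists_equation (D : CDiv X) {U : X.Opens} {x : X} (hx : x ∈ U) :
    ∃ V ≤ U, x ∈ V ∧ ∃ f : (X.functionField)ˣ, ∀ y ∈ V, IsLocalEquationAt D y f := by
  obtain ⟨V, hxV, f, hf⟩ := D.2 x
  exact ⟨V ⊓ U, inf_le_right, ⟨hxV, hx⟩, f, fun y hy => hf y hy.1⟩

/-- Locally a section of the twist is m' ⊗ f⁻¹ with f a local equation, and its value is θ(m') f⁻¹.
As f⁻¹ is not zero, the vanishing of all values forces m' = 0. -/
lemma Separates.twistDual {κ : Type} {θ : κ → genericDual (toPMod F)} (h : Separates θ) :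
    Separates fun a => twistDual D (θ a) := by
  intro U m hm
  have key : ∀ x : U.1, ∃ (V : X.Opens) (hV : V ≤ U.1), x.1 ∈ V ∧
      resSec (toPMod (twist F D)) hV m = 0 := by
    rintro ⟨x, hx⟩
    obtain ⟨V, hV, hxV, n, hn⟩ := exists_toSheafify_eq_res (toPMod F ⊗ divisorSheaf D) m hx
    obtain ⟨W, hW, hxW, f, hf⟩ := exists_equation D hxV
    let W' : GenericOpens X := ⟨W, genericPoint_mem hxW⟩
    obtain ⟨m', hm'⟩ := exists_eq_tmul D W'.2 f hf (resSec _ hW n)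
    have hres : toSheafify (toPMod F ⊗ divisorSheaf D) W (resSec _ hW n) = resSec _ (hW.trans hV) m := by
      rw [toSheafify_res, hn]
      exact resSec_resSec (toPMod (twist F D)) hV hW m
    refine ⟨W, hW.trans hV, hxW, ?_⟩
    have h0 : m' = 0 := by
      refine h W' m' fun a => ?_
      have e : (preTwist D (θ a)).1 W' (resSec _ hW n) = 0 :=
        (sheafifyDual_eq (preTwist D (θ a)) U W' (hW.trans hV) m _ hres).symm.trans (hm a)
      rw [hm', preTwist_tmul] at e
      refine (mul_eq_zero.mp e).resolve_right ?_
      exact Units.ne_zero f⁻¹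
    refine hres.symm.trans ?_
    rw [hm', h0]
    refine (congrArg _ (TensorProduct.zero_tmul _ _)).trans (map_zero _)
  choose V hV hxV h0 using key
  refine eq_of_locally (twist F D) V U.1 hV (fun x hx => Opens.mem_iSup.mpr ⟨⟨x, hx⟩, hxV ⟨x, hx⟩⟩) _ _
    fun i => ?_
  rw [h0, map_zero]

/-- The value of `θ` on global sections of `F(D)`. -/
def globalVal (θ : genericDual (toPMod F)) : H0 (twist F D) →+ X.functionField :=
  (twistDual D θ).1 ⟨⊤, trivial⟩

omit [IsIntegral X] in
lemma toSheafify_naturality {L L' : PMod X} (φ : L ⟶ L') {U : X.Opens} (n : (toPMod F ⊗ L).obj (op U)) :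
    (tensorMap F φ).val.app (op U) (toSheafify _ U n) = toSheafify _ U ((toPMod F ◁ φ).app (op U) n) :=
  (congrArg (fun h : (toPMod F ⊗ L) ⟶ toPMod (tensor F L') => h.app (op U) n) ((PresheafOfModules.sheafificationAdjunction
    (𝟙 X.ringCatSheaf.obj)).unit.naturality (toPMod F ◁ φ))).symm

/-- This compatibility makes the map from the section module to the Cox ring linear over the Cox
ring. -/
lemma globalVal_twistMul (θ : genericDual (toPMod F)) {D E : CDiv X} {h : X.functionField}
    (hh : Multiplies D E h) (x : H0 (twist F D)) :
    globalVal E θ (twistMul F h hh x) = h * globalVal D θ x := by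
  obtain ⟨V, hV, n, hn⟩ := exists_generic_repr (toPMod F ⊗ divisorSheaf D) ⟨⊤, trivial⟩ x
  have e1 : globalVal D θ x = (preTwist D θ).1 V n := sheafifyDual_eq (preTwist D θ) _ V hV x n hn
  have hn' : toSheafify (toPMod F ⊗ divisorSheaf E) V.1 ((toPMod F ◁ mulHom h hh).app (op V.1) n) =
      resSec (toPMod (twist F E)) hV (twistMul F h hh x) := by
    refine (toSheafify_naturality (mulHom h hh) n).symm.trans ?_
    rw [hn]
    exact PresheafOfModules.naturality_apply (tensorMap F (mulHom h hh)).val (homOfLE hV).op x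
  have e2 : globalVal E θ (twistMul F h hh x) =
      (preTwist E θ).1 V ((toPMod F ◁ mulHom h hh).app (op V.1) n) :=
    sheafifyDual_eq (preTwist E θ) _ V hV _ _ hn'
  rw [e1, e2]
  refine tensor_induction (P := fun n => (preTwist E θ).1 V ((toPMod F ◁ mulHom h hh).app (op V.1) n) =
    h * (preTwist D θ).1 V n) n (by simp) (fun m s => ?_)
    (fun _ _ ha hb => by rw [map_add, map_add, map_add, ha, hb, mul_add])
  change θ.1 V m * (h * divVal D V.2 s) = h * (θ.1 V m * divVal D V.2 s)
  ring

end GenericFunctionals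
end CoxEuler
end

noncomputable section
namespace CoxEuler

/-! ### Finiteness, separation and bounded poles of functionals -/

section ReflexiveFunctionals
variable {X : Scheme.{0}} [IsIntegral X] {F : X.Modules}

/-- A property of the values of a generic functional that holds for generators of the sheaf near a
point, and is stable under linear combinations, holds for all sections near that point. -/
lemma genericDual_induction {U : X.Opens} {ι : Type} (s : ι → (toPMod F).obj (op U))
    (hs : ∀ (V : X.Opens) (hV : V ≤ U) (m : (toPMod F).obj (op V)) (y : X), y ∈ V →
        ∃ (W : X.Opens) (hW : W ≤ V), y ∈ W ∧ resSec (toPMod F) hW m ∈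
          Submodule.span Γ(X, W) (Set.range fun i => resSec (toPMod F) (hW.trans hV) (s i)))
    (hU : genericPoint X ∈ U) (θ : genericDual (toPMod F)) (x : X) (hx : x ∈ U)
    (P : X.functionField → Prop) (h0 : P 0) (ha : ∀ a b, P a → P b → P (a + b))
    (hm : ∀ r a, IsRegularAt x r → P a → P (r * a)) (hP : ∀ i, P (θ.1 ⟨U, hU⟩ (s i)))
    (V : GenericOpens X) (hxV : x ∈ V.1) (m : (toPMod F).obj (op V.1)) : P (θ.1 V m) := by
  obtain ⟨W, hW, hxW, h⟩ := hs (V.1 ⊓ U) inf_le_right (resSec _ inf_le_left m) x ⟨hxV, hx⟩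
  let W' : GenericOpens X := ⟨W, genericPoint_mem hxW⟩
  have e : θ.1 V m = θ.1 W' (resSec _ hW (resSec _ inf_le_left m)) := by
    rw [resSec_resSec, θ.2.2 V W' (hW.trans inf_le_left)]
  rw [e]
  refine Submodule.span_induction (p := fun z _ => P (θ.1 W' z)) ?_ ?_ ?_ ?_ h
  · rintro _ ⟨i, rfl⟩
    rw [θ.2.2 ⟨U, hU⟩ W' (hW.trans inf_le_right)]
    exact hP i
  · rwa [map_zero]
  · intro a b _ _ h h'
    rw [map_add]; exact ha _ _ h h'
  · intro r a _ h
    rw [θ.2.1]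
    exact hm _ _ (isRegularAt_ratFun W'.2 r hxW) h

/-- A functional is determined by its values on finitely many sections that generate F near the
generic point. -/
lemma finiteDimensional_genericDual (hF : IsCoherent F) :
    FiniteDimensional X.functionField (genericDual (toPMod F)) := by
  obtain ⟨U, hU, ι, _, s, hs⟩ := exists_local_generators hF (genericPoint X)
  let e : genericDual (toPMod F) →ₗ[X.functionField] (ι → X.functionField) :=
    { toFun := fun θ i => θ.1 ⟨U, hU⟩ (s i)
      map_add' := fun _ _ => rfl
      map_smul' := fun _ _ => rfl }
  have he : Function.Injective e := by
    rw [injective_iff_map_eq_zero]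
    intro θ hθ
    refine Subtype.ext (funext fun V => AddMonoidHom.ext fun m => ?_)
    exact genericDual_induction s hs hU θ _ hU (· = 0) rfl (fun a b h h' => by rw [h, h', add_zero])
      (fun r a _ h => by rw [h, mul_zero]) (fun i => congrFun hθ i) V V.2 m
  have := Fintype.ofFinite ι
  exact FiniteDimensional.of_injective e he

lemma genericPoint_mem_inf {U V : X.Opens} (hU : genericPoint X ∈ U) (hV : genericPoint X ∈ V) :
    genericPoint X ∈ U ⊓ V := ⟨hU, hV⟩

/-- A linear form on `M` over a nonempty open set, as a generic functional. -/
def genericOfDual (M : PMod X) {V : X.Opens} (hV : genericPoint X ∈ V) (φ : dualSections M V) :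
    genericDual M := by
  refine ⟨fun U => (ratFun (genericPoint_mem_inf U.2 hV)).toAddMonoidHom.comp
    ((φ.1 ⟨U.1 ⊓ V, inf_le_right⟩).toAddMonoidHom.comp (resSec M inf_le_left)), fun U r m => ?_,
      fun U W h m => ?_⟩
  · change ratFun _ (φ.1 ⟨U.1 ⊓ V, inf_le_right⟩ (resSec M inf_le_left (r • m))) =
      ratFun _ r * ratFun _ (φ.1 ⟨U.1 ⊓ V, inf_le_right⟩ (resSec M inf_le_left m))
    rw [resSec_smul, map_smul, smul_eq_mul, map_mul]
    exact congrArg (· * _) (ratFun_resFun inf_le_left (genericPoint_mem_inf U.2 hV) r)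
  · change ratFun _ (φ.1 ⟨W.1 ⊓ V, inf_le_right⟩ (resSec M inf_le_left (resSec M h m))) =
      ratFun _ (φ.1 ⟨U.1 ⊓ V, inf_le_right⟩ (resSec M inf_le_left m))
    have := φ.2 ⟨U.1 ⊓ V, inf_le_right⟩ ⟨W.1 ⊓ V, inf_le_right⟩ (inf_le_inf_right V h)
      (resSec M inf_le_left m)
    rw [resSec_resSec] at this ⊢
    rw [this]
    exact ratFun_resFun (inf_le_inf_right V h) (genericPoint_mem_inf W.2 hV) _

lemma genericOfDual_apply (M : PMod X) {V : X.Opens} (hV : genericPoint X ∈ V) (φ : dualSections M V)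
    (U : GenericOpens X) (h : V ≤ U.1) (m : M.obj (op U.1)) :
    (genericOfDual M hV φ).1 U m = ratFun hV (φ.1 ⟨V, le_rfl⟩ (resSec M h m)) := by
  change ratFun _ (φ.1 ⟨U.1 ⊓ V, inf_le_right⟩ (resSec M inf_le_left m)) = _
  have := φ.2 ⟨V, le_rfl⟩ ⟨U.1 ⊓ V, inf_le_right⟩ inf_le_right (resSec M h m)
  rw [resSec_resSec] at this
  rw [this]
  exact ratFun_resFun inf_le_right (genericPoint_mem_inf U.2 hV) _

/-- The generic functionals separate the sections of a reflexive sheaf. -/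
lemma separates_of_isReflexive (hF : IsReflexive F) :
    Separates fun θ : genericDual (toPMod F) => θ := by
  intro U m hm
  have hb := (bijective_bidualSection_iff _).mp hF.isIso U.1
  apply hb.1
  refine Subtype.ext (funext fun V => LinearMap.ext fun φ => ?_)
  change (φ : dualSections (toPMod F) V.1).1 ⟨V.1, le_rfl⟩ (resSec _ _ m) =
    (φ : dualSections (toPMod F) V.1).1 ⟨V.1, le_rfl⟩ (resSec _ _ 0)
  rw [map_zero, map_zero]
  -- A linear form over a nonempty open set extends to a functional with values in the function
  -- field, so the hypothesis applies to it. Over the empty set all functions are equal.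
  by_cases hV : genericPoint X ∈ V.1
  · apply ratFun_injective hV
    rw [map_zero, ← genericOfDual_apply (toPMod F) hV φ U V.2 m]
    exact hm _
  · have : V.1 = ⊥ := by
      exact eq_bot_iff.mpr fun x hx => hV (genericPoint_mem hx)
    have hs : Subsingleton Γ(X, V.1) := by
      rw [this]; exact CommRingCat.subsingleton_of_isTerminal X.sheaf.isTerminalOfEmpty
    exact Subsingleton.elim _ _

/-- The poles of a generic functional are bounded by the poles of finitely many rational functions. -/
lemma exists_mapsInto [CompactSpace X] (hF : IsCoherent F) (θ : genericDual (toPMod F)) :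
    ∃ T : Set X.functionField, T.Finite ∧ ∀ (q : X.functionField) (D : CDiv X),
      (∀ c ∈ T, q * c ∈ sectionSpace D) → MapsInto (q • θ) D := by
  choose U hU ι hι s hs using exists_local_generators hF
  obtain ⟨t, ht⟩ := isCompact_univ.elim_nhds_subcover (fun x : X => (U x : Set X))
    (fun x _ => (U x).isOpen.mem_nhds (hU x))
  -- T consists of the values of θ on local generators over a finite cover; any other value is
  -- locally a combination of these with regular coefficients.
  refine ⟨⋃ x ∈ t, Set.range fun i => θ.1 ⟨U x, genericPoint_mem (hU x)⟩ (s x i), ?_, ?_⟩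
  · exact t.finite_toSet.biUnion fun x _ => by have := hι x; exact Set.finite_range _
  · intro q D hq V m y hy
    obtain ⟨x, hx, hyx⟩ := Set.mem_iUnion₂.mp (ht.2 (Set.mem_univ y))
    refine genericDual_induction (s x) (hs x) (genericPoint_mem (hU x)) (q • θ) y hyx
      (IsSectionAt D y) (isSectionAt_zero _ _) (fun a b h h' => isSectionAt_add _ h h')
      (fun r a hr h => h.regular_mul hr) (fun i => ?_) V hy m
    exact hq _ (Set.mem_iUnion₂.mpr ⟨x, hx, i, rfl⟩) y

end ReflexiveFunctionals
end CoxEuler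
end

noncomputable section
namespace CoxEuler

/-! ### Homogeneous coordinates as rational functions on X -/

section ProjectiveCharts
open HomogeneousLocalization
attribute [local instance] MvPolynomial.gradedAlgebra

/-- The grading of the polynomial ring by degree. -/
abbrev polyGrading (n : ℕ) := MvPolynomial.homogeneousSubmodule (Fin (n + 1)) ℂ

lemma X_mem (n : ℕ) (k : Fin (n + 1)) : (MvPolynomial.X k : MvPolynomial (Fin (n + 1)) ℂ) ∈ polyGrading n 1 :=
  MvPolynomial.isHomogeneous_X ℂ k

lemma C_mem (n : ℕ) (z : ℂ) : (MvPolynomial.C z : MvPolynomial (Fin (n + 1)) ℂ) ∈ polyGrading n 0 :=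
  MvPolynomial.isHomogeneous_C _ z

lemma adjoin_range_X (n : ℕ) : Algebra.adjoin (polyGrading n 0)
    (Set.range (MvPolynomial.X : Fin (n + 1) → MvPolynomial (Fin (n + 1)) ℂ)) = ⊤ := by
  rw [eq_top_iff]
  rintro p -
  induction p using MvPolynomial.induction_on with
  | C z => exact Subalgebra.algebraMap_mem _ (⟨_, C_mem n z⟩ : polyGrading n 0)
  | add p q hp hq => exact add_mem hp hq
  | mul_X p k hp => exact mul_mem hp (Algebra.subset_adjoin ⟨k, rfl⟩)

/-- The coordinate `x_l / x_k`. -/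
def awayCoord (n : ℕ) (k l : Fin (n + 1)) : Away (polyGrading n) (MvPolynomial.X k) :=
  Away.mk (polyGrading n) (X_mem n k) 1 (MvPolynomial.X l) (by simpa using X_mem n l)

/-- The constant `z`. -/
def awayConst (n : ℕ) (k : Fin (n + 1)) (z : ℂ) : Away (polyGrading n) (MvPolynomial.X k) :=
  fromZeroRingHom (polyGrading n) _ ⟨_, C_mem n z⟩

/-- The degree-zero part of the localization at x_k is generated as a ring by the constants and the
quotients x_l / x_k. -/
lemma away_induction (n : ℕ) (k : Fin (n + 1)) {P : Away (polyGrading n) (MvPolynomial.X k) → Prop}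
    (hc : ∀ z, P (awayConst n k z)) (hx : ∀ l, P (awayCoord n k l))
    (ha : ∀ a b, P a → P b → P (a + b)) (hm : ∀ a b, P a → P b → P (a * b)) (a) : P a := by
  have h1 : P 1 := by
    have := hc 1
    have e : awayConst n k 1 = 1 := by
      refine (congrArg (fromZeroRingHom (polyGrading n) _) (Subtype.ext ?_)).trans (map_one _)
      exact MvPolynomial.C_1
    rwa [e] at this
  have hpow : ∀ a m, P a → P (a ^ m) := fun a m h => by
    induction m with
    | zero => rwa [pow_zero]
    | succ m ih => rw [pow_succ]; exact hm _ _ ih h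
  have hmem : a ∈ (⊤ : Subalgebra (polyGrading n 0) (Away (polyGrading n) (MvPolynomial.X k))) := trivial
  rw [← Away.adjoin_mk_prod_pow_eq_top (X_mem n k) (Fin (n + 1)) MvPolynomial.X (adjoin_range_X n)
    (fun _ => 1) (X_mem n)] at hmem
  induction hmem using Algebra.adjoin_induction with
  | mem x h =>
    obtain ⟨a, ai, hai, -, rfl⟩ := h
    -- A monomial of degree a divided by x_k to the power a is a product of coordinates x_i / x_k.
    have e : Away.mk (polyGrading n) (X_mem n k) a (∏ i, MvPolynomial.X i ^ ai i)
        (hai ▸ SetLike.prod_pow_mem_graded _ _ _ _ fun i _ ↦ X_mem n i) =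
          ∏ i, awayCoord n k i ^ ai i := by
      apply HomogeneousLocalization.val_injective
      have hv : ∀ i, (awayCoord n k i).val = Localization.mk (MvPolynomial.X i)
        (⟨MvPolynomial.X k ^ 1, 1, rfl⟩ : Submonoid.powers (MvPolynomial.X k)) := fun i => rfl
      have hp : (∏ i, awayCoord n k i ^ ai i).val = ∏ i, (awayCoord n k i).val ^ ai i := by
        refine (map_prod (algebraMap (Away (polyGrading n) (MvPolynomial.X k))
          (Localization (Submonoid.powers (MvPolynomial.X k : MvPolynomial (Fin (n + 1)) ℂ)))) _ _).trans ?_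
        simp only [map_pow]
        rfl
      rw [hp, Away.val_mk]
      simp only [hv, Localization.mk_pow, Localization.mk_prod]
      congr 1
      apply Subtype.ext
      simp only [SubmonoidClass.coe_pow, pow_one,
        Finset.prod_pow_eq_pow_sum]
      congr 1
      simpa using hai.symm
    rw [e]
    exact Finset.prod_induction _ P (fun a b => hm a b) h1 (fun i _ => hpow _ _ (hx i))
  | algebraMap r =>
    obtain ⟨r, hr⟩ := r
    have hr' : r ∈ (1 : Submodule ℂ (MvPolynomial (Fin (n + 1)) ℂ)) :=
      MvPolynomial.homogeneousSubmodule_zero (σ := Fin (n + 1)) (R := ℂ) ▸ hr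
    rw [Submodule.mem_one] at hr'
    obtain ⟨z, hz⟩ := hr'
    have := hc z
    convert this using 1
    exact congrArg (fromZeroRingHom (polyGrading n) _) (Subtype.ext hz.symm)
  | add x y _ _ h h' => exact ha _ _ h h'
  | mul x y _ _ h h' => exact hm _ _ h h'

variable {X : Scheme.{0}} [IsIntegral X]

/-- An affine chart of a variety embedded in projective space, with its homogeneous coordinates as
rational functions. -/
structure ProjectiveCharts (f : X ⟶ Spec (.of ℂ)) where
  κ : Type
  finite : Finite κ
  U : κ → X.Opens
  u : κ → (X.functionField)ˣ
  isAffineOpen : ∀ k, IsAffineOpen (U k)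
  generic : ∀ k, genericPoint X ∈ U k
  cover : ∀ x : X, ∃ k, x ∈ U k
  regular_iff : ∀ k c, (∀ x ∈ U k, IsRegularAt x c) ↔
    c ∈ (MvPolynomial.eval₂Hom (constFun f) fun l => ((u l / u k : (X.functionField)ˣ) : X.functionField)).range

section
variable {n : ℕ} (i : X ⟶ projSpace n)

/-- The image of the generic point, as a homogeneous prime ideal. -/
def genericIdeal : ProjectiveSpectrum (polyGrading n) := i (genericPoint X)

/-- The intersection of `X` with a standard open set. -/
def chart (k : Fin (n + 1)) : X.Opens := i ⁻¹ᵁ Proj.basicOpen (polyGrading n) (MvPolynomial.X k)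

/-- Rational functions on projective space that are regular at the image of the generic point, as
rational functions on `X`. -/
def stalkHom : AtPrime (polyGrading n) (genericIdeal i).asHomogeneousIdeal.toIdeal →+* X.functionField :=
  (i.stalkMap (genericPoint X)).hom.comp (Proj.stalkIso (polyGrading n) (i (genericPoint X))).inv.hom

/-- The restriction to `X` of functions on a standard open set. -/
def chartHom (k : Fin (n + 1)) (hk : genericPoint X ∈ chart i k) :
    Away (polyGrading n) (MvPolynomial.X k) →+* X.functionField :=
  (stalkHom i).comp (mapId (polyGrading n) (Q := (genericIdeal i).asHomogeneousIdeal.toIdeal.primeCompl)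
      (Submonoid.powers_le.mpr hk))

/-- The restriction to `X` of functions on a standard open set, as regular functions. -/
def chartFun (k : Fin (n + 1)) (a : Away (polyGrading n) (MvPolynomial.X k)) : Γ(X, chart i k) :=
  i.app _ (Proj.awayToSection (polyGrading n) (MvPolynomial.X k) a)

lemma stalkMap_germ {V : (projSpace n).Opens} (hV : i (genericPoint X) ∈ V) (s : Γ(projSpace n, V)) :
    i.stalkMap (genericPoint X) ((projSpace n).presheaf.germ V _ hV s) =
      ratFun (U := i ⁻¹ᵁ V) hV (i.app V s) := by
  have : Nonempty (i ⁻¹ᵁ V) := ⟨⟨_, hV⟩⟩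
  rw [ratFun_eq_germ (U := i ⁻¹ᵁ V) hV]
  exact Scheme.Hom.germ_stalkMap_apply i _ (genericPoint X) hV _

lemma chartHom_eq_stalkMap (k : Fin (n + 1)) (hk : genericPoint X ∈ chart i k)
    (a : Away (polyGrading n) (MvPolynomial.X k)) :
    chartHom i k hk a = i.stalkMap (genericPoint X) ((projSpace n).presheaf.germ _ _ hk
      (Proj.awayToSection (polyGrading n) (MvPolynomial.X k) a)) :=
  congrArg (i.stalkMap (genericPoint X)) (congrArg (fun h => h.hom a)
    (ProjectiveSpectrum.Proj.awayToSection_germ (polyGrading n)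
    (MvPolynomial.X k) (i (genericPoint X)) hk)).symm

lemma ratFun_chartFun (k : Fin (n + 1)) (hk : genericPoint X ∈ chart i k)
    (a : Away (polyGrading n) (MvPolynomial.X k)) :
    ratFun hk (chartFun i k a) = chartHom i k hk a :=
  ((chartHom_eq_stalkMap i k hk a).trans (stalkMap_germ i hk _)).symm

/-- This is (x_l / x_k)(x_m / x_l) = x_m / x_k in the local ring at the image of the generic point.
-/
lemma chartHom_coord_mul (k l m : Fin (n + 1))
    (hk : genericPoint X ∈ chart i k)
    (hl : genericPoint X ∈ chart i l) :
    chartHom i k hk (awayCoord n k l) * chartHom i l hl (awayCoord n l m) =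
      chartHom i k hk (awayCoord n k m) := by
  refine (map_mul (stalkHom i) _ _).symm.trans (congrArg (stalkHom i) ?_)
  apply HomogeneousLocalization.val_injective
  rw [HomogeneousLocalization.val_mul]
  have hv : ∀ (k l : Fin (n + 1)) (hk : genericPoint X ∈ chart i k),
      (mapId (polyGrading n) (Q := (genericIdeal i).asHomogeneousIdeal.toIdeal.primeCompl)
        (Submonoid.powers_le.mpr hk) (awayCoord n k l)).val =
        Localization.mk (MvPolynomial.X l) ⟨MvPolynomial.X k ^ 1, Submonoid.powers_le.mpr hk ⟨1, rfl⟩⟩ := fun k l hk => rfl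
  rw [hv k l hk, hv l m hl, hv k m hk, Localization.mk_mul, Localization.mk_eq_mk_iff, Localization.r_iff_exists]
  refine ⟨1, ?_⟩
  simp only [Submonoid.coe_mul, OneMemClass.coe_one]
  ring

lemma chartHom_coord_self (k : Fin (n + 1))
    (hk : genericPoint X ∈ chart i k) :
    chartHom i k hk (awayCoord n k k) = 1 := by
  refine (congrArg (chartHom i k hk) ?_).trans (map_one _)
  apply HomogeneousLocalization.val_injective
  rw [HomogeneousLocalization.val_one]
  refine Eq.trans ?_ (Localization.mk_self (⟨MvPolynomial.X k ^ 1, 1, rfl⟩ : Submonoid.powers (MvPolynomial.X k)))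
  simp [awayCoord]

/-- Here x_l lies in the prime ideal of the image of the generic point, so x_l / x_k is not a unit
there. The stalk map is local and its target is a field, so the image is not a unit and hence zero.
-/
lemma chartHom_coord_eq_zero (k l : Fin (n + 1))
    (hk : genericPoint X ∈ chart i k)
    (hl : genericPoint X ∉ chart i l) :
    chartHom i k hk (awayCoord n k l) = 0 := by
  by_contra h
  let z := mapId (polyGrading n) (Q := (genericIdeal i).asHomogeneousIdeal.toIdeal.primeCompl)
      (Submonoid.powers_le.mpr hk) (awayCoord n k l)
  let e := Proj.stalkIso (polyGrading n) (i (genericPoint X))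
  have h1 : IsUnit (i.stalkMap (genericPoint X) (e.inv z)) := isUnit_iff_ne_zero.mpr h
  have h2 : IsUnit (e.inv z) := isUnit_of_map_unit (i.stalkMap (genericPoint X)).hom _ h1
  have h3 : IsUnit z := by
    have := h2.map e.hom.hom
    rwa [show e.hom.hom (e.inv z) = z from congrArg (fun h => h.hom z) e.inv_hom_id] at this
  have h4 := (HomogeneousLocalization.isUnit_iff_isUnit_val (polyGrading n) _ _).mpr h3
  have hv : z.val = Localization.mk (MvPolynomial.X l) ⟨MvPolynomial.X k ^ 1, Submonoid.powers_le.mpr hk ⟨1, rfl⟩⟩ := rfl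
  rw [hv, Localization.mk_eq_mk'] at h4
  exact hl ((IsLocalization.AtPrime.isUnit_mk'_iff _ (genericIdeal i).asHomogeneousIdeal.toIdeal _ _).mp h4)

/-- On a standard open set the structure morphism of Proj is the inclusion of the elements of degree
zero. This identifies the constants in `chartHom_const`. -/
lemma toSpecZero_appTop_res (k : Fin (n + 1)) :
    (Proj.toSpecZero (polyGrading n)).appTop ≫ (projSpace n).presheaf.map
      (homOfLE (le_top : Proj.basicOpen (polyGrading n) (MvPolynomial.X k) ≤ ⊤)).op =
    (Scheme.ΓSpecIso (.of (polyGrading n 0))).hom ≫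
      CommRingCat.ofHom (fromZeroRingHom (polyGrading n) _) ≫
        Proj.awayToSection (polyGrading n) (MvPolynomial.X k) := by
  have h : (Proj.basicOpen (polyGrading n) (MvPolynomial.X k)).ι ≫ Proj.toSpecZero (polyGrading n) =
      Proj.basicOpenToSpec (polyGrading n) (MvPolynomial.X k) ≫
        Spec.map (CommRingCat.ofHom (fromZeroRingHom (polyGrading n) _)) := by
    rw [← Proj.awayι_toSpecZero (polyGrading n) _ (X_mem n k) one_pos, Proj.awayι, Category.assoc,
      ← Proj.basicOpenIsoSpec_hom (polyGrading n) _ (X_mem n k) one_pos, Iso.hom_inv_id_assoc]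
  have h' := congrArg Scheme.Hom.appTop h
  rw [Scheme.Hom.comp_appTop, Scheme.Hom.comp_appTop, Scheme.Opens.ι_appTop] at h'
  have h2 := Proj.basicOpenToSpec_app_top (polyGrading n) (MvPolynomial.X k)
  rw [show (Proj.basicOpenToSpec (polyGrading n) (MvPolynomial.X k)).appTop = _ from h2,
    Scheme.ΓSpecIso_naturality_assoc] at h'
  have h3 := congrArg (· ≫ (Proj.basicOpen (polyGrading n) (MvPolynomial.X k)).topIso.hom) h'
  simp only [Category.assoc, Iso.inv_hom_id, Category.comp_id] at h3
  refine Eq.trans (congrArg (fun g => (Proj.toSpecZero (polyGrading n)).appTop ≫ g) ?_)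
    ((Category.assoc _ _ _).symm.trans h3)
  rw [Scheme.Opens.topIso_hom]
  exact (Proj (polyGrading n)).presheaf.map_comp _ _

lemma chartHom_const (k : Fin (n + 1)) (z : ℂ)
    (hk : genericPoint X ∈ chart i k) :
    chartHom i k hk (awayConst n k z) = constFun (i ≫ projSpaceHom n) z := by
  let t : Γ(projSpace n, ⊤) := (projSpaceHom n).appTop ((Scheme.ΓSpecIso (.of ℂ)).inv z)
  have ht : Proj.awayToSection (polyGrading n) (MvPolynomial.X k) (awayConst n k z) =
      (projSpace n).presheaf.map (homOfLE le_top).op t := by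
    have h1 := congrArg (fun h => h.hom z) (Scheme.ΓSpecIso_inv_naturality (CommRingCat.ofHom
      (algebraMap ℂ (polyGrading n 0))))
    have h2 := congrArg (fun h => h.hom ((Scheme.ΓSpecIso (.of (polyGrading n 0))).inv
      (algebraMap ℂ (polyGrading n 0) z))) (toSpecZero_appTop_res k)
    have h3 : (Scheme.ΓSpecIso (.of (polyGrading n 0))).hom ((Scheme.ΓSpecIso (.of (polyGrading n 0))).inv
      (algebraMap ℂ (polyGrading n 0) z)) = algebraMap ℂ (polyGrading n 0) z :=
      congrArg (fun h => h.hom (algebraMap ℂ (polyGrading n 0) z)) (Scheme.ΓSpecIso (.of (polyGrading n 0))).inv_hom_id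
    refine Eq.trans ?_ (h2.symm.trans ?_)
    · refine congrArg (fun w => Proj.awayToSection (polyGrading n) (MvPolynomial.X k)
        (fromZeroRingHom (polyGrading n) _ w)) h3.symm
    · exact congrArg (fun w => (projSpace n).presheaf.map (homOfLE le_top).op
        ((Proj.toSpecZero (polyGrading n)).appTop w)) h1
  rw [chartHom_eq_stalkMap, ht]
  refine Eq.trans (congrArg _ ((projSpace n).presheaf.germ_res_apply (homOfLE le_top) _ hk t)) ?_
  refine (stalkMap_germ i (V := ⊤) trivial t).trans ?_
  change _ = ratFun (U := ⊤) trivial (resFun le_top ((i ≫ projSpaceHom n).appTop ((Scheme.ΓSpecIso (.of ℂ)).inv z)))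
  rw [resFun_self]
  refine congrArg (ratFun (U := ⊤) trivial) ?_
  exact (congrArg (fun h => h.hom ((Scheme.ΓSpecIso (.of ℂ)).inv z)) (Scheme.Hom.comp_appTop i (projSpaceHom n))).symm

end

lemma exists_projectiveCharts {f : X ⟶ Spec (.of ℂ)} (hf : IsProjective f) :
    Nonempty (ProjectiveCharts f) := by
  obtain ⟨n, i, hi, rfl⟩ := hf
  have hcov : ∀ x : X, ∃ k : Fin (n + 1), x ∈ chart i k := by
    intro x
    have := Proj.iSup_basicOpen_eq_top' (polyGrading n) MvPolynomial.X (fun k => ⟨1, X_mem n k⟩)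
      (adjoin_range_X n)
    have hx : i x ∈ (⊤ : (projSpace n).Opens) := trivial
    rw [← this] at hx
    obtain ⟨k, hk⟩ := Opens.mem_iSup.mp hx
    exact ⟨k, hk⟩
  -- Coordinates that vanish identically on X are dropped. The remaining charts still cover, since
  -- every nonempty chart contains the generic point.
  let κ := {k : Fin (n + 1) // genericPoint X ∈ chart i k}
  obtain ⟨k₀, hk₀⟩ := hcov (genericPoint X)
  let k₀' : κ := ⟨k₀, hk₀⟩
  let w : κ → κ → X.functionField := fun k l => chartHom i k.1 k.2 (awayCoord n k.1 l.1)
  have hw : ∀ k l m, w k l * w l m = w k m := fun k l m => chartHom_coord_mul i k.1 l.1 m.1 k.2 l.2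
  have hw1 : ∀ k, w k k = 1 := fun k => chartHom_coord_self i k.1 k.2
  -- The homogeneous coordinates are normalized by dividing by the coordinate k₀, so u_k is x_k /
  -- x_{k₀}.
  let u : κ → (X.functionField)ˣ := fun k => ⟨w k₀' k, w k k₀', by rw [hw, hw1], by rw [hw, hw1]⟩
  have hu : ∀ k l, ((u l / u k : (X.functionField)ˣ) : X.functionField) = w k l := fun k l => by
    rw [div_eq_mul_inv, mul_comm]
    exact hw k k₀' l
  have haff : ∀ k : Fin (n + 1), IsAffineOpen (Proj.basicOpen (polyGrading n) (MvPolynomial.X k)) :=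
    fun k => Proj.isAffineOpen_basicOpen _ _ (X_mem n k) one_pos
  refine ⟨⟨κ, inferInstance, fun k => chart i k.1, u,
    fun k => (haff k.1).preimage i, fun k => k.2, fun x => ?_, fun k c => ?_⟩⟩
  · obtain ⟨k, hk⟩ := hcov x
    exact ⟨⟨k, genericPoint_mem (U := chart i k) hk⟩, hk⟩
  · clear_value u
    -- The chart is a closed subscheme of an affine standard open set, so every regular function on
    -- it is the restriction of one from the ambient set.
    have h1 : (∀ x ∈ chart i k.1, IsRegularAt x c) ↔
        ∃ a, chartHom i k.1 k.2 a = c := by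
      constructor
      · intro h
        obtain ⟨r, rfl⟩ := exists_ratFun_eq (U := chart i k.1) k.2 h
        obtain ⟨s, rfl⟩ := i.app_surjective _ (haff k.1) r
        let e := Proj.basicOpenIsoAway (polyGrading n) _ (X_mem n k.1) one_pos
        refine ⟨e.inv s, ?_⟩
        rw [← ratFun_chartFun i k.1 k.2]
        refine congrArg (ratFun k.2) (congrArg (i.app _) ?_)
        exact congrArg (fun h => h.hom s) e.inv_hom_id
      · rintro ⟨a, rfl⟩ x hx
        rw [← ratFun_chartFun i k.1 k.2]
        exact isRegularAt_ratFun _ _ hx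
    rw [h1]
    clear h1
    constructor
    · rintro ⟨a, rfl⟩
      refine away_induction n k.1 (P := fun a => chartHom i k.1 k.2 a ∈ RingHom.range _) ?_ ?_ ?_ ?_ a
      · intro z
        rw [chartHom_const]
        exact ⟨MvPolynomial.C z, by simp⟩
      · intro l
        by_cases hl : genericPoint X ∈ chart i l
        · refine ⟨MvPolynomial.X ⟨l, hl⟩, ?_⟩
          rw [MvPolynomial.coe_eval₂Hom, MvPolynomial.eval₂_X, hu]
        · rw [chartHom_coord_eq_zero i _ _ _ hl]; exact zero_mem _
      · intro a b ha hb; rw [map_add]; exact add_mem ha hb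
      · intro a b ha hb; rw [map_mul]; exact mul_mem ha hb
    · rintro ⟨p, rfl⟩
      induction p using MvPolynomial.induction_on with
      | C z => exact ⟨_, (chartHom_const i k.1 z k.2).trans (by simp)⟩
      | add p q hp hq =>
        obtain ⟨a, ha⟩ := hp
        obtain ⟨b, hb⟩ := hq
        exact ⟨a + b, by rw [map_add, map_add, ha, hb]⟩
      | mul_X p l hp =>
        obtain ⟨a, ha⟩ := hp
        refine ⟨a * awayCoord n k.1 l.1, ?_⟩
        rw [map_mul, map_mul, ha]
        congr 1
        rw [MvPolynomial.coe_eval₂Hom, MvPolynomial.eval₂_X, hu]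

end ProjectiveCharts
end CoxEuler
end

noncomputable section
namespace CoxEuler

/-! ### Finiteness of integral closures -/

section FiniteIntegralClosure
open nonZeroDivisors
attribute [local instance] FractionRing.liftAlgebra FractionRing.isScalarTower_liftAlgebra

/-- The integral closure of a finitely generated domain over a field of characteristic zero in its
fraction field is a finite module. -/
lemma finite_integralClosure (k B : Type) [Field k] [CharZero k] [CommRing B] [IsDomain B]
    [Algebra k B] [Algebra.FiniteType k B] : Module.Finite B (integralClosure B (FractionRing B)) := by
  -- By Noether normalization B is finite over a polynomial ring A, which is integrally closed and
  -- noetherian. In characteristic zero the extension of fraction fields is separable, so the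
  -- integral closure of A in Frac B is finite over A, and it contains everything integral over B.
  obtain ⟨s, g, hg, hfin⟩ := exists_finite_inj_algHom_of_fg k B
  let A := MvPolynomial (Fin s) k
  let : Algebra A B := g.toRingHom.toAlgebra
  have : Module.Finite A B := hfin
  have : FaithfulSMul A B := (faithfulSMul_iff_algebraMap_injective A B).mpr hg
  have : FiniteDimensional (FractionRing A) (FractionRing B) := .of_isLocalization A B A⁰
  have : CharZero (FractionRing A) := charZero_of_injective_algebraMap
    (IsFractionRing.injective A (FractionRing A))
  have hA : Module.Finite A (integralClosure A (FractionRing B)) :=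
    IsIntegralClosure.finite A (FractionRing A) (FractionRing B) _
  let e : integralClosure A (FractionRing B) →ₗ[A] integralClosure B (FractionRing B) :=
    { toFun := fun x => ⟨x.1, x.2.tower_top⟩
      map_add' := fun _ _ => rfl
      map_smul' := fun _ _ => rfl }
  have he : Function.Surjective e := fun x => ⟨⟨x.1, isIntegral_trans (R := A) (A := B) x.1 x.2⟩, rfl⟩
  have : Module.Finite A (integralClosure B (FractionRing B)) := .of_surjective e he
  exact Module.Finite.of_restrictScalars_finite A B _

/-- A submodule of a domain whose elements are integral over a finitely generated subalgebra, and
have denominators in it, is finitely generated. -/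
lemma fg_of_isIntegral {k R : Type} [Field k] [CharZero k] [CommRing R] [IsDomain R] [Algebra k R]
    (S : Subalgebra k R) [Algebra.FiniteType k S] (M : Submodule S R)
    (hM : ∀ y ∈ M, IsIntegral S y ∧ ∃ b : S, b ≠ 0 ∧ ∃ a : S, (b : R) * y = a) : M.FG := by
  have hfin := finite_integralClosure k S
  have : IsNoetherianRing S := Algebra.FiniteType.isNoetherianRing k S
  let L := FractionRing S
  let E := FractionRing R
  have hSE : Function.Injective (algebraMap S E) := by
    rw [IsScalarTower.algebraMap_eq S R E]
    exact (IsFractionRing.injective R E).comp Subtype.val_injective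
  let j : L →ₐ[S] E := IsFractionRing.liftAlgHom (g := Algebra.ofId S E) hSE
  let toE : R →ₗ[S] E := (IsScalarTower.toAlgHom S R E).toLinearMap
  have htoE : Function.Injective toE := IsFractionRing.injective R E
  refine Submodule.fg_of_fg_map_injective toE htoE ?_
  -- Elements of M are fractions of elements of S and are integral over S, so M lies in the image of
  -- the integral closure of S, a finite module over a noetherian ring.
  have hfg : (Submodule.map j.toLinearMap (Subalgebra.toSubmodule (integralClosure S L))).FG :=
    (Module.Finite.iff_fg.mp hfin).map _
  refine hfg.of_le ?_
  rintro _ ⟨y, hy, rfl⟩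
  obtain ⟨hint, b, hb, a, hab⟩ := hM y hy
  have hjy : j (algebraMap S L a / algebraMap S L b) = toE y := by
    have hb' : algebraMap S E b ≠ 0 := fun h => hb (hSE (by rw [h, map_zero]))
    rw [map_div₀, AlgHom.commutes, AlgHom.commutes, div_eq_iff hb']
    have := congrArg (algebraMap R E) hab
    rw [map_mul] at this
    rw [mul_comm]
    exact this.symm
  refine ⟨_, ?_, hjy⟩
  have : IsIntegral S (toE y) := hint.map (IsScalarTower.toAlgHom S R E)
  rw [← hjy] at this
  exact (isIntegral_algHom_iff j j.injective).mp this

end FiniteIntegralClosure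

/-! ### Spaces of functions that multiply high-degree forms into forms -/

section Forms
open Polynomial
variable {k K : Type} [Field k] [Field K] [Algebra k K] (W : Submodule k K)

/-- Polynomials in `t` whose coefficient of `tⁱ` lies in `Wⁱ`. -/
def formAlgebra : Subalgebra k K[X] where
  carrier := {s | ∀ i, s.coeff i ∈ W ^ i}
  mul_mem' := fun {a b} ha hb i => by
    rw [coeff_mul]
    refine Submodule.sum_mem _ fun x hx => ?_
    rw [← Finset.HasAntidiagonal.mem_antidiagonal.mp hx, pow_add]
    exact Submodule.mul_mem_mul (ha _) (hb _)
  add_mem' := fun {a b} ha hb i => by rw [coeff_add]; exact add_mem (ha i) (hb i)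
  algebraMap_mem' := fun r i => by
    rw [IsScalarTower.algebraMap_apply k K K[X], Polynomial.algebraMap_apply, Algebra.algebraMap_self,
      RingHom.id_apply, coeff_C]
    split_ifs with h
    · subst h; rw [pow_zero]; exact Submodule.algebraMap_mem r
    · exact zero_mem _

variable {W} in
lemma monomial_mem_formAlgebra {i : ℕ} {w : K} (hw : w ∈ W ^ i) : monomial i w ∈ formAlgebra W := fun j => by
  rw [coeff_monomial]
  split_ifs with h
  · rwa [← h]
  · exact zero_mem _

variable {κ : Type} [Finite κ] (u : κ → K)

/-- The algebra is generated by the elements u_l t of degree one: Wⁱ is spanned by products of i of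
the u_l. -/
lemma finiteType_formAlgebra : Algebra.FiniteType k (formAlgebra (Submodule.span k (Set.range u))) := by
  set W := Submodule.span k (Set.range u) with hW
  rw [← Subalgebra.fg_iff_finiteType]
  have h : formAlgebra W = Algebra.adjoin k (Set.range fun l => monomial 1 (u l)) := by
    apply le_antisymm
    · intro s hs
      rw [s.as_sum_support]
      refine Subalgebra.sum_mem _ fun i _ => ?_
      have key : ∀ (i : ℕ) (w : K), w ∈ W ^ i →
          monomial i w ∈ Algebra.adjoin k (Set.range fun l => monomial 1 (u l)) := by
        intro i w hw
        induction hw using Submodule.pow_induction_on_left' with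
        | algebraMap r => 
          rw [monomial_zero_left]
          exact Subalgebra.algebraMap_mem _ r
        | add x y i hx hy h h' => rw [map_add]; exact add_mem h h'
        | mem_mul m hm i x hx h =>
          rw [Nat.succ_eq_one_add, ← monomial_mul_monomial]
          refine mul_mem ?_ h
          rw [hW] at hm
          induction hm using Submodule.span_induction with
          | mem x hx =>
            obtain ⟨l, rfl⟩ := hx
            exact Algebra.subset_adjoin ⟨l, rfl⟩
          | zero => rw [map_zero]; exact zero_mem _
          | add x y _ _ h h' => rw [map_add]; exact add_mem h h'
          | smul r x _ h => rw [← smul_monomial]; exact Subalgebra.smul_mem _ h r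
      exact key i _ (hs i)
    · rw [Algebra.adjoin_le_iff]
      rintro _ ⟨l, rfl⟩
      exact monomial_mem_formAlgebra (by rw [pow_one]; exact Submodule.subset_span ⟨l, rfl⟩)
  rw [h]
  exact ⟨(Set.finite_range fun l => monomial 1 (u l)).toFinset, by simp⟩

/-- If multiplication by `h` raises the degree of large powers of the `u_l` by `n`, then it does so for
all forms of large degree. -/
lemma exists_mul_mem_pow {h : K} {n : ℕ}
    (hh : ∀ l, ∃ m₀, ∀ m, m₀ ≤ m → h * u l ^ m ∈ Submodule.span k (Set.range u) ^ (m + n)) :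
    ∃ N, ∀ i, N ≤ i → ∀ w ∈ Submodule.span k (Set.range u) ^ i,
      h * w ∈ Submodule.span k (Set.range u) ^ (i + n) := by
  classical
  have := Fintype.ofFinite κ
  choose m hm using hh
  set W := Submodule.span k (Set.range u) with hW
  -- A monomial with more than card κ · ∑ m_l factors contains some u_l more than ∑ m_l ≥ m_l times,
  -- by the pigeonhole principle. This power of u_l absorbs h.
  refine ⟨Fintype.card κ * (∑ l, m l) + 1, fun i hi w hw => ?_⟩
  rw [hW, Submodule.span_pow] at hw
  induction hw using Submodule.span_induction with
  | zero => rw [mul_zero]; exact zero_mem _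
  | add x y _ _ h h' => rw [mul_add]; exact add_mem h h'
  | smul r x _ h => rw [mul_smul_comm]; exact Submodule.smul_mem _ r h
  | mem x hx =>
    obtain ⟨f, rfl⟩ := Set.mem_pow.mp hx
    choose g hg using fun j => (f j).2
    rw [List.prod_ofFn]
    obtain ⟨l, hl⟩ := Fintype.exists_lt_card_fiber_of_mul_lt_card g (n := ∑ l, m l)
      (by rw [Fintype.card_fin]; omega)
    rw [← Finset.prod_filter_mul_prod_filter_not Finset.univ (fun j => g j = l)]
    have h1 : ∏ j ∈ Finset.univ.filter (fun j => g j = l), (f j : K) =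
        u l ^ (Finset.univ.filter (fun j => g j = l)).card := by
      rw [Finset.prod_congr rfl (g := fun _ => u l), Finset.prod_const]
      intro j hj
      rw [← hg j, (Finset.mem_filter.mp hj).2]
    have h2 : ∏ j ∈ Finset.univ.filter (fun j => ¬ g j = l), (f j : K) ∈
        W ^ (Finset.univ.filter (fun j => ¬ g j = l)).card := by
      refine Finset.induction_on (Finset.univ.filter (fun j => ¬ g j = l)) ?_ ?_
      · rw [Finset.prod_empty, Finset.card_empty, pow_zero]
        exact Submodule.one_le.mp le_rfl
      · intro j s hj hs
        rw [Finset.prod_insert hj, Finset.card_insert_of_notMem hj, pow_succ']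
        exact Submodule.mul_mem_mul (Submodule.subset_span (f j).2) hs
    have hc : (Finset.univ.filter (fun j => g j = l)).card + n +
        (Finset.univ.filter (fun j => ¬ g j = l)).card = i + n := by
      have := Finset.card_filter_add_card_filter_not (s := Finset.univ) (fun j => g j = l)
      rw [Finset.card_univ, Fintype.card_fin] at this
      omega
    rw [h1, ← mul_assoc, ← hc, pow_add]
    refine Submodule.mul_mem_mul (hm l _ ?_) h2
    exact (Finset.single_le_sum (fun _ _ => Nat.zero_le _) (Finset.mem_univ l)).trans hl.le

/-- The elements that raise the degree of large powers of the `u_l` by `n` form a finite-dimensional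
space. -/
lemma finiteDimensional_of_mul_mem_pow [CharZero k] (hu : ∃ l, u l ≠ 0) (n : ℕ) (V : Submodule k K)
    (hV : ∀ h ∈ V, ∀ l, ∃ m₀, ∀ m, m₀ ≤ m → h * u l ^ m ∈ Submodule.span k (Set.range u) ^ (m + n)) :
    FiniteDimensional k V := by
  obtain ⟨l, hl⟩ := hu
  set W := Submodule.span k (Set.range u) with hW
  have hft : Algebra.FiniteType k (formAlgebra W) := finiteType_formAlgebra u
  have : IsNoetherianRing (formAlgebra W) := Algebra.FiniteType.isNoetherianRing k _
  -- V is placed in degree n. Its finite dimension will follow once the module it generates over the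
  -- algebra of forms is finitely generated.
  let M : Submodule (formAlgebra W) K[X] := Submodule.span _ (monomial n '' V)
  have hul : ∀ N, u l ^ N ∈ W ^ N := fun N =>
    Submodule.pow_mem_pow _ (Submodule.subset_span (Set.mem_range_self l)) N
  let b : ℕ → formAlgebra W := fun N => ⟨monomial N (u l ^ N), monomial_mem_formAlgebra (hul N)⟩
  have hb : ∀ N, b N ≠ 0 := fun N h0 => by
    have := congrArg Subtype.val h0
    exact pow_ne_zero N hl ((monomial_eq_zero_iff _ N).mp this)
  have hM : M.FG := by
    refine fg_of_isIntegral (k := k) (formAlgebra W) M fun y hy => ?_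
    induction hy using Submodule.span_induction with
    | zero => exact ⟨isIntegral_zero, 1, one_ne_zero, 0, by simp⟩
    | add x y _ _ hx hy =>
      obtain ⟨hx, b, hb, a, hab⟩ := hx
      obtain ⟨hy, b', hb', a', hab'⟩ := hy
      refine ⟨hx.add hy, b * b', mul_ne_zero hb hb', a * b' + a' * b, ?_⟩
      push_cast
      rw [← hab, ← hab']; ring
    | smul r x _ hx =>
      obtain ⟨hx, b, hb, a, hab⟩ := hx
      refine ⟨hx.smul r, b, hb, r * a, ?_⟩
      push_cast
      rw [← hab, Algebra.smul_def]
      change _ * ((r : K[X]) * x) = _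
      ring
    | mem y hy =>
      obtain ⟨h, hh, rfl⟩ := hy
      obtain ⟨N, hN⟩ := exists_mul_mem_pow u (hV h hh)
      constructor
      -- The forms of degree at least N make up a nonzero ideal, finitely generated as the ring is
      -- noetherian. Multiplication by h tⁿ maps it into itself, so h tⁿ is integral by the
      -- determinant trick.
      · let I : Submodule (formAlgebra W) K[X] :=
          { carrier := {s | ∀ i, s.coeff i ∈ W ^ i ∧ (i < N → s.coeff i = 0)}
            zero_mem' := fun i => by simp
            add_mem' := fun {a b} ha hb i => by
              rw [coeff_add]
              exact ⟨add_mem (ha i).1 (hb i).1, fun hi => by rw [(ha i).2 hi, (hb i).2 hi, add_zero]⟩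
            smul_mem' := fun r s hs i => by
              change ((r : K[X]) * s).coeff i ∈ _ ∧ (_ → ((r : K[X]) * s).coeff i = 0)
              refine ⟨(formAlgebra W).mul_mem r.2 (fun i => (hs i).1) i, fun hi => ?_⟩
              rw [coeff_mul]
              refine Finset.sum_eq_zero fun x hx => ?_
              rw [(hs x.2).2 (by have := Finset.HasAntidiagonal.mem_antidiagonal.mp hx; omega), mul_zero] }
        refine isIntegral_of_smul_mem_submodule (M := K[X]) I ?_ ?_ _ ?_
        · intro hI
          have hmem : monomial N (u l ^ N) ∈ I := fun i => by
            rw [coeff_monomial]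
            refine ⟨?_, fun hi => if_neg (by omega)⟩
            split_ifs with h
            · rw [← h]; exact hul N
            · exact zero_mem _
          rw [hI, Submodule.mem_bot] at hmem
          exact pow_ne_zero N hl ((monomial_eq_zero_iff _ N).mp hmem)
        · have h1 : (1 : Submodule (formAlgebra W) K[X]).FG := ⟨{1}, by rw [Finset.coe_singleton, Submodule.one_eq_span]⟩
          refine h1.of_le fun s hs => Submodule.mem_one.mpr ⟨⟨s, fun i => (hs i).1⟩, rfl⟩
        · intro s hs i
          rw [smul_eq_mul]
          by_cases hi : n ≤ i
          · obtain ⟨j, rfl⟩ := Nat.exists_eq_add_of_le' hi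
            rw [coeff_monomial_mul]
            by_cases hj : N ≤ j
            · exact ⟨hN j hj _ (hs j).1, fun h => absurd h (by omega)⟩
            · rw [(hs j).2 (by omega), mul_zero]
              exact ⟨zero_mem _, fun _ => rfl⟩
          · have h0 : (monomial n h * s).coeff i = 0 := by
              rw [← C_mul_X_pow_eq_monomial, mul_assoc, coeff_C_mul, coeff_X_pow_mul', if_neg hi, mul_zero]
            rw [h0]
            exact ⟨zero_mem _, fun _ => rfl⟩
      -- The form (u_l t)ᴺ is a denominator, because h u_lᴺ is a form of degree N + n.
      · refine ⟨_, hb N, ⟨monomial (N + n) (h * u l ^ N), monomial_mem_formAlgebra (hN N le_rfl _ (hul N))⟩, ?_⟩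
        change monomial N (u l ^ N) * monomial n h = _
        rw [monomial_mul_monomial, mul_comm (u l ^ N)]
  obtain ⟨T, hT, hMT⟩ := (Submodule.fg_span_iff_fg_span_finset_subset _).mp hM
  let V' : Submodule k K := Submodule.span k ((fun p : K[X] => p.coeff n) '' T)
  have hV' : FiniteDimensional k V' := FiniteDimensional.span_of_finite k (T.finite_toSet.image _)
  refine Submodule.finiteDimensional_of_le (S₂ := V') fun h hh => ?_
  -- The generators in T are concentrated in degree n, so only the degree-zero coefficients of the
  -- scalars reach degree n, and these lie in W⁰ = k.
  have key : ∀ z ∈ Submodule.span (formAlgebra W) (T : Set K[X]), (∀ i < n, z.coeff i = 0) ∧ z.coeff n ∈ V' := by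
    intro z hz
    induction hz using Submodule.span_induction with
    | zero => simp
    | add x y _ _ hx hy =>
      refine ⟨fun i hi => by rw [coeff_add, hx.1 i hi, hy.1 i hi, add_zero], ?_⟩
      rw [coeff_add]; exact add_mem hx.2 hy.2
    | mem x hx =>
      refine ⟨fun i hi => ?_, Submodule.subset_span ⟨x, hx, rfl⟩⟩
      obtain ⟨v, -, rfl⟩ := hT hx
      rw [coeff_monomial, if_neg (by omega)]
    | smul r x _ hx =>
      change (∀ i < n, ((r : K[X]) * x).coeff i = 0) ∧ ((r : K[X]) * x).coeff n ∈ V'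
      constructor
      · intro i hi
        rw [coeff_mul]
        refine Finset.sum_eq_zero fun y hy => ?_
        rw [hx.1 _ (by have := Finset.HasAntidiagonal.mem_antidiagonal.mp hy; omega), mul_zero]
      · rw [coeff_mul]
        refine Submodule.sum_mem _ fun y hy => ?_
        have hy' := Finset.HasAntidiagonal.mem_antidiagonal.mp hy
        by_cases h0 : y.1 = 0
        · obtain ⟨z, hz⟩ : ∃ z, algebraMap k K z = (r : K[X]).coeff 0 := by
            have := r.2 0
            rwa [pow_zero, Submodule.mem_one] at this
          rw [h0, ← hz, ← Algebra.smul_def, show y.2 = n by omega]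
          exact Submodule.smul_mem _ z hx.2
        · rw [hx.1 _ (by omega), mul_zero]; exact zero_mem _
  have := (key (monomial n h) (by rw [← hMT]; exact Submodule.subset_span ⟨h, hh, rfl⟩)).2
  rwa [coeff_monomial, if_pos rfl] at this

end Forms
end CoxEuler
end

noncomputable section
namespace CoxEuler

/-! ### The hyperplane section and finite-dimensionality of section spaces -/

section Hyperplane
variable {X : Scheme.{0}} [IsIntegral X] {f : X ⟶ Spec (.of ℂ)}

lemma IsRegularAt.mul {x : X} {a b : X.functionField} (ha : IsRegularAt x a) (hb : IsRegularAt x b) :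
    IsRegularAt x (a * b) := (RingHom.range _).mul_mem ha hb

lemma IsLocalEquationAt.nsmul {D : CDiv X} {x : X} {g : (X.functionField)ˣ}
    (h : IsLocalEquationAt D x g) (n : ℕ) : IsLocalEquationAt (n • D) x (g ^ n) := by
  change n • D.1 x = _
  rw [h]; rfl

lemma mem_localUnits {x : X} {g : (X.functionField)ˣ} (h : IsRegularAt x (g : X.functionField))
    (h' : IsRegularAt x ((g⁻¹ : (X.functionField)ˣ) : X.functionField)) : g ∈ localUnits X x := by
  obtain ⟨a, ha⟩ := h
  obtain ⟨b, hb⟩ := h'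
  have hab : a * b = 1 := by
    apply IsFractionRing.injective (X.presheaf.stalk x) X.functionField
    rw [map_mul, map_one]
    exact (congrArg₂ (· * ·) ha hb).trans g.mul_inv
  exact ⟨⟨a, b, hab, by rw [mul_comm, hab]⟩, Units.ext ha⟩

namespace ProjectiveCharts
variable (ch : ProjectiveCharts f)

lemma isRegularAt_div (k l : ch.κ) {x : X} (hx : x ∈ ch.U k) :
    IsRegularAt x ((ch.u l / ch.u k : (X.functionField)ˣ) : X.functionField) :=
  (ch.regular_iff k _).mpr ⟨MvPolynomial.X l, by simp⟩ x hx

lemma div_mem_localUnits (k l : ch.κ) {x : X} (hx : x ∈ ch.U k) (hx' : x ∈ ch.U l) :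
    ch.u l / ch.u k ∈ localUnits X x :=
  mem_localUnits (ch.isRegularAt_div k l hx) (by rw [inv_div]; exact ch.isRegularAt_div l k hx')

/-- The hyperplane section `H`, with local equations `1 / u_k`. -/
def hyperplane : CDiv X := by
  refine ⟨fun x => Additive.ofMul (QuotientGroup.mk (ch.u (ch.cover x).choose)⁻¹), fun x => ?_⟩
  obtain ⟨k, hk⟩ := ch.cover x
  refine ⟨ch.U k, hk, (ch.u k)⁻¹, fun y hy => congrArg Additive.ofMul (QuotientGroup.eq.mpr ?_)⟩
  rw [inv_inv, ← div_eq_mul_inv]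
  exact ch.div_mem_localUnits _ _ hy (ch.cover y).choose_spec

lemma isLocalEquationAt_hyperplane {k : ch.κ} {x : X} (hx : x ∈ ch.U k) :
    IsLocalEquationAt ch.hyperplane x (ch.u k)⁻¹ := by
  refine congrArg Additive.ofMul (QuotientGroup.eq.mpr ?_)
  rw [inv_inv, ← div_eq_mul_inv]
  exact ch.div_mem_localUnits _ _ hx (ch.cover x).choose_spec

lemma regular_of_mem {n : ℕ} {h : X.functionField} (hh : h ∈ sectionSpace (n • ch.hyperplane))
    {k : ch.κ} {x : X} (hx : x ∈ ch.U k) :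
    IsRegularAt x (h * (((ch.u k)⁻¹ ^ n : (X.functionField)ˣ) : X.functionField)) :=
  hh x _ ((ch.isLocalEquationAt_hyperplane hx).nsmul n)

lemma u_mem (l : ch.κ) : (ch.u l : X.functionField) ∈ sectionSpace ch.hyperplane := fun x => by
  obtain ⟨k, hk⟩ := ch.cover x
  refine isSectionAt_of (ch.isLocalEquationAt_hyperplane hk) ?_
  have := ch.isRegularAt_div k l hk
  rwa [div_eq_mul_inv, Units.val_mul] at this

end ProjectiveCharts

lemma mul_mem_sectionSpace {D E : CDiv X} {h k : X.functionField} (hh : h ∈ sectionSpace D)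
    (hk : k ∈ sectionSpace E) : h * k ∈ sectionSpace (D + E) := fun x => (hh x).mul (hk x)

lemma pow_mem_sectionSpace {D : CDiv X} {h : X.functionField} (hh : h ∈ sectionSpace D) (n : ℕ) :
    h ^ n ∈ sectionSpace (n • D) := by
  induction n with
  | zero => rw [pow_zero, zero_smul]; exact isSectionAt_one X
  | succ n ih => rw [pow_succ, succ_nsmul]; exact mul_mem_sectionSpace ih hh

variable (f) in
lemma isRegularAt_constFun (z : ℂ) (x : X) : IsRegularAt x (constFun f z) := by
  change IsRegularAt x (toFunctionField ⊤ _ _)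
  rw [toFunctionField_const _ (⟨x, trivial⟩ : (⊤ : X.Opens))]
  exact ⟨_, rfl⟩

variable (f) in
/-- The function field as a `ℂ`-algebra. -/
@[reducible] def functionFieldAlgebra : Algebra ℂ X.functionField := (constFun f).toAlgebra

variable (f) in
/-- The space of sections `H⁰(X, 𝒪_X(D))` as a vector space over `ℂ`. -/
def sectionSubmodule (D : CDiv X) :
    letI := functionFieldAlgebra f
    Submodule ℂ X.functionField :=
  letI := functionFieldAlgebra f
  { sectionSpace D with
    smul_mem' := fun z h hh x => by
      rw [Algebra.smul_def]
      exact IsSectionAt.regular_mul (isRegularAt_constFun f z x) (hh x) }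

namespace ProjectiveCharts
variable (ch : ProjectiveCharts f)

/-- The space of linear forms in the homogeneous coordinates. -/
def forms : letI := functionFieldAlgebra f
    Submodule ℂ X.functionField :=
  letI := functionFieldAlgebra f
  Submodule.span ℂ (Set.range fun l => (ch.u l : X.functionField))

/-- A regular function on the chart is a polynomial in the u_l / u_k, and multiplying by a power of
u_k at least its degree clears the denominators. -/
lemma exists_mul_pow_mem_forms {k : ch.κ} {c : X.functionField} (hc : ∀ x ∈ ch.U k, IsRegularAt x c) :
    letI := functionFieldAlgebra f
    ∃ m₀, ∀ m, m₀ ≤ m → c * (ch.u k : X.functionField) ^ m ∈ ch.forms ^ m := by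
  let := functionFieldAlgebra f
  have hu : ∀ l, (ch.u l : X.functionField) ∈ ch.forms := fun l => Submodule.subset_span ⟨l, rfl⟩
  obtain ⟨p, rfl⟩ := (ch.regular_iff k c).mp hc
  clear hc
  induction p using MvPolynomial.induction_on with
  | C z =>
    refine ⟨0, fun m _ => ?_⟩
    rw [MvPolynomial.coe_eval₂Hom, MvPolynomial.eval₂_C]
    change algebraMap ℂ X.functionField z * _ ∈ _
    rw [← Algebra.smul_def]
    exact Submodule.smul_mem _ _ (Submodule.pow_mem_pow _ (hu k) m)
  | add p q hp hq =>
    obtain ⟨m, hm⟩ := hp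
    obtain ⟨m', hm'⟩ := hq
    refine ⟨max m m', fun i hi => ?_⟩
    rw [map_add, add_mul]
    exact add_mem (hm i ((le_max_left _ _).trans hi)) (hm' i ((le_max_right _ _).trans hi))
  | mul_X p l hp =>
    obtain ⟨m, hm⟩ := hp
    refine ⟨m + 1, fun i hi => ?_⟩
    obtain ⟨j, rfl⟩ := Nat.exists_eq_add_of_le' hi
    rw [← add_assoc, map_mul, MvPolynomial.coe_eval₂Hom, MvPolynomial.eval₂_X, pow_succ, pow_succ]
    have h := Submodule.mul_mem_mul (hm (j + m) (by omega)) (hu l)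
    convert h using 1
    rw [div_eq_mul_inv, Units.val_mul, MvPolynomial.coe_eval₂Hom]
    have := (ch.u k).ne_zero
    have hk : (ch.u k : X.functionField) * (((ch.u k)⁻¹ : (X.functionField)ˣ) : X.functionField) = 1 := Units.mul_inv _
    linear_combination (MvPolynomial.eval₂ (constFun f) (fun l => ((ch.u l / ch.u k : (X.functionField)ˣ) : X.functionField)) p * (ch.u l : X.functionField) * (ch.u k : X.functionField) ^ (j + m)) * hk

lemma forms_pow_le (m : ℕ) :
    letI := functionFieldAlgebra f
    ch.forms ^ m ≤ sectionSubmodule f (m • ch.hyperplane) := by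
  let := functionFieldAlgebra f
  intro w hw
  induction hw using Submodule.pow_induction_on_left' with
  | algebraMap r =>
    rw [zero_smul]
    have := (sectionSubmodule f (0 : CDiv X)).smul_mem r (x := 1) (isSectionAt_one X)
    rwa [Algebra.smul_def, mul_one] at this
  | add x y i _ _ h h' => exact add_mem h h'
  | mem_mul w hw i x _ h =>
    have hw' : w ∈ sectionSubmodule f ch.hyperplane := by
      refine (Submodule.span_le (p := sectionSubmodule f ch.hyperplane)).mpr ?_ hw
      rintro _ ⟨l, rfl⟩
      exact ch.u_mem l
    rw [succ_nsmul']
    exact mul_mem_sectionSpace hw' h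

/-- Finitely many rational functions have a common denominator that makes them sections of a multiple
of the hyperplane section. -/
lemma exists_denominator {T : Set X.functionField} (hT : T.Finite) :
    ∃ (n : ℕ) (q : X.functionField), q ≠ 0 ∧ ∀ c ∈ T, q * c ∈ sectionSpace (n • ch.hyperplane) := by
  let := functionFieldAlgebra f
  obtain ⟨k, -⟩ := ch.cover (genericPoint X)
  have := nonempty_of_mem (ch.generic k)
  have := functionField_isFractionRing_of_isAffineOpen X (ch.U k) (ch.isAffineOpen k)
  -- One element b clears the denominators on the affine chart U_k, whose fraction field is the
  -- function field. A power of u_k then turns the resulting regular functions into forms, which are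
  -- sections of a multiple of H.
  obtain ⟨b, hb⟩ := IsLocalization.exist_integer_multiples_of_finset
    (nonZeroDivisors Γ(X, ch.U k)) hT.toFinset
  have hreg : ∀ r : Γ(X, ch.U k), ∀ x ∈ ch.U k, IsRegularAt x (algebraMap _ X.functionField r) := fun r x hx => by
    have := isRegularAt_ratFun (ch.generic k) r hx
    rwa [ratFun_eq_germ] at this
  have key : ∀ c : hT.toFinset, ∃ m₀, ∀ m, m₀ ≤ m →
      (algebraMap _ X.functionField b.1 * c.1) * (ch.u k : X.functionField) ^ m ∈ ch.forms ^ m := by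
    intro c
    obtain ⟨r, hr⟩ := hb c.1 c.2
    refine ch.exists_mul_pow_mem_forms ?_
    rw [← Algebra.smul_def]
    rw [← hr]
    exact hreg r
  choose m hm using key
  refine ⟨∑ c, m c, algebraMap _ X.functionField b.1 * (ch.u k : X.functionField) ^ (∑ c, m c), ?_, ?_⟩
  · refine mul_ne_zero ?_ (pow_ne_zero _ (ch.u k).ne_zero)
    exact IsLocalization.to_map_ne_zero_of_mem_nonZeroDivisors _ le_rfl b.2
  · intro c hc
    have := hm ⟨c, hT.mem_toFinset.mpr hc⟩ _ (Finset.single_le_sum (fun _ _ => Nat.zero_le _) (Finset.mem_univ _))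
    have h := ch.forms_pow_le _ this
    rw [mul_right_comm]
    exact h

/-- For a section h of nH the function h u_l⁻ⁿ is regular on the chart U_l. Hence h u_lᵐ is a form
of degree m + n for large m, which is the condition in `finiteDimensional_of_mul_mem_pow`. -/
lemma finiteDimensional_nsmul_hyperplane (n : ℕ) :
    letI := functionFieldAlgebra f
    FiniteDimensional ℂ (sectionSubmodule f (n • ch.hyperplane)) := by
  let := functionFieldAlgebra f
  have := ch.finite
  obtain ⟨k, -⟩ := ch.cover (genericPoint X)
  refine finiteDimensional_of_mul_mem_pow (fun l => (ch.u l : X.functionField)) ⟨k, (ch.u k).ne_zero⟩ n _ ?_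
  intro h hh l
  obtain ⟨m₀, hm₀⟩ := ch.exists_mul_pow_mem_forms (k := l) (fun x hx => ch.regular_of_mem hh hx)
  refine ⟨m₀, fun m hm => ?_⟩
  have := hm₀ (m + n) (by omega)
  have e : (((ch.u l)⁻¹ ^ n : (X.functionField)ˣ) : X.functionField) * (ch.u l : X.functionField) ^ n = 1 := by
    rw [← Units.val_pow_eq_pow_val, ← Units.val_mul, inv_pow, inv_mul_cancel, Units.val_one]
  have e' : h * (((ch.u l)⁻¹ ^ n : (X.functionField)ˣ) : X.functionField) * (ch.u l : X.functionField) ^ (m + n) =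
      h * (ch.u l : X.functionField) ^ m := by
    rw [pow_add]
    linear_combination h * (ch.u l : X.functionField) ^ m * e
  rwa [e'] at this

lemma compactSpace (ch : ProjectiveCharts f) : CompactSpace X := by
  have := ch.finite
  have h : (⋃ k, (ch.U k : Set X)) = Set.univ :=
    Set.eq_univ_of_forall fun x => Set.mem_iUnion.mpr (ch.cover x)
  refine ⟨h ▸ isCompact_iUnion fun k => (ch.isAffineOpen k).isCompact⟩

/-- Finitely many local equations cover `X`. -/
lemma exists_finite_equations [CompactSpace X] (D : CDiv X) :
    ∃ T : Set (X.functionField)ˣ, T.Finite ∧ ∀ x, ∃ g ∈ T, IsLocalEquationAt D x g := by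
  choose U hU g hg using D.2
  obtain ⟨t, ht⟩ := isCompact_univ.elim_nhds_subcover (fun x : X => (U x : Set X))
    (fun x _ => (U x).isOpen.mem_nhds (hU x))
  refine ⟨g '' t, t.finite_toSet.image g, fun x => ?_⟩
  obtain ⟨y, hy, hxy⟩ := Set.mem_iUnion₂.mp (ht.2 (Set.mem_univ x))
  exact ⟨g y, ⟨y, hy, rfl⟩, hg y x hxy⟩

/-- Multiplication by a common denominator q of the inverses of finitely many local equations of D
embeds the sections of D into those of a multiple of the hyperplane section. -/
lemma finiteDimensional_sectionSubmodule (ch : ProjectiveCharts f) (D : CDiv X) :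
    letI := functionFieldAlgebra f
    FiniteDimensional ℂ (sectionSubmodule f D) := by
  let := functionFieldAlgebra f
  have := ch.compactSpace
  obtain ⟨T, hT, hD⟩ := exists_finite_equations D
  obtain ⟨n, q, hq, hqT⟩ := ch.exists_denominator (hT.image fun g => ((g⁻¹ : (X.functionField)ˣ) : X.functionField))
  have := ch.finiteDimensional_nsmul_hyperplane n
  have hmul : ∀ h ∈ sectionSubmodule f D, q * h ∈ sectionSubmodule f (n • ch.hyperplane) := by
    intro h hh x
    obtain ⟨g, hg, hgx⟩ := hD x
    have h1 := hqT _ ⟨g, hg, rfl⟩ x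
    have h2 := hh x g hgx
    have e : q * h = (h * g) * (q * ((g⁻¹ : (X.functionField)ˣ) : X.functionField)) := by
      have : (g : X.functionField) * ((g⁻¹ : (X.functionField)ˣ) : X.functionField) = 1 := g.mul_inv
      linear_combination (-q * h) * this
    rw [e]
    exact h1.regular_mul h2
  let e : sectionSubmodule f D →ₗ[ℂ] sectionSubmodule f (n • ch.hyperplane) :=
    (LinearMap.mulLeft ℂ q).restrict hmul
  refine FiniteDimensional.of_injective e fun a b hab => Subtype.ext ?_
  exact mul_left_cancel₀ hq (congrArg Subtype.val hab)

end ProjectiveCharts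
end Hyperplane
end CoxEuler
end

noncomputable section
namespace CoxEuler

/-- An isomorphism of sheaves over `V` as a local splitting without free part. -/
def LocalSplitting.ofBijective {X : Scheme.{0}} {A E : X.Modules} {V : X.Opens}
    (i : ∀ W : X.Opens, W ≤ V → (toPMod A).obj (op W) →ₗ[Γ(X, W)] (toPMod E).obj (op W))
    (i_res : ∀ (W W' : X.Opens) (h : W ≤ V) (h' : W' ≤ W) (m : (toPMod A).obj (op W)),
      i W' (h'.trans h) (resSec (toPMod A) h' m) = resSec (toPMod E) h' (i W h m))
    (hi : ∀ W h, Function.Bijective (i W h)) : LocalSplitting A E V Empty where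
  i := i
  p W h := (LinearEquiv.ofBijective (i W h) (hi W h)).symm.toLinearMap
  q _ _ k := k.elim
  s k := k.elim
  i_res := i_res
  p_res W W' h h' m := by
    apply (hi W' (h'.trans h)).1
    rw [i_res W W' h h']
    refine ((LinearEquiv.ofBijective (i W' (h'.trans h)) (hi W' (h'.trans h))).apply_symm_apply _).trans ?_
    exact congrArg _ ((LinearEquiv.ofBijective (i W h) (hi W h)).apply_symm_apply m).symm
  q_res _ _ _ _ k := k.elim
  p_i W h a := (LinearEquiv.ofBijective (i W h) (hi W h)).symm_apply_apply a
  q_i _ _ k := k.elim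
  p_s _ _ k := k.elim
  q_s_self _ _ k := k.elim
  q_s_ne _ _ k := k.elim
  total W h m := by
    rw [Finset.univ_eq_empty, Finset.sum_empty, add_zero]
    exact (LinearEquiv.ofBijective (i W h) (hi W h)).apply_symm_apply m

/-! ### Ample divisors and common denominators -/

section Ample
variable {X : Scheme.{0}} [IsIntegral X] (D : CDiv X)

/-- Sections glue pointwise, and the glued function is constant because every nonempty open set
contains the generic point. -/
lemma divisorSheaf_isSheaf : TopCat.Presheaf.IsSheaf (divisorSheaf D).presheaf := by
  rw [TopCat.Presheaf.isSheaf_iff_isSheafUniqueGluing]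
  intro ι U sf hsf
  change ∀ i, divisorSections D (U i) at sf
  have hsf' : ∀ i j (x : X) (hi : x ∈ U i) (hj : x ∈ U j), (sf i).1 ⟨x, hi⟩ = (sf j).1 ⟨x, hj⟩ := by
    intro i j x hi hj
    exact congrArg (fun s : divisorSections D (U i ⊓ U j) => s.1 ⟨x, hi, hj⟩) (hsf i j)
  choose i hi using fun x : (iSup U : X.Opens) => Opens.mem_iSup.mp x.2
  let s : divisorSections D (iSup U) := ⟨fun x => (sf (i x)).1 ⟨x.1, hi x⟩, fun x y => by
      exact ((sf (i x)).2.1 _ ⟨genericPoint X, genericPoint_mem (hi x)⟩).trans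
        ((hsf' _ _ _ _ _).trans ((sf (i y)).2.1 ⟨genericPoint X, genericPoint_mem (hi y)⟩ _)), fun x => (sf (i x)).2.2 ⟨x.1, hi x⟩⟩
  refine ⟨s, fun j => Subtype.ext (funext fun x => hsf' _ j x.1 _ x.2), fun t ht => ?_⟩
  refine Subtype.ext (funext fun x => ?_)
  exact congrArg (fun s : divisorSections D (U (i x)) => s.1 ⟨x.1, hi x⟩) (ht (i x))

/-- The invertible sheaf `𝒪_X(D)`. -/
def divisorModule : X.Modules := ⟨divisorSheaf D, divisorSheaf_isSheaf D⟩

variable {D} in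
/-- A local equation of `D` trivializes `𝒪_X(D)`. -/
def divisorSplitting {V : X.Opens} (g : (X.functionField)ˣ) (hg : ∀ x ∈ V, IsLocalEquationAt D x g) :
    LocalSplitting (unitModule X) (divisorModule D) V Empty := by
  have hs : ∀ W ≤ V, ∀ x ∈ W, IsSectionAt D x ((g⁻¹ : (X.functionField)ˣ) : X.functionField) :=
    fun W hW x hx => isSectionAt_of (hg x (hW hx)) (by
      rw [Units.inv_mul]; exact (RingHom.range _).one_mem)
  let σ : ∀ W : X.Opens, W ≤ V → (divisorSheaf D).obj (op W) := fun W hW => divSec _ (hs W hW)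
  refine LocalSplitting.ofBijective (A := unitModule X) (E := divisorModule D)
    (fun W h => LinearMap.toSpanSingleton Γ(X, W) ((divisorSheaf D).obj (op W)) (σ W h)) ?_ ?_
  · intro W W' h h' r
    exact (resSec_smul (divisorSheaf D) h' (r : Γ(X, W)) (σ W h)).symm
  · intro W hW
    by_cases hη : genericPoint X ∈ W
    · have hval : ∀ r : Γ(X, W), divVal D hη (r • σ W hW) =
          ratFun hη r * ((g⁻¹ : (X.functionField)ˣ) : X.functionField) := fun r => rfl
      constructor
      · intro r r' h
        have h' := congrArg (divVal D hη) h
        refine ratFun_injective hη (mul_right_cancel₀ (Units.ne_zero g⁻¹) ?_)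
        exact h'
      · intro s
        obtain ⟨r, hr⟩ := exists_ratFun_eq hη (h := divVal D hη s * g)
          (fun x hx => isSectionAt_divVal D hη s hx g (hg x (hW hx)))
        refine ⟨r, divVal_injective D hη ((hval r).trans ?_)⟩
        rw [hr, mul_assoc, Units.mul_inv, mul_one]
    · have hW0 : W = ⊥ := eq_bot_iff.mpr fun x hx => hη (genericPoint_mem hx)
      have h1 : Subsingleton Γ(X, W) := by
        rw [hW0]; exact CommRingCat.subsingleton_of_isTerminal X.sheaf.isTerminalOfEmpty
      have h2 : ∀ s t : (divisorSheaf D).obj (op W), s = t := fun s t =>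
        Subtype.ext (funext fun x => absurd (genericPoint_mem x.2) hη)
      exact ⟨fun r r' _ => h1.elim r r', fun s => ⟨(0 : Γ(X, W)), h2 _ _⟩⟩

lemma isCoherent_divisorModule : IsCoherent (divisorModule D) := by
  choose V hV g hg using D.2
  exact isCoherent_of_localSplitting (A := unitModule X) (V := V) (fun x => ⟨x, hV x⟩)
    (fun x => divisorSplitting (g x) (hg x)) (isCoherent_unitModule)

/-- Sections of `𝒪_X(D)` as rational functions, as a generic functional. -/
def divDual : genericDual (toPMod (divisorModule D)) :=
  ⟨fun U => divVal D U.2, fun U r m => divVal_smul D U.2 r m, fun U V h m => divVal_resSec D h V.2 m⟩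

lemma separates_divDual : Separates fun _ : Unit => divDual D := fun (U : GenericOpens X) _ h =>
  divVal_injective D U.2 ((h ()).trans (map_zero (divVal D U.2)).symm)

lemma mapsInto_divDual : MapsInto (divDual D) D := fun U m _ => isSectionAt_divVal D U.2 m

/-- A large multiple of an ample divisor minus a given divisor is linearly equivalent to an effective
divisor. -/
lemma IsAmple.exists_mem {A : CDiv X} (hA : IsAmple A) (D : CDiv X) :
    ∃ (n : ℕ) (h : X.functionField), h ≠ 0 ∧ h ∈ sectionSpace (-D + n • A) := by
  obtain ⟨n, hn⟩ := hA (divisorModule (-D)) (isCoherent_divisorModule _)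
  specialize hn n le_rfl
  have hsep := (separates_divDual (-D)).twistDual (D := n • A)
  -- Without nonzero global sections the globally generated twist would be the zero sheaf, but the
  -- tensor product of inverse local equations near the generic point has a nonzero value.
  by_cases h0 : ∀ s : H0 (twist (divisorModule (-D)) (n • A)), s = 0
  · exfalso
    have h1 := fun U m => eq_zero_of_isGloballyGenerated hn h0 (U := U) m
    obtain ⟨V, hV, g, hg⟩ := (-D).2 (genericPoint X)
    obtain ⟨W, hWV, hW, k, hk⟩ := exists_equation (n • A) hV
    let W' : GenericOpens X := ⟨W, hW⟩
    let s : (divisorSheaf (-D)).obj (op W) := divSec ((g⁻¹ : (X.functionField)ˣ) : X.functionField)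
      (fun x hx => isSectionAt_of (hg x (hWV hx)) (by
        rw [Units.inv_mul]; exact (RingHom.range _).one_mem))
    let t : (divisorSheaf (n • A)).obj (op W) := divSec ((k⁻¹ : (X.functionField)ˣ) : X.functionField)
      (fun x hx => isSectionAt_of (hk x hx) (by
        rw [Units.inv_mul]; exact (RingHom.range _).one_mem))
    let z : (MonoidalCategory.tensorObj (toPMod (divisorModule (-D))) (divisorSheaf (n • A))).obj (op W) :=
      TensorProduct.tmul Γ(X, W) (M := (divisorSheaf (-D)).obj (op W)) s t
    have e : (twistDual (n • A) (divDual (-D))).1 W' (toSheafify _ W z) =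
        ((g⁻¹ : (X.functionField)ˣ) : X.functionField) * ((k⁻¹ : (X.functionField)ˣ) : X.functionField) :=
      sheafifyDual_eq (preTwist (n • A) (divDual (-D))) W' W' le_rfl _ z (resSec_self _ _).symm
    rw [h1 W (toSheafify _ W z), map_zero] at e
    exact mul_ne_zero (Units.ne_zero g⁻¹) (Units.ne_zero k⁻¹) e.symm
  · push Not at h0
    obtain ⟨s, hs⟩ := h0
    refine ⟨n, globalVal (n • A) (divDual (-D)) s, fun h => hs (hsep ⟨⊤, trivial⟩ s fun _ => h), fun x => ?_⟩
    exact (mapsInto_divDual (-D)).twistDual (D := n • A) ⟨⊤, trivial⟩ s x trivial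

variable {f : X ⟶ Spec (.of ℂ)}

/-- Finitely many rational functions have a common denominator that makes them sections of a multiple
of an ample divisor. -/
lemma ProjectiveCharts.exists_denominator_ample (ch : ProjectiveCharts f) {A : CDiv X} (hA : IsAmple A)
    {T : Set X.functionField} (hT : T.Finite) :
    ∃ (n : ℕ) (q : X.functionField), q ≠ 0 ∧ ∀ c ∈ T, q * c ∈ sectionSpace (n • A) := by
  obtain ⟨m, q, hq, h⟩ := ch.exists_denominator hT
  obtain ⟨n, s, hs, hs'⟩ := hA.exists_mem ch.hyperplane
  -- As s is a section of -H + nA and qc one of mH, the product sᵐ q c is a section of mnA.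
  refine ⟨m * n, s ^ m * q, mul_ne_zero (pow_ne_zero _ hs) hq, fun c hc => ?_⟩
  have := mul_mem_sectionSpace (pow_mem_sectionSpace hs' m) (h c hc)
  have aux : ∀ {G : Type} [AddCommGroup G] (a b : G), m • (-a + n • b) + m • a = (m * n) • b := fun a b => by
    rw [smul_add, smul_neg, mul_smul]; abel
  have e : m • (-ch.hyperplane + n • A) + m • ch.hyperplane = (m * n) • A :=
    Subtype.ext (funext fun x => aux (ch.hyperplane.1 x) (A.1 x))
  rwa [e, ← mul_assoc] at this

end Ample
end CoxEuler
end

noncomputable section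
namespace CoxEuler

/-! ### Degree-shifting maps between graded modules -/

section Graded
open DirectSum
variable {ι : Type} [DecidableEq ι] {A M : ι → Type} [∀ i, AddCommMonoid (A i)] [∀ i, AddCommMonoid (M i)]

lemma toAddMonoid_of_comp_apply {e : ι → ι} (he : Function.Injective e) (φ : ∀ i, M i →+ A (e i))
    (x : ⨁ i, M i) (i : ι) :
    DirectSum.toAddMonoid (fun i => (DirectSum.of A (e i)).comp (φ i)) x (e i) = φ i (x i) := by
  induction x using DirectSum.induction_on with
  | zero => simp
  | add x y hx hy => simp only [map_add, DirectSum.add_apply, hx, hy]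
  | of j x =>
    rw [DirectSum.toAddMonoid_of, AddMonoidHom.comp_apply]
    by_cases h : j = i
    · subst h
      rw [DirectSum.of_eq_same, DirectSum.of_eq_same]
    · rw [DirectSum.of_eq_of_ne _ _ _ (Ne.symm h), DirectSum.of_eq_of_ne _ _ _ (he.ne (Ne.symm h)),
        map_zero]

lemma map_smul_of_map_of_smul_of [AddMonoid ι] [DirectSum.GSemiring A] [DirectSum.Gmodule A M]
    (Φ : (⨁ i, M i) →+ ⨁ i, A i)
    (h : ∀ i j (a : A i) (x : M j), Φ (DirectSum.of A i a • DirectSum.of M j x) =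
      DirectSum.of A i a * Φ (DirectSum.of M j x)) (s : ⨁ i, A i) (x : ⨁ i, M i) :
    Φ (s • x) = s * Φ x := by
  induction s using DirectSum.induction_on with
  | zero => rw [zero_smul, map_zero, zero_mul]
  | add a b ha hb => rw [add_smul, map_add, ha, hb, add_mul]
  | of i a =>
    induction x using DirectSum.induction_on with
    | zero => rw [smul_zero, map_zero, mul_zero]
    | add y z hy hz => rw [smul_add, map_add, map_add, hy, hz, mul_add]
    | of j x => exact h i j a x

end Graded

/-! ### Embedding the section module into a power of the Cox ring -/

section SectionMap
open DirectSum
variable {X : Scheme.{0}} [IsIntegral X] {Λ : AddSubgroup (CDiv X)} {F : X.Modules}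

/-- The map `H⁰(X, F(D_l)) → H⁰(X, 𝒪_X(D_{μ+l}))` induced by a functional `F → 𝒪_X(D_μ)`. -/
def pieceMap (θ : genericDual (toPMod F)) (μ : Λ) (hθ : MapsInto θ μ.1) (l : Λ) :
    gradedSections Λ F l →+ coxPiece Λ (μ + l) where
  toFun x := ⟨globalVal l.1 θ x, fun y => hθ.twistDual (D := l.1) ⟨⊤, trivial⟩ x y trivial⟩
  map_zero' := Subtype.ext (map_zero _)
  map_add' _ _ := Subtype.ext (map_add _ _ _)

open Classical in
/-- The map `Γ_Λ(F) → S_Λ`, of degree `μ`, induced by a functional `F → 𝒪_X(D_μ)`. -/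
def sectionMapHom (θ : genericDual (toPMod F)) (μ : Λ) (hθ : MapsInto θ μ.1) :
    SectionModule Λ F →+ CoxRing Λ :=
  DirectSum.toAddMonoid fun l => (DirectSum.of (fun l : Λ => coxPiece Λ l) (μ + l)).comp (pieceMap θ μ hθ l)

open Classical in
lemma sectionMapHom_of (θ : genericDual (toPMod F)) (μ : Λ) (hθ : MapsInto θ μ.1) (l : Λ)
    (x : gradedSections Λ F l) : sectionMapHom θ μ hθ (DirectSum.of (gradedSections Λ F) l x) =
      DirectSum.of (fun l : Λ => coxPiece Λ l) (μ + l) (pieceMap θ μ hθ l x) :=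
  DirectSum.toAddMonoid_of _ _ _

open Classical in
lemma of_smul_of (l m : Λ) (h : coxPiece Λ l) (x : gradedSections Λ F m) :
    DirectSum.of (fun l : Λ => coxPiece Λ l) l h • DirectSum.of (gradedSections Λ F) m x =
      DirectSum.of (gradedSections Λ F) (l + m) (twistMul F h.1 (multiplies_of_mem h.2) x) :=
  DirectSum.Gmodule.of_smul_of (fun l : Λ => coxPiece Λ l) (gradedSections Λ F) h x

open Classical in
lemma sectionMapHom_of_smul_of (θ : genericDual (toPMod F)) (μ : Λ) (hθ : MapsInto θ μ.1) (l m : Λ)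
    (h : coxPiece Λ l) (x : gradedSections Λ F m) : sectionMapHom θ μ hθ
      (DirectSum.of (fun l : Λ => coxPiece Λ l) l h • DirectSum.of (gradedSections Λ F) m x) =
        DirectSum.of (fun l : Λ => coxPiece Λ l) l h *
          sectionMapHom θ μ hθ (DirectSum.of (gradedSections Λ F) m x) := by
  rw [of_smul_of, sectionMapHom_of, sectionMapHom_of]
  refine Eq.trans ?_ (DirectSum.of_mul_of (A := fun l : Λ => coxPiece Λ l) h
    (pieceMap θ μ hθ m x)).symm
  refine DirectSum.of_eq_of_gradedMonoid_eq (Sigma.subtype_ext (add_left_comm μ l m) ?_)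
  exact globalVal_twistMul θ (multiplies_of_mem h.2) x

open Classical in
lemma sectionMapHom_smul (θ : genericDual (toPMod F)) (μ : Λ) (hθ : MapsInto θ μ.1) (s : CoxRing Λ)
    (x : SectionModule Λ F) : sectionMapHom θ μ hθ (s • x) = s * sectionMapHom θ μ hθ x :=
  map_smul_of_map_of_smul_of (A := fun l : Λ => coxPiece Λ l) (M := gradedSections Λ F)
    (sectionMapHom θ μ hθ) (sectionMapHom_of_smul_of θ μ hθ) s x

/-- The linear map `Γ_Λ(F) → S_Λ`, of degree `μ`, induced by a functional `F → 𝒪_X(D_μ)`. -/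
def sectionMap (θ : genericDual (toPMod F)) (μ : Λ) (hθ : MapsInto θ μ.1) :
    SectionModule Λ F →ₗ[CoxRing Λ] CoxRing Λ where
  __ := sectionMapHom θ μ hθ
  map_smul' := sectionMapHom_smul θ μ hθ

open Classical in
lemma sectionMap_apply (θ : genericDual (toPMod F)) (μ : Λ) (hθ : MapsInto θ μ.1)
    (x : SectionModule Λ F) (l : Λ) : sectionMap θ μ hθ x (μ + l) = pieceMap θ μ hθ l (x l) :=
  toAddMonoid_of_comp_apply (A := fun l : Λ => coxPiece Λ l) (M := gradedSections Λ F)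
    (add_right_injective μ) (pieceMap θ μ hθ) x l

/-- If finitely many functionals embed `F` into a sum of sheaves `𝒪_X(D_μ)`, and `S_Λ` is noetherian,
then `Γ_Λ(F)` is finitely generated. -/
lemma finite_sectionModule [IsNoetherianRing (CoxRing Λ)] {κ : Type} [Finite κ]
    (θ : κ → genericDual (toPMod F)) (hs : Separates θ) (μ : κ → Λ)
    (hθ : ∀ a, MapsInto (θ a) (μ a).1) : Module.Finite (CoxRing Λ) (SectionModule Λ F) := by
  let Φ : SectionModule Λ F →ₗ[CoxRing Λ] (κ → CoxRing Λ) :=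
    LinearMap.pi fun a => sectionMap (θ a) (μ a) (hθ a)
  refine Module.Finite.of_injective Φ ((injective_iff_map_eq_zero Φ).mpr fun x hx => ?_)
  refine DFinsupp.ext fun l => ?_
  -- Injectivity holds degree by degree, since the twisted functionals separate the sections of
  -- every twist.
  refine hs.twistDual (D := l.1) ⟨⊤, trivial⟩ (x l) fun a => ?_
  have := sectionMap_apply (θ a) (μ a) (hθ a) x l
  rw [show sectionMap (θ a) (μ a) (hθ a) x = 0 from congrFun hx a, DirectSum.zero_apply] at this
  exact (congrArg Subtype.val this).symm

variable {f : X ⟶ Spec (.of ℂ)}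

lemma isNoetherianRing_of_finiteType (h : (coxStructure Λ f).FiniteType) : IsNoetherianRing (CoxRing Λ) := by
  let := (coxStructure Λ f).toAlgebra
  have : Algebra.FiniteType ℂ (CoxRing Λ) := h
  exact Algebra.FiniteType.isNoetherianRing ℂ _

/-- Sections of reflexive sheaves are finitely generated if the Cox ring is. -/
lemma finite_sectionModule_of_isReflexive (hf : IsProjective f) (hA : ∃ D ∈ Λ, IsAmple D)
    (h : (coxStructure Λ f).FiniteType) (hF : IsReflexive F) :
    Module.Finite (CoxRing Λ) (SectionModule Λ F) := by
  obtain ⟨ch⟩ := exists_projectiveCharts hf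
  obtain ⟨A, hAΛ, hA⟩ := hA
  have := ch.compactSpace
  have := isNoetherianRing_of_finiteType h
  have : Module.Finite X.functionField (genericDual (toPMod F)) :=
    finiteDimensional_genericDual hF.coherent
  obtain ⟨n, b, hb⟩ := Module.Finite.exists_fin (R := X.functionField) (M := genericDual (toPMod F))
  -- Each member of a finite spanning family of functionals is rescaled so that its poles are
  -- bounded by a multiple of the ample divisor. Rescaling by q ≠ 0 does not affect separation.
  have key : ∀ a, ∃ (μ : Λ) (q : X.functionField), q ≠ 0 ∧ MapsInto (q • b a) μ.1 := by
    intro a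
    obtain ⟨T, hT, h⟩ := exists_mapsInto hF.coherent (b a)
    obtain ⟨n, q, hq, hqT⟩ := ch.exists_denominator_ample hA hT
    exact ⟨⟨n • A, Λ.nsmul_mem hAΛ n⟩, q, hq, h q _ hqT⟩
  choose μ q hq hμ using key
  refine finite_sectionModule (fun a => q a • b a) (fun U m hm => ?_) μ hμ
  refine separates_of_isReflexive hF U m fun θ => ?_
  have h0 : ∀ a, (b a).1 U m = 0 := fun a => (mul_eq_zero.mp (hm a)).resolve_left (hq a)
  let ev : genericDual (toPMod F) →ₗ[X.functionField] X.functionField :=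
    { toFun := fun θ => θ.1 U m
      map_add' := fun _ _ => rfl
      map_smul' := fun _ _ => rfl }
  have : ev = 0 := LinearMap.ext_on_range hb h0
  exact congrArg (· θ) this

end SectionMap
end CoxEuler
end

noncomputable section
namespace CoxEuler

/-! ### Functionals avoiding countably many vectors -/

section GenericFunctional

/-- Countably many nonzero vectors of a finite-dimensional complex vector space avoid the kernel of
some functional. -/
lemma exists_functional_ne_zero_of_finite {W : Type*} [AddCommGroup W] [Module ℂ W] [Module.Finite ℂ W]
    {ι : Type*} [Countable ι] (v : ι → W) : ∃ φ : W →ₗ[ℂ] ℂ, ∀ i, v i ≠ 0 → φ (v i) ≠ 0 := by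
  let b := Module.finBasis ℂ W
  -- Sending the basis to powers of the variable makes nonzero vectors into nonzero polynomials.
  -- Their roots form a countable set, and evaluation at any complex number outside it is the
  -- required functional.
  let p : W →ₗ[ℂ] Polynomial ℂ := (Finsupp.linearCombination ℂ
    fun k : Fin (Module.finrank ℂ W) => (Polynomial.X ^ (k : ℕ) : Polynomial ℂ)) ∘ₗ b.repr.toLinearMap
  have hp : Function.Injective p := by
    have h := (Polynomial.basisMonomials ℂ).linearIndependent.comp
      (fun k : Fin (Module.finrank ℂ W) => (k : ℕ)) Fin.val_injective
    have e : (Polynomial.basisMonomials ℂ : ℕ → Polynomial ℂ) ∘ (fun k : Fin (Module.finrank ℂ W) => (k : ℕ)) =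
        fun k : Fin (Module.finrank ℂ W) => (Polynomial.X ^ (k : ℕ) : Polynomial ℂ) := funext fun k => by simp [Polynomial.X_pow_eq_monomial]
    rw [e] at h
    exact Function.Injective.comp (g := Finsupp.linearCombination ℂ _) h b.repr.injective
  let A : Set ℂ := ⋃ i, {z : ℂ | v i ≠ 0 ∧ (p (v i)).IsRoot z}
  have hc : A.Countable := by
    refine Set.countable_iUnion fun i => ?_
    by_cases h : v i = 0
    · simp [h]
    · exact ((Polynomial.finite_setOfPred_isRoot ((map_ne_zero_iff p hp).mpr h)).subset fun z hz => hz.2).countable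
  obtain ⟨z, hz⟩ := Set.nonempty_compl (s := A) |>.mpr fun h => not_countable_complex (h ▸ hc)
  exact ⟨(Polynomial.leval z).comp p, fun i hi h => hz (Set.mem_iUnion.mpr ⟨i, hi, h⟩)⟩

/-- A finitely generated group of vectors has a functional that vanishes at zero only. -/
lemma exists_functional_ne_zero {V : Type*} [AddCommGroup V] [Module ℂ V] {Λ : Type*} [AddCommGroup Λ]
    [Module.Finite ℤ Λ] (c : Λ →+ V) : ∃ φ : V →ₗ[ℂ] ℂ, ∀ l, c l ≠ 0 → φ (c l) ≠ 0 := by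
  obtain ⟨n, g, hg⟩ := Module.Finite.exists_fin (R := ℤ) (M := Λ)
  have : Countable Λ := by
    have : Function.Surjective (Fintype.linearCombination ℤ g) := by
      rw [← LinearMap.range_eq_top, Fintype.range_linearCombination, hg]
    exact this.countable
  -- The image of the group lies in this finite-dimensional span, so a functional is chosen there
  -- and then extended.
  let W := Submodule.span ℂ (Set.range (c ∘ g))
  have hW : ∀ l, c l ∈ W := by
    intro l
    have hl : l ∈ Submodule.span ℤ (Set.range g) := hg ▸ Submodule.mem_top
    induction hl using Submodule.span_induction with
    | mem x hx =>
      obtain ⟨k, rfl⟩ := hx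
      exact Submodule.subset_span ⟨k, rfl⟩
    | zero => rw [map_zero]; exact W.zero_mem
    | add x y _ _ hx hy => rw [map_add]; exact W.add_mem hx hy
    | smul z x _ hx => rw [map_zsmul]; exact W.toAddSubgroup.zsmul_mem hx z
  have : Module.Finite ℂ W := Module.Finite.span_of_finite ℂ (Set.finite_range _)
  obtain ⟨φ, hφ⟩ := exists_functional_ne_zero_of_finite fun l => (⟨c l, hW l⟩ : W)
  obtain ⟨φ', h⟩ := φ.exists_extend
  refine ⟨φ', fun l hl h0 => hφ l (fun e => hl (congrArg Subtype.val e)) ?_⟩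
  rw [← h]; exact h0

end GenericFunctional

section KillsRelations
variable {X : Scheme.{0}} (f : X ⟶ Spec (.of ℂ)) {F : X.Modules} {T : Type} {V : T → X.Opens}
  {Λ : Type} [AddCommGroup Λ]

/-- The functional `L` on `Λ` is compatible with all linear relations, with complex coefficients,
between the classes in Čech cohomology of the cocycles `ψ(l)`. -/
def KillsRelations (ψ : ∀ s t : T, Λ →+ (toPMod F).obj (op (V s ⊓ V t))) (L : Λ →+ ℂ) : Prop :=
  ∀ (κ : Type) [Fintype κ] (z : κ → ℂ) (l : κ → Λ) (b : ∀ t, (toPMod F).obj (op (V t))),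
    (∀ s t, ∑ k, constHom f (V s ⊓ V t) (z k) • ψ s t (l k) = cechD0 (toPMod F) V b s t) →
      ∑ k, z k * L (l k) = 0

end KillsRelations

/-! ### A linear functional on Chern classes -/

section ChernFunctional
variable {X : Scheme.{0}} [IsIntegral X] {Λ : AddSubgroup (CDiv X)} (f : X ⟶ Spec (.of ℂ))

omit [IsIntegral X] in
lemma resFun_constHom {U V : X.Opens} (h : V ≤ U) (z : ℂ) :
    resFun h (constHom f U z) = constHom f V z := resFun_resFun le_top h _

/-- If `c₁` is injective, there is a linear functional on `H¹(X, Ω_X)` that does not vanish at the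
Chern classes of nonzero divisors. It is described by its values `L(l)` at the `c₁(l)`. -/
lemma exists_chern_functional [Module.Finite ℤ Λ] (hc1 : Function.Injective (c1 (Λ := Λ) f)) :
    ∃ L : Λ →+ ℂ, (∀ l, l ≠ 0 → L l ≠ 0) ∧
      KillsRelations f (Λ := Λ) (F := Omega f) (V := Trivialization.V (Λ := Λ)) (psi f) L := by
  let inst1 (t : Trivialization Λ) : Module ℂ ((toPMod (Omega f)).obj (op t.V)) :=
    Module.compHom _ (constHom f t.V)
  let inst2 (s t : Trivialization Λ) : Module ℂ ((toPMod (Omega f)).obj (op (s.V ⊓ t.V))) :=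
    Module.compHom _ (constHom f (s.V ⊓ t.V))
  let δ : (∀ t : Trivialization Λ, (toPMod (Omega f)).obj (op t.V)) →ₗ[ℂ]
      (∀ s t : Trivialization Λ, (toPMod (Omega f)).obj (op (s.V ⊓ t.V))) :=
    { cechD0 (toPMod (Omega f)) (Trivialization.V (Λ := Λ)) with
      map_smul' := fun z b => funext fun s => funext fun t => by
        have e1 := resSec_smul (toPMod (Omega f)) (V := s.V ⊓ t.V) inf_le_right (constHom f t.V z) (b t)
        have e2 := resSec_smul (toPMod (Omega f)) (V := s.V ⊓ t.V) inf_le_left (constHom f s.V z) (b s)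
        rw [resFun_constHom] at e1 e2
        refine (congrArg₂ (· - ·) e1 e2).trans ?_
        exact (smul_sub (constHom f (s.V ⊓ t.V) z) _ _).symm }
  -- All cochains are taken modulo coboundaries. This complex vector space contains the cohomology
  -- group, and c(l) is zero only if the cocycle of l is a coboundary, that is, c₁(l) = 0.
  let c : Λ →+ (∀ s t : Trivialization Λ, (toPMod (Omega f)).obj (op (s.V ⊓ t.V))) ⧸ LinearMap.range δ :=
    (LinearMap.range δ).mkQ.toAddMonoidHom.comp
      { toFun := fun l s t => psi f s t l
        map_zero' := funext fun s => funext fun t => map_zero (psi f s t)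
        map_add' := fun l m => funext fun s => funext fun t => map_add (psi f s t) l m }
  obtain ⟨φ, hφ⟩ := exists_functional_ne_zero (Λ := Λ) c
  refine ⟨φ.toAddMonoidHom.comp c, fun l hl => hφ l fun h => hl (hc1 ?_), fun κ _ z l b hb => ?_⟩
  · obtain ⟨b, hb⟩ := (Submodule.Quotient.mk_eq_zero _).mp h
    rw [map_zero]
    exact (QuotientAddGroup.eq_zero_iff _).mpr ⟨b, hb⟩
  · have : ∑ k, z k • c (l k) = 0 := by
      have : (LinearMap.range δ).mkQ (∑ k, z k • fun s t => psi f s t (l k)) = 0 := by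
        refine (Submodule.Quotient.mk_eq_zero _).mpr ⟨b, ?_⟩
        refine funext fun s => funext fun t => ?_
        rw [Finset.sum_apply, Finset.sum_apply]
        exact (hb s t).symm
      rw [map_sum] at this
      simp only [map_smul] at this
      exact this
    have := congrArg φ this
    rw [map_sum, map_zero] at this
    simp only [map_smul, smul_eq_mul] at this
    exact this

end ChernFunctional
end CoxEuler
end

noncomputable section
namespace CoxEuler

/-! ### Constructing and describing global sections of twists -/

section TwistSections
open MonoidalCategory
variable {X : Scheme.{0}} [IsIntegral X] {F : X.Modules}

/-- Global sections of `F(0)` come from global sections of `F`. -/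
lemma exists_section_of_twist_zero {κ : Type} {θ : κ → genericDual (toPMod F)} (hs : Separates θ)
    (x : H0 (twist F 0)) : ∃ m : H0 F, ∀ φ : genericDual (toPMod F), φ.1 ⟨⊤, trivial⟩ m = globalVal 0 φ x := by
  have key : ∀ y : X, ∃ (V : X.Opens) (hy : y ∈ V) (m : (toPMod F).obj (op V)),
      ∀ φ : genericDual (toPMod F), φ.1 ⟨V, genericPoint_mem hy⟩ m = globalVal 0 φ x := by
    intro y
    obtain ⟨V, hV, hy, n, hn⟩ := exists_toSheafify_eq_res (toPMod F ⊗ divisorSheaf 0) x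
      (x := y) trivial
    -- The constant 1 is a local equation of the zero divisor everywhere, so the local sections have
    -- the form m ⊗ 1.
    obtain ⟨m, rfl⟩ := exists_eq_tmul (D := (0 : CDiv X)) (genericPoint_mem hy) 1 (fun _ _ => rfl) n
    refine ⟨V, hy, m, fun φ => ?_⟩
    refine Eq.trans ?_ (sheafifyDual_eq (preTwist 0 φ) ⟨⊤, trivial⟩ ⟨V, genericPoint_mem hy⟩ hV x _ hn).symm
    refine Eq.trans ?_ (preTwist_tmul 0 φ ⟨V, genericPoint_mem hy⟩ m _).symm
    change _ = _ * ((1⁻¹ : (X.functionField)ˣ) : X.functionField)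
    rw [inv_one, Units.val_one, mul_one]
  choose V hV m hm using key
  obtain ⟨n, hn, -⟩ := existsUnique_glue F V ⊤ (fun _ => le_top)
    (fun y _ => Opens.mem_iSup.mpr ⟨y, hV y⟩) m (fun y z => by
      have hyz : genericPoint X ∈ V y ⊓ V z := ⟨genericPoint_mem (hV y), genericPoint_mem (hV z)⟩
      -- On overlaps the local sections have the same value under every functional, so separation
      -- makes them equal.
      refine sub_eq_zero.mp (hs ⟨V y ⊓ V z, hyz⟩ _ fun a => ?_)
      rw [map_sub, (θ a).2.2 ⟨V y, genericPoint_mem (hV y)⟩ ⟨V y ⊓ V z, hyz⟩ inf_le_left,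
        (θ a).2.2 ⟨V z, genericPoint_mem (hV z)⟩ ⟨V y ⊓ V z, hyz⟩ inf_le_right, hm, hm, sub_self])
  refine ⟨n, fun φ => ?_⟩
  rw [← hm (genericPoint X) φ, ← hn (genericPoint X), φ.2.2 ⟨⊤, trivial⟩ ⟨V (genericPoint X), _⟩ le_top]

/-- Sections `m_t` of `F` with `m_t = (f_t / f_s) m_s`, where the `f_t` are local equations of `D`,
define a global section `m_t ⊗ f_t⁻¹` of `F(D)`. -/
lemma exists_section_twist {D : CDiv X} {T : Type} {V : T → X.Opens} (hV : ∀ x, ∃ t, x ∈ V t)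
    (hη : ∀ t, genericPoint X ∈ V t) (eq : T → (X.functionField)ˣ)
    (heq : ∀ t, ∀ x ∈ V t, IsLocalEquationAt D x (eq t)) (m : ∀ t, (toPMod F).obj (op (V t)))
    (g : ∀ s t, Γ(X, V s ⊓ V t))
    (hg : ∀ s t, (eq s : X.functionField) * ratFun (U := V s ⊓ V t) ⟨hη s, hη t⟩ (g s t) = eq t)
    (hm : ∀ s t, resSec (toPMod F) (V := V s ⊓ V t) inf_le_right (m t) =
      g s t • resSec (toPMod F) (V := V s ⊓ V t) inf_le_left (m s)) :
    ∃ x : H0 (twist F D), ∀ (φ : genericDual (toPMod F)) t,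
      globalVal D φ x * eq t = φ.1 ⟨V t, hη t⟩ (m t) := by
  have hd : ∀ t, ∀ x ∈ V t, IsSectionAt D x (((eq t)⁻¹ : (X.functionField)ˣ) : X.functionField) :=
    fun t x hx => isSectionAt_of (heq t x hx) (by
      rw [Units.inv_mul]; exact (RingHom.range _).one_mem)
  let n (t : T) : (toPMod F ⊗ divisorSheaf D).obj (op (V t)) := m t ⊗ₜ[Γ(X, V t)] divSec _ (hd t)
  have compat : ∀ s t, resSec (toPMod F ⊗ divisorSheaf D) (V := V s ⊓ V t) inf_le_left (n s) =
      resSec (toPMod F ⊗ divisorSheaf D) (V := V s ⊓ V t) inf_le_right (n t) := by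
    intro s t
    refine (resSec_tmul (M := toPMod F) (N := divisorSheaf D) inf_le_left (m s) _).trans
      (Eq.trans ?_ (resSec_tmul (M := toPMod F) (N := divisorSheaf D) inf_le_right (m t) _).symm)
    -- The relation f_s⁻¹ = g_st f_t⁻¹ lets g_st move across the tensor sign.
    have e : resSec (divisorSheaf D) (V := V s ⊓ V t) inf_le_left (divSec _ (hd s)) =
        g s t • resSec (divisorSheaf D) (V := V s ⊓ V t) inf_le_right (divSec _ (hd t)) := by
      have hst : genericPoint X ∈ V s ⊓ V t := ⟨hη s, hη t⟩
      apply divVal_injective D hst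
      refine Eq.trans ?_ (divVal_smul D hst (g s t) _).symm
      change (((eq s)⁻¹ : (X.functionField)ˣ) : X.functionField) =
        _ * (((eq t)⁻¹ : (X.functionField)ˣ) : X.functionField)
      have := hg s t
      have h1 := (eq s).ne_zero
      have h2 := (eq t).ne_zero
      rw [Units.val_inv_eq_inv_val, Units.val_inv_eq_inv_val]
      field_simp
      exact this.symm
    rw [e, hm s t]
    exact (TensorProduct.smul_tmul (R := Γ(X, V s ⊓ V t)) (g s t) _ _).symm
  obtain ⟨x, hx, -⟩ := existsUnique_glue (twist F D) V ⊤ (fun _ => le_top)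
    (fun y _ => Opens.mem_iSup.mpr (hV y)) (fun t => toSheafify _ (V t) (n t)) (fun s t => by
      refine (toSheafify_res (toPMod F ⊗ divisorSheaf D) _ _).symm.trans
        (Eq.trans ?_ (toSheafify_res (toPMod F ⊗ divisorSheaf D) _ _))
      rw [compat s t])
  refine ⟨x, fun φ t => ?_⟩
  have e : globalVal D φ x = (preTwist D φ).1 ⟨V t, hη t⟩ (n t) :=
    sheafifyDual_eq (preTwist D φ) ⟨⊤, trivial⟩ ⟨V t, hη t⟩ le_top x _ (hx t).symm
  rw [e]
  refine (congrArg (· * (eq t : X.functionField)) (preTwist_tmul D φ ⟨V t, hη t⟩ (m t) _)).trans ?_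
  change _ * (((eq t)⁻¹ : (X.functionField)ˣ) : X.functionField) * _ = _
  rw [mul_assoc, Units.inv_mul, mul_one]

end TwistSections

/-! ### The functional (ω, ℓ) ↦ L(ℓ) -/

section ExtDual
open TensorProduct
variable {X : Scheme.{0}} [IsIntegral X] {Λ : Type} [AddCommGroup Λ] (f : X ⟶ Spec (.of ℂ))

/-- The linear extension of `L : Λ → ℂ` to sections of `𝒪_X ⊗ Λ`, with values in the function field. -/
def tensorVal (L : Λ →+ ℂ) {U : X.Opens} (hU : genericPoint X ∈ U) :
    Γ(X, U) ⊗[ℤ] Λ →+ X.functionField :=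
  TensorProduct.liftAddHom ((AddMonoidHom.mul.comp (ratFun hU).toAddMonoidHom).compl₂
    ((constFun f).toAddMonoidHom.comp L)) (fun n a l => by
      change ratFun hU (n • a) * constFun f (L l) = ratFun hU a * constFun f (L (n • l))
      rw [map_zsmul, map_zsmul, map_zsmul, smul_mul_assoc, mul_smul_comm])

lemma tensorVal_tmul (L : Λ →+ ℂ) {U : X.Opens} (hU : genericPoint X ∈ U) (a : Γ(X, U)) (l : Λ) :
    tensorVal f L hU (a ⊗ₜ l) = ratFun hU a * constFun f (L l) := rfl

lemma tensorVal_smul (L : Λ →+ ℂ) {U : X.Opens} (hU : genericPoint X ∈ U) (r : Γ(X, U))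
    (x : Γ(X, U) ⊗[ℤ] Λ) : tensorVal f L hU (r • x) = ratFun hU r * tensorVal f L hU x := by
  induction x with
  | zero => rw [smul_zero, map_zero, mul_zero]
  | add x y hx hy =>
    rw [smul_add, map_add, map_add, hx, hy]
    exact (mul_add _ _ _).symm
  | tmul a l =>
    rw [TensorProduct.smul_tmul', tensorVal_tmul, tensorVal_tmul, smul_eq_mul, map_mul, mul_assoc]

lemma tensorVal_resTensor (L : Λ →+ ℂ) {U V : X.Opens} (h : V ≤ U) (hV : genericPoint X ∈ V)
    (x : Γ(X, U) ⊗[ℤ] Λ) : tensorVal f L hV (resTensor Λ h x) = tensorVal f L (h hV) x := by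
  induction x with
  | zero => rw [map_zero, map_zero, map_zero]
  | add x y hx hy => rw [map_add, map_add, map_add, hx, hy]
  | tmul a l =>
    change tensorVal f L hV (resFun h a ⊗ₜ[ℤ] l) = _
    rw [tensorVal_tmul, tensorVal_tmul, ratFun_resFun]

lemma isSectionAt_tensorVal (L : Λ →+ ℂ) {U : X.Opens} (hU : genericPoint X ∈ U)
    (a : Γ(X, U) ⊗[ℤ] Λ) {x : X} (hx : x ∈ U) : IsSectionAt 0 x (tensorVal f L hU a) := by
  induction a with
  | zero => rw [map_zero]; exact isSectionAt_zero _ _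
  | add a b ha hb => rw [map_add]; exact isSectionAt_add _ ha hb
  | tmul a l =>
    rw [tensorVal_tmul]
    have := (isSectionAt_one X x).regular_mul
      ((isRegularAt_ratFun hU a hx).mul (isRegularAt_constFun f (L l) x))
    rwa [mul_one] at this

variable (F : X.Modules) {T : Type} (V : T → X.Opens) (ψ : ∀ s t : T, Λ →+ (toPMod F).obj (op (V s ⊓ V t)))
  [Module.Free ℤ Λ] [Module.Finite ℤ Λ]

/-- The additive map underlying `extSnd`. -/
def extSndHom (U : X.Opens) : (toPMod (extSheaf F V ψ)).obj (op U) →+ Γ(X, U) ⊗[ℤ] Λ where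
  toFun m := extSnd F V ψ U m
  map_zero' := rfl
  map_add' _ _ := rfl

/-- The functional `(ω, ℓ) ↦ L(ℓ)` on an extension. -/
def extDual (L : Λ →+ ℂ) : genericDual (toPMod (extSheaf F V ψ)) :=
  ⟨fun U => (tensorVal f L U.2).comp (extSndHom F V ψ U.1),
    fun U r m => tensorVal_smul f L U.2 r (extSndHom F V ψ U.1 m),
    fun U V' h m => tensorVal_resTensor f L h V'.2 (extSndHom F V ψ U.1 m)⟩

lemma mapsInto_extDual (L : Λ →+ ℂ) : MapsInto (extDual f F V ψ L) 0 :=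
  fun U m _ hx => isSectionAt_tensorVal f L U.2 (extSndHom F V ψ U.1 m) hx

end ExtDual

section EulerDual
variable {X : Scheme.{0}} [IsIntegral X] {Λ : AddSubgroup (CDiv X)} [Module.Free ℤ Λ]
  [Module.Finite ℤ Λ] (f : X ⟶ Spec (.of ℂ))

/-- The functional `(ω, ℓ) ↦ L(ℓ)` on the Euler sheaf. -/
def eulerDual (L : Λ →+ ℂ) : genericDual (toPMod (eulerSheaf f Λ)) := by
  have θ := @extDual X _ Λ _ f (Omega f) _ (Trivialization.V (Λ := Λ)) (psi f) _ _ L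
  exact θ

lemma mapsInto_eulerDual (L : Λ →+ ℂ) : MapsInto (eulerDual f L) 0 := by
  have h := @mapsInto_extDual X _ Λ _ f (Omega f) _ (Trivialization.V (Λ := Λ)) (psi f) _ _ L
  exact h

end EulerDual
end CoxEuler
end

noncomputable section
namespace CoxEuler

/-! ### Sections of the extension on overlaps and globally -/

section ExtensionSections
open TensorProduct
variable {X : Scheme.{0}} [IsIntegral X] {Λ : Type} [AddCommGroup Λ] (f : X ⟶ Spec (.of ℂ))
  (F : X.Modules) {T : Type} (V : T → X.Opens) (ψ : ∀ s t : T, Λ →+ (toPMod F).obj (op (V s ⊓ V t)))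
  [Module.Free ℤ Λ] [Module.Finite ℤ Λ]

omit [IsIntegral X] [Module.Free ℤ Λ] [Module.Finite ℤ Λ] in
lemma psiTensor_tmul (s t : T) {W : X.Opens} (hW : W ≤ V s ⊓ V t) (a : Γ(X, W)) (l : Λ) :
    psiTensor F V ψ s t hW (a ⊗ₜ l) = a • resSec (toPMod F) hW (ψ s t l) := rfl

omit [IsIntegral X] [Module.Free ℤ Λ] [Module.Finite ℤ Λ] in
lemma resTensor_tmul {U W : X.Opens} (h : W ≤ U) (a : Γ(X, U)) (l : Λ) :
    resTensor Λ h (a ⊗ₜ l) = resFun h a ⊗ₜ l := rfl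

variable (X) in
lemma genericPoint_mem_top : genericPoint X ∈ (⊤ : X.Opens) := trivial

omit [IsIntegral X] in
-- In the chart t the pair (a, p ⊗ l) of the chart s has first component a + p ψ_st(l), so the two
-- hypotheses say that both components transform by g. The conclusion is the gluing condition of
-- `exists_section_twist`.
lemma extPair_compat (hψ : ∀ l, (fun s t => ψ s t l) ∈ cechZ1 (toPMod F) V) {s t : T}
    {a : (toPMod F).obj (op (V s))} {a' : (toPMod F).obj (op (V t))} {p : Γ(X, V s)} {p' : Γ(X, V t)}
    (g : Γ(X, V s ⊓ V t)) (l : Λ) (hp : resFun (V := V s ⊓ V t) inf_le_right p' =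
      g * resFun (V := V s ⊓ V t) inf_le_left p)
    (ha : resSec (toPMod F) (V := V s ⊓ V t) inf_le_right a' =
      g • (resSec (toPMod F) (V := V s ⊓ V t) inf_le_left a + resFun (V := V s ⊓ V t) inf_le_left p • ψ s t l)) :
    resSec (toPMod (extSheaf F V ψ)) (V := V s ⊓ V t) inf_le_right
        (extPair F V ψ hψ t le_rfl a' (p' ⊗ₜ l)) =
      g • resSec (toPMod (extSheaf F V ψ)) (V := V s ⊓ V t) inf_le_left
        (extPair F V ψ hψ s le_rfl a (p ⊗ₜ l)) := by
  have e1 : resSec (toPMod (extSheaf F V ψ)) (V := V s ⊓ V t) inf_le_right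
      (extPair F V ψ hψ t le_rfl a' (p' ⊗ₜ l)) = extPair F V ψ hψ t (W := V s ⊓ V t) inf_le_right
        (resSec (toPMod F) inf_le_right a') (resFun inf_le_right p' ⊗ₜ l) :=
    resSec_extOfPair hψ t le_rfl _ _ _
  have e2 : resSec (toPMod (extSheaf F V ψ)) (V := V s ⊓ V t) inf_le_left
      (extPair F V ψ hψ s le_rfl a (p ⊗ₜ l)) = extPair F V ψ hψ s (W := V s ⊓ V t) inf_le_left
        (resSec (toPMod F) inf_le_left a) (resFun inf_le_left p ⊗ₜ l) :=
    resSec_extOfPair hψ s le_rfl _ _ _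
  rw [e1, e2]
  refine ext_hom_ext t (W := V s ⊓ V t) inf_le_right ?_ ?_
  · rw [map_smul]
    refine (extOfPair_fst hψ t inf_le_right _ _).trans (ha.trans (congrArg (g • ·) ?_))
    change _ = resSec (toPMod F) _ (resSec (toPMod F) _ _ + psiTensor F V ψ s t _ (resTensor Λ _ _))
    rw [map_add, resSec_resSec, resSec_resSec, resSec_psiTensor, resTensor_resTensor]
    refine congrArg₂ (· + ·) rfl ?_
    rw [resTensor_tmul, psiTensor_tmul, resFun_resFun, resSec_self]
  · rw [map_smul]
    change resFun inf_le_right p' ⊗ₜ[ℤ] l = (g * resFun inf_le_left p) ⊗ₜ[ℤ] l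
    rw [hp]

omit [Module.Free ℤ Λ] [Module.Finite ℤ Λ] in
/-- If all regular functions are constant, a global section of an extension gives a relation between
the classes in the extension cocycle. -/
lemma exists_relation_of_section (hΓ : ∀ a : Γ(X, ⊤), ∃ z, constHom f ⊤ z = a) (L : Λ →+ ℂ)
    {κ : Type} [Fintype κ] (b : Module.Basis κ ℤ Λ) (m : extSections F V ψ ⊤) :
    ∃ z : κ → ℂ, (∀ s t, ∑ k, constHom f (V s ⊓ V t) (z k) • ψ s t (b k) =
      cechD0 (toPMod F) V (fun t => resSec (toPMod F) (le_inf le_top le_rfl) (m.1.1 t)) s t) ∧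
      tensorVal f L (genericPoint_mem_top X) m.1.2 = constFun f (∑ k, z k * L (b k)) := by
  -- The coordinates of ℓ are global functions, hence constants z_k, and the gluing rule for the
  -- components ω_t then exhibits ∑ z_k ψ(b_k) as their coboundary.
  choose z hz using fun k => hΓ ((b.baseChange Γ(X, ⊤)).coord k m.1.2)
  have hsum : ∑ k, constHom f ⊤ (z k) • ((1 : Γ(X, ⊤)) ⊗ₜ[ℤ] b k) = m.1.2 := by
    refine Eq.trans (Finset.sum_congr rfl fun k _ => ?_) (sum_coord_baseChange b m.1.2)
    rw [hz]
  refine ⟨z, fun s t => ?_, ?_⟩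
  · have h := congrArg (resSec (toPMod F) (V := V s ⊓ V t) (le_inf le_top le_rfl)) (m.2 s t)
    rw [map_add, resSec_resSec, resSec_resSec, resSec_psiTensor, resTensor_resTensor] at h
    change _ = resSec (toPMod F) _ (resSec (toPMod F) _ (m.1.1 t)) -
      resSec (toPMod F) _ (resSec (toPMod F) _ (m.1.1 s))
    rw [resSec_resSec, resSec_resSec]
    refine Eq.trans ?_ (sub_eq_of_eq_add' h).symm
    rw [← hsum, map_sum, map_sum]
    refine Finset.sum_congr rfl fun k _ => ?_
    rw [resTensor_smul, map_smul, resFun_constHom]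
    refine congrArg (constHom f (V s ⊓ V t) (z k) • ·) ?_
    rw [resTensor_tmul, psiTensor_tmul, map_one, one_smul, resSec_self]
  · rw [← hsum, map_sum, map_sum]
    refine Finset.sum_congr rfl fun k _ => ?_
    rw [tensorVal_smul, tensorVal_tmul, map_one, one_mul, map_mul]
    rfl

end ExtensionSections
end CoxEuler
end

noncomputable section
namespace CoxEuler

/-! ### Global regular functions are constant -/

section Constants
variable {X : Scheme.{0}} [IsIntegral X] {f : X ⟶ Spec (.of ℂ)}

/-- Global regular functions on a projective variety are constant. -/
lemma ProjectiveCharts.exists_constFun_eq (ch : ProjectiveCharts f) {h : X.functionField}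
    (hh : h ∈ sectionSpace (0 : CDiv X)) : ∃ z, constFun f z = h := by
  let := functionFieldAlgebra f
  have := ch.finiteDimensional_sectionSubmodule 0
  -- The global regular functions form a finite-dimensional algebra inside a field, so they are
  -- algebraic over ℂ and therefore constant.
  let A : Subalgebra ℂ X.functionField :=
    { sectionSubmodule f 0 with
      mul_mem' := fun {a b} ha hb => by
        have := mul_mem_sectionSpace (D := 0) (E := 0) (X := X) ha hb
        rwa [add_zero] at this
      algebraMap_mem' := fun z => constFun_mem (Λ := ⊥) f z }
  have hfg : A.toSubmodule.FG := (Submodule.fg_top _).mp this.fg_top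
  have hint : IsIntegral ℂ h := IsIntegral.of_mem_of_fg A hfg h hh
  exact (minpoly.mem_range_of_degree_eq_one ℂ h
    (IsAlgClosed.degree_eq_one_of_irreducible ℂ (minpoly.irreducible hint)))

lemma ratFun_constHom {U : X.Opens} (hU : genericPoint X ∈ U) (z : ℂ) :
    ratFun hU (constHom f U z) = constFun f z := by
  rw [← resFun_constHom f le_top z, ratFun_resFun]; rfl

lemma ProjectiveCharts.exists_constHom_eq (ch : ProjectiveCharts f) (a : Γ(X, ⊤)) :
    ∃ z, constHom f ⊤ z = a := by
  obtain ⟨z, hz⟩ := ch.exists_constFun_eq (h := ratFun (genericPoint_mem_top X) a) fun x => by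
    have := (isSectionAt_one X x).regular_mul (isRegularAt_ratFun (genericPoint_mem_top X) a (x := x) trivial)
    rwa [mul_one] at this
  exact ⟨z, ratFun_injective (genericPoint_mem_top X) ((ratFun_constHom _ z).trans hz)⟩

end Constants

/-! ### Sections of a divisor with nonzero Chern class have zeros -/

section EulerSections
open TensorProduct
variable {X : Scheme.{0}} [IsIntegral X] {Λ : AddSubgroup (CDiv X)} {f : X ⟶ Spec (.of ℂ)}

/-- A section of `𝒪_X(D)` without zeros trivializes `D`. -/
lemma exists_zero (hc1 : Function.Injective (c1 (Λ := Λ) f)) {l : Λ} (hl : l ≠ 0)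
    (h : (X.functionField)ˣ) :
    ∃ x, ∀ q, IsLocalEquationAt l.1 x q → h * q ∉ localUnits X x := by
  by_contra! hcon
  -- If h had no zeros, the functions u_t = h f_t would be units with u_t / u_s = g_st. The Chern
  -- cocycle would be the coboundary of dlog u_t, so c₁(l) = 0, against injectivity.
  have hu : ∀ t : Trivialization Λ, ∃ u : (Γ(X, t.V))ˣ,
      ∀ hη : genericPoint X ∈ t.V, ratFun hη (u : Γ(X, t.V)) = h * (t.eqn l).toMul := by
    intro t
    have := t.nonempty
    obtain ⟨u, hu⟩ := exists_unit (U := t.V) (h * (t.eqn l).toMul) fun x hx => by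
      obtain ⟨q, hq, hq'⟩ := hcon x
      have := (localUnits X x).mul_mem hq' (hq.div_mem (t.isLocalEquationAt l x hx))
      rwa [mul_assoc, mul_inv_cancel_left] at this
    exact ⟨u, fun hη => (ratFun_eq_germ hη _).trans (congrArg Units.val hu)⟩
  choose u hu using hu
  refine hl (hc1 ?_)
  rw [map_zero]
  refine (QuotientAddGroup.eq_zero_iff _).mpr ⟨fun t => dlog f t.V (Additive.ofMul (u t)), ?_⟩
  refine funext fun s => funext fun t => ?_
  change resSec _ _ (dlog f _ _) - resSec _ _ (dlog f _ _) = dlog f _ (transition s t l)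
  rw [resSec_dlog, resSec_dlog, ← map_sub]
  refine congrArg _ ?_
  have hη : genericPoint X ∈ s.V ⊓ t.V :=
    ⟨genericPoint_mem_trivialization s, genericPoint_mem_trivialization t⟩
  rw [sub_eq_iff_eq_add]
  apply Additive.toMul.injective
  apply Units.ext
  apply ratFun_injective hη
  have e1 : ratFun hη ((transition s t l).toMul : Γ(X, s.V ⊓ t.V)) = (s.eqn l).toMul⁻¹ * (t.eqn l).toMul :=
    (ratFun_eq_germ hη _).trans (congrArg Units.val (transition_spec s t l))
  have e2 : ratFun hη (resFun (V := s.V ⊓ t.V) inf_le_right (u t : Γ(X, t.V))) = h * (t.eqn l).toMul := by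
    rw [ratFun_resFun, hu]
  have e3 : ratFun hη (resFun (V := s.V ⊓ t.V) inf_le_left (u s : Γ(X, s.V))) = h * (s.eqn l).toMul := by
    rw [ratFun_resFun, hu]
  refine e2.trans (Eq.trans ?_ (map_mul (ratFun hη) _ _).symm)
  refine Eq.trans ?_ (congrArg₂ (· * ·) e1 e3).symm
  have := (s.eqn l).toMul.ne_zero
  rw [Units.val_inv_eq_inv_val]
  field_simp

end EulerSections
end CoxEuler
end

noncomputable section
namespace CoxEuler

/-! ### Lifting sections to the extension, and sections of degree zero -/

section ExtensionGlobal
open TensorProduct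
variable {X : Scheme.{0}} [IsIntegral X] {Λ : Type} [AddCommGroup Λ] (f : X ⟶ Spec (.of ℂ))
  {F : X.Modules} {T : Type} {V : T → X.Opens} {ψ : ∀ s t : T, Λ →+ (toPMod F).obj (op (V s ⊓ V t))}
  [Module.Free ℤ Λ] [Module.Finite ℤ Λ]

/-- Multiples `L(l) h` of sections `h` of `𝒪_X(D)` lift to sections of the extension, given locally by
`(a_t, h f_t ⊗ l) ⊗ f_t⁻¹`, if the `a_t` can be chosen suitably. -/
lemma exists_ext_section (hψ : ∀ l, (fun s t => ψ s t l) ∈ cechZ1 (toPMod F) V)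
    (hV : ∀ x, ∃ t, x ∈ V t) (hη : ∀ t, genericPoint X ∈ V t) {D : CDiv X} (eq : T → (X.functionField)ˣ)
    (heq : ∀ t, ∀ x ∈ V t, IsLocalEquationAt D x (eq t)) (g : ∀ s t, Γ(X, V s ⊓ V t))
    (hg : ∀ s t (hst : genericPoint X ∈ V s ⊓ V t), (eq s : X.functionField) * ratFun hst (g s t) = eq t)
    (L : Λ →+ ℂ) (l : Λ) {h : X.functionField} (hh : h ∈ sectionSpace D)
    (a : ∀ t, Γ(X, V t) → (toPMod F).obj (op (V t)))
    (ha : ∀ s t p p', resFun (V := V s ⊓ V t) inf_le_right p' =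
      g s t * resFun (V := V s ⊓ V t) inf_le_left p →
        resSec (toPMod F) (V := V s ⊓ V t) inf_le_right (a t p') =
          g s t • (resSec (toPMod F) (V := V s ⊓ V t) inf_le_left (a s p) +
            resFun (V := V s ⊓ V t) inf_le_left p • ψ s t l)) :
    ∃ x : H0 (twist (extSheaf F V ψ) D), globalVal D (extDual f F V ψ L) x = constFun f (L l) * h := by
  -- The functions p_t = h f_t are regular and satisfy p_t = g_st p_s on overlaps.
  have hp : ∀ t, ∃ p : Γ(X, V t), ratFun (hη t) p = h * eq t := fun t =>
    exists_ratFun_eq _ fun x hx => hh x _ (heq t x hx)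
  choose p hp using hp
  have hst : ∀ s t, genericPoint X ∈ V s ⊓ V t := fun s t => ⟨hη s, hη t⟩
  have hpp : ∀ s t, resFun (V := V s ⊓ V t) inf_le_right (p t) =
      g s t * resFun (V := V s ⊓ V t) inf_le_left (p s) := by
    intro s t
    apply ratFun_injective (hst s t)
    rw [map_mul, ratFun_resFun, ratFun_resFun, hp, hp, ← hg s t (hst s t)]
    ring
  obtain ⟨x, hx⟩ := exists_section_twist (F := extSheaf F V ψ) hV hη eq heq
    (fun t => extPair F V ψ hψ t le_rfl (a t (p t)) (p t ⊗ₜ l)) g (fun s t => hg s t _)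
    (fun s t => extPair_compat F V ψ hψ _ l (hpp s t) (ha s t _ _ (hpp s t)))
  refine ⟨x, ?_⟩
  obtain ⟨t, -⟩ := hV (genericPoint X)
  apply mul_right_cancel₀ (eq t).ne_zero
  refine (hx (extDual f F V ψ L) t).trans ?_
  refine Eq.trans (b := ratFun (hη t) (p t) * constFun f (L l)) rfl ?_
  rw [hp]
  ring

/-- A functional that kills all relations in the extension cocycle is zero on global sections. -/
lemma globalVal_extDual_zero (hψ : ∀ l, (fun s t => ψ s t l) ∈ cechZ1 (toPMod F) V)
    (hV : ∀ x, ∃ t, x ∈ V t) (hF : IsReflexive F) (hΓ : ∀ a : Γ(X, ⊤), ∃ z, constHom f ⊤ z = a)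
    (L : Λ →+ ℂ) (hL : KillsRelations f ψ L)
    (x : H0 (twist (extSheaf F V ψ) 0)) : globalVal 0 (extDual f F V ψ L) x = 0 := by
  obtain ⟨m, hm⟩ := exists_section_of_twist_zero 
    (separates_of_isReflexive (isReflexive_extSheaf hV hψ hF)) x
  rw [← hm]
  obtain ⟨z, hz, hz'⟩ := exists_relation_of_section f F V ψ hΓ L (Module.Free.chooseBasis ℤ Λ) m
  refine hz'.trans ?_
  rw [hL _ z _ _ hz, map_zero]

end ExtensionGlobal

/-! ### The generalized Euler formula -/

section EulerGlobal
variable {X : Scheme.{0}} [IsIntegral X] {Λ : AddSubgroup (CDiv X)} (f : X ⟶ Spec (.of ℂ))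

lemma ratFun_transition (s t : Trivialization Λ) (l : Λ) (hη : genericPoint X ∈ s.V ⊓ t.V) :
    ratFun hη ((transition s t l).toMul : Γ(X, s.V ⊓ t.V)) =
      ((s.eqn l).toMul⁻¹ * (t.eqn l).toMul : (X.functionField)ˣ) :=
  (ratFun_eq_germ hη _).trans (congrArg Units.val (transition_spec s t l))

/-- The Leibniz rule gives d(gp) = g (dp + p dlog g). Thus a_t = d satisfies the condition imposed
on the a_t in `exists_ext_section`. -/
lemma diff_psi (s t : Trivialization Λ) (l : Λ) (p : Γ(X, s.V)) (p' : Γ(X, t.V))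
    (h : resFun (V := s.V ⊓ t.V) inf_le_right p' =
      ((transition s t l).toMul : Γ(X, s.V ⊓ t.V)) * resFun (V := s.V ⊓ t.V) inf_le_left p) :
    resSec (toPMod (Omega f)) (V := s.V ⊓ t.V) inf_le_right (diff f t.V p') =
      ((transition s t l).toMul : Γ(X, s.V ⊓ t.V)) •
        (resSec (toPMod (Omega f)) (V := s.V ⊓ t.V) inf_le_left (diff f s.V p) +
          resFun (V := s.V ⊓ t.V) inf_le_left p • psi f s t l) := by
  have e : psi f s t l = (((transition s t l).toMul⁻¹ : (Γ(X, s.V ⊓ t.V))ˣ) : Γ(X, s.V ⊓ t.V)) •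
    diff f (s.V ⊓ t.V) ((transition s t l).toMul : Γ(X, s.V ⊓ t.V)) := rfl
  rw [resSec_diff, resSec_diff, h, diff_mul, e, smul_add, smul_smul, smul_smul]
  congr 2
  rw [mul_right_comm, Units.mul_inv, one_mul]

lemma exists_mem_trivialization [Module.Free ℤ Λ] [Module.Finite ℤ Λ] (x : X) :
    ∃ t : Trivialization Λ, x ∈ t.V := by
  obtain ⟨t, ht, -⟩ := exists_trivialization (Λ := Λ) (U := ⊤) (x := x) trivial
  exact ⟨t, ht⟩

lemma eqn_mul_ratFun_transition (s t : Trivialization Λ) (l : Λ) (hη : genericPoint X ∈ s.V ⊓ t.V) :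
    ((s.eqn l).toMul : X.functionField) * ratFun hη ((transition s t l).toMul : Γ(X, s.V ⊓ t.V)) =
      (t.eqn l).toMul := by
  rw [ratFun_transition, ← Units.val_mul, mul_inv_cancel_left]

end EulerGlobal
end CoxEuler
end

noncomputable section
namespace CoxEuler

/-! ### The functional on the Euler sheaf -/

section EulerFunctional
variable {X : Scheme.{0}} [IsIntegral X] {Λ : AddSubgroup (CDiv X)} (f : X ⟶ Spec (.of ℂ))
  [Module.Free ℤ Λ] [Module.Finite ℤ Λ]

/-- The lift is given locally by (d(h f_t), h f_t ⊗ l) ⊗ f_t⁻¹, with f_t the local equation of D_l.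
-/
lemma exists_eulerDual_eq (L : Λ →+ ℂ) (l : Λ) {h : X.functionField} (hh : h ∈ coxPiece Λ l) :
    ∃ x : gradedSections Λ (eulerSheaf f Λ) l, globalVal l.1 (eulerDual f L) x = constFun f (L l) * h := by
  have key := @exists_ext_section X _ Λ _ f (Omega f) _ (Trivialization.V (Λ := Λ)) (psi f) _ _
    (fun l => psi_cocycle f l) exists_mem_trivialization genericPoint_mem_trivialization l.1
    (fun t => (t.eqn l).toMul) (fun t => t.isLocalEquationAt l)
    (fun s t => ((transition s t l).toMul : Γ(X, s.V ⊓ t.V)))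
    (fun s t hst => eqn_mul_ratFun_transition s t l hst) L l h hh
    (fun t => diff f t.V) (fun s t p p' => diff_psi f s t l p p')
  exact key

/-- A global section of the Euler sheaf projects to an element of Λ ⊗ ℂ on which the connecting map
to cohomology vanishes, and L respects all such relations. -/
lemma globalVal_eulerDual_zero (ch : ProjectiveCharts f) (hΩ : IsReflexive (Omega f)) (L : Λ →+ ℂ)
    (hL : KillsRelations f (Λ := Λ) (F := Omega f) (V := Trivialization.V (Λ := Λ)) (psi f) L) :
    ∀ x : H0 (twist (eulerSheaf f Λ) 0), globalVal 0 (eulerDual f L) x = 0 := by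
  have key := globalVal_extDual_zero (Λ := Λ) (F := Omega f) (V := Trivialization.V (Λ := Λ))
    (ψ := psi f) f (fun l => psi_cocycle f l) exists_mem_trivialization hΩ ch.exists_constHom_eq L hL
  exact key

end EulerFunctional
end CoxEuler
end

noncomputable section
namespace CoxEuler

/-! ### Vanishing orders at a point -/

section Vanishing
variable {X : Scheme.{0}} [IsIntegral X] {f : X ⟶ Spec (.of ℂ)}

/-- The functions on each chart form a quotient of a polynomial ring over ℂ in finitely many
variables. -/
lemma ProjectiveCharts.isLocallyNoetherian (ch : ProjectiveCharts f) : IsLocallyNoetherian X := by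
  have := ch.finite
  refine isLocallyNoetherian_of_affine_cover (S := fun k => ⟨ch.U k, ch.isAffineOpen k⟩)
    (top_le_iff.mp fun x _ => Opens.mem_iSup.mpr (ch.cover x)) fun k => ?_
  let e := MvPolynomial.eval₂Hom (constFun f)
    fun l => ((ch.u l / ch.u k : (X.functionField)ˣ) : X.functionField)
  have he : (ratFun (ch.generic k)).range = e.range := by
    ext c
    rw [← ch.regular_iff k c]
    constructor
    · rintro ⟨r, rfl⟩ x hx
      exact isRegularAt_ratFun _ r hx
    · exact fun h => exists_ratFun_eq (ch.generic k) h
  have h1 : IsNoetherianRing e.range :=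
    isNoetherianRing_of_surjective _ _ e.rangeRestrict e.rangeRestrict_surjective
  rw [← he] at h1
  exact isNoetherianRing_of_ringEquiv _ (RingEquiv.ofLeftInverse
    (Function.leftInverse_invFun (ratFun_injective (ch.generic k)))).symm

/-- The section `g` of `𝒪_X(D)` vanishes to order at least `N` at the point `x`. -/
def VanishesAt (x : X) (D : CDiv X) (N : ℕ) (g : X.functionField) : Prop :=
  ∀ q, IsLocalEquationAt D x q → ∃ a ∈ IsLocalRing.maximalIdeal (X.presheaf.stalk x) ^ N,
    algebraMap (X.presheaf.stalk x) X.functionField a = g * q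

variable {x : X} {D E : CDiv X} {M N : ℕ} {g h : X.functionField}

lemma vanishesAt_zero_of_mem (hg : g ∈ sectionSpace D) : VanishesAt x D 0 g := fun q hq => by
  obtain ⟨a, ha⟩ := hg x q hq
  exact ⟨a, by rw [pow_zero, Ideal.one_eq_top]; trivial, ha⟩

lemma VanishesAt.mul (hg : VanishesAt x D M g) (hh : VanishesAt x E N h) :
    VanishesAt x (D + E) (M + N) (g * h) := by
  intro q hq
  obtain ⟨q₁, h₁⟩ := exists_isLocalEquationAt D x
  obtain ⟨q₂, h₂⟩ := exists_isLocalEquationAt E x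
  obtain ⟨a, ha, ha'⟩ := hg q₁ h₁
  obtain ⟨b, hb, hb'⟩ := hh q₂ h₂
  obtain ⟨u, hu⟩ := (h₁.add h₂).div_mem hq
  have hu' : algebraMap (X.presheaf.stalk x) X.functionField u = (((q₁ * q₂)⁻¹ * q : (X.functionField)ˣ) : X.functionField) :=
    congrArg Units.val hu
  refine ⟨a * b * u, Ideal.mul_mem_right _ _ (by rw [pow_add]; exact Ideal.mul_mem_mul ha hb), ?_⟩
  rw [map_mul, map_mul, ha', hb', hu', Units.val_mul, Units.val_inv_eq_inv_val, Units.val_mul]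
  have := q₁.ne_zero
  have := q₂.ne_zero
  field_simp

lemma vanishesAt_one (hg : g ∈ sectionSpace D) (u : (X.functionField)ˣ) (hu : (u : X.functionField) = g)
    (hx : ∀ q, IsLocalEquationAt D x q → u * q ∉ localUnits X x) : VanishesAt x D 1 g := fun q hq => by
  obtain ⟨a, ha⟩ := hg x q hq
  refine ⟨a, ?_, ha⟩
  rw [pow_one]
  by_contra hcon
  have hua : IsUnit a := by
    by_contra h
    exact hcon ((IsLocalRing.mem_maximalIdeal a).mpr h)
  refine hx q hq ⟨hua.unit, Units.ext ?_⟩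
  exact ha.trans (by rw [Units.val_mul, hu])

/-- This is Krull's intersection theorem in the noetherian local ring at x. -/
lemma eq_zero_of_vanishesAt [IsLocallyNoetherian X] (hg : ∀ N, VanishesAt x D N g) : g = 0 := by
  obtain ⟨q, hq⟩ := exists_isLocalEquationAt D x
  obtain ⟨a, -, ha⟩ := hg 0 q hq
  have h : a ∈ (⨅ N : ℕ, IsLocalRing.maximalIdeal (X.presheaf.stalk x) ^ N) := by
    refine (Submodule.mem_iInf _).mpr fun N => ?_
    obtain ⟨b, hb, hb'⟩ := hg N q hq
    rwa [IsFractionRing.injective (X.presheaf.stalk x) X.functionField (ha.trans hb'.symm)]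
  rw [Ideal.iInf_pow_eq_bot_of_isLocalRing _ (Ideal.IsPrime.ne_top inferInstance)] at h
  rw [(Submodule.mem_bot _).mp h, map_zero] at ha
  exact (mul_eq_zero.mp ha.symm).resolve_right q.ne_zero

lemma VanishesAt.mono (hMN : M ≤ N) (hg : VanishesAt x D N g) : VanishesAt x D M g := fun q hq => by
  obtain ⟨a, ha, ha'⟩ := hg q hq
  exact ⟨a, Ideal.pow_le_pow_right hMN ha, ha'⟩

variable (f x D N) in
/-- The sections of `𝒪_X(D)` that vanish to order at least `N` at `x`. -/
def vanishingSubmodule :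
    letI := functionFieldAlgebra f
    Submodule ℂ (sectionSubmodule f D) :=
  letI := functionFieldAlgebra f
  { carrier := {g | VanishesAt x D N g}
    zero_mem' := fun q _ => ⟨0, Ideal.zero_mem _, by rw [map_zero]; exact (zero_mul _).symm⟩
    add_mem' := fun {g h} hg hh q hq => by
      obtain ⟨a, ha, ha'⟩ := hg q hq
      obtain ⟨b, hb, hb'⟩ := hh q hq
      refine ⟨a + b, Ideal.add_mem _ ha hb, ?_⟩
      rw [map_add, ha', hb', ← add_mul]; rfl
    smul_mem' := fun z g hg q hq => by
      obtain ⟨a, ha, ha'⟩ := hg q hq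
      obtain ⟨c, hc⟩ := isRegularAt_constFun f z x
      refine ⟨c * a, Ideal.mul_mem_left _ _ ha, ?_⟩
      rw [map_mul, ha', hc, ← mul_assoc]; rfl }

/-- Nonzero sections of `𝒪_X(D)` vanish to bounded order at `x`. -/
lemma ProjectiveCharts.exists_vanishing_bound (ch : ProjectiveCharts f) (x : X) (D : CDiv X) :
    ∃ N, ∀ g ∈ sectionSpace D, VanishesAt x D N g → g = 0 := by
  let := functionFieldAlgebra f
  have := ch.finiteDimensional_sectionSubmodule D
  have := ch.isLocallyNoetherian
  -- The sections vanishing to order N form a descending chain in a finite-dimensional space; its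
  -- stable value is zero, since its elements vanish to every order.
  obtain ⟨N, hN⟩ := IsArtinian.monotone_stabilizes (R := ℂ) (M := sectionSubmodule f D)
    ⟨fun N => OrderDual.toDual (vanishingSubmodule f x D N), fun M N h g hg => VanishesAt.mono h hg⟩
  refine ⟨N, fun g hg hgN => eq_zero_of_vanishesAt (x := x) (D := D) fun M => ?_⟩
  rcases le_total M N with h | h
  · exact hgN.mono h
  · have e : vanishingSubmodule f x D N = vanishingSubmodule f x D M := hN M h
    have : (⟨g, hg⟩ : sectionSubmodule f D) ∈ vanishingSubmodule f x D M := e ▸ hgN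
    exact this

/-- A numerical function on divisors that decreases under subtraction of effective divisors, and
strictly if the effective divisor contains a given point. -/
lemma ProjectiveCharts.exists_measure (ch : ProjectiveCharts f) (x : X) : ∃ ν : CDiv X → ℕ,
    (∀ D E g, g ∈ sectionSpace E → g ≠ 0 → ν D ≤ ν (D + E)) ∧
    (∀ D E g, g ∈ sectionSpace E → g ≠ 0 → VanishesAt x E 1 g →
      (∃ k ∈ sectionSpace (D + E), k ≠ 0) → ν D < ν (D + E)) := by
  classical
  -- ν(D) is the least N such that no nonzero section of D vanishes to order N at x. Multiplication
  -- by g embeds the sections of D into those of D + E and adds the vanishing order of g.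
  refine ⟨fun D => Nat.find (ch.exists_vanishing_bound x D), fun D E g hg hg0 => ?_,
    fun D E g hg hg0 hgx ⟨k, hk, hk0⟩ => ?_⟩
  · refine Nat.find_min' _ fun h hh hhN => ?_
    have := Nat.find_spec (ch.exists_vanishing_bound x (D + E)) (h * g) (mul_mem_sectionSpace hh hg)
      (hhN.mul (vanishesAt_zero_of_mem hg))
    exact (mul_eq_zero.mp this).resolve_right hg0
  -- The nonzero section k of D + E makes this number positive, which leaves room for a strict
  -- decrease; it would be 0 if there were no such section.
  · have hpos : Nat.find (ch.exists_vanishing_bound x (D + E)) ≠ 0 := fun h0 => hk0 <|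
      Nat.find_spec (ch.exists_vanishing_bound x (D + E)) k hk (by
        rw [h0]; exact vanishesAt_zero_of_mem hk)
    obtain ⟨n, hn⟩ := Nat.exists_eq_succ_of_ne_zero hpos
    change Nat.find _ < Nat.find _
    rw [hn, Nat.lt_succ_iff]
    refine Nat.find_min' _ fun h hh hhN => ?_
    have := Nat.find_spec (ch.exists_vanishing_bound x (D + E)) (h * g) (mul_mem_sectionSpace hh hg)
      (by rw [hn]; exact hhN.mul hgx)
    exact (mul_eq_zero.mp this).resolve_right hg0

end Vanishing
end CoxEuler
end

noncomputable section
namespace CoxEuler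

/-! ### The irrelevant ideal as image of the sections of the Euler sheaf -/

section EulerIdeal
variable {X : Scheme.{0}} [IsIntegral X] {Λ : AddSubgroup (CDiv X)} (f : X ⟶ Spec (.of ℂ))
  [Module.Free ℤ Λ] [Module.Finite ℤ Λ]

lemma constFun_mul_mem {D : CDiv X} (z : ℂ) {h : X.functionField} (hh : h ∈ sectionSpace D) :
    constFun f z * h ∈ sectionSpace D := fun x => (hh x).regular_mul (isRegularAt_constFun f z x)

/-- There is a functional on the Euler sheaf that is zero on sections of degree `0` and surjective
onto the Cox ring in all other degrees. -/
lemma exists_euler_functional (ch : ProjectiveCharts f) (hΩ : IsReflexive (Omega f))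
    (hc1 : Function.Injective (c1 (Λ := Λ) f)) :
    ∃ θ : genericDual (toPMod (eulerSheaf f Λ)), MapsInto θ 0 ∧
      (∀ x : H0 (twist (eulerSheaf f Λ) 0), globalVal 0 θ x = 0) ∧
      ∀ l : Λ, l ≠ 0 → ∀ h ∈ coxPiece Λ l, ∃ x : gradedSections Λ (eulerSheaf f Λ) l,
        globalVal l.1 θ x = h := by
  obtain ⟨L, hL, hL'⟩ := exists_chern_functional f hc1
  refine ⟨eulerDual f L, mapsInto_eulerDual f L, globalVal_eulerDual_zero f ch hΩ L hL', fun l hl h hh => ?_⟩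
  -- The Euler lift multiplies by L(l), which is not zero, so L(l)⁻¹ h is lifted instead of h.
  obtain ⟨x, hx⟩ := exists_eulerDual_eq f L l (constFun_mul_mem f (L l)⁻¹ hh)
  refine ⟨x, hx.trans ?_⟩
  rw [← mul_assoc, ← map_mul, mul_inv_cancel₀ (hL l hl), map_one, one_mul]

end EulerIdeal

section Graded
open DirectSum

/-- A finitely generated ideal that is the irrelevant ideal of a graded ring is generated by finitely
many homogeneous elements of nonzero degree. -/
lemma exists_homogeneous_generators {ι : Type} [DecidableEq ι] [AddMonoid ι] {R : Type} [Ring R]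
    (A : ι → AddSubgroup R) [SetLike.GradedMonoid A] (J : Ideal (⨁ i, A i)) (hJfg : J.FG)
    (hJ0 : ∀ s ∈ J, (s 0 : R) = 0) (hJ : ∀ m, m ≠ 0 → ∀ g : A m, DirectSum.of (fun i => A i) m g ∈ J) :
    ∃ (κ : Type) (_ : Fintype κ) (l : κ → ι) (h : ∀ k, A (l k)),
      (∀ k, l k ≠ 0 ∧ (h k : R) ≠ 0) ∧ ∀ m, m ≠ 0 → ∀ g : A m, DirectSum.of (fun i => A i) m g ∈
        Ideal.span (Set.range fun k => DirectSum.of (fun i => A i) (l k) (h k)) := by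
  classical
  obtain ⟨t, ht⟩ := hJfg
  -- The generators are the nonzero homogeneous components of a finite generating set. Degree 0 does
  -- not occur among them, as elements of J have no component there.
  refine ⟨Σ s : t, (DFinsupp.support s.1), inferInstance, fun k => k.2.1, fun k => k.1.1 k.2.1,
    fun k => ⟨fun h => ?_, fun h => DFinsupp.mem_support_iff.mp k.2.2 (Subtype.ext h)⟩, fun m hm g => ?_⟩
  · have h1 : ∀ i, i = 0 → (k.1.1 i : R) = 0 := by
      rintro i rfl
      exact hJ0 _ (ht ▸ Ideal.subset_span k.1.2)
    exact DFinsupp.mem_support_iff.mp k.2.2 (Subtype.ext (h1 _ h))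
  · have h1 := hJ m hm g
    rw [← ht] at h1
    refine Ideal.span_le.mpr (fun s hs => ?_) h1
    have h := DirectSum.sum_support_of s
    rw [← h]
    exact Ideal.sum_mem _ fun i hi => Ideal.subset_span ⟨⟨⟨s, hs⟩, i, hi⟩, rfl⟩

end Graded

section Ideal
variable {X : Scheme.{0}} [IsIntegral X] {Λ : AddSubgroup (CDiv X)} {F : X.Modules}

lemma sectionMap_val (θ : genericDual (toPMod F)) (hθ : MapsInto θ ((0 : Λ) : CDiv X))
    (x : SectionModule Λ F) (l : Λ) :
    (sectionMap θ 0 hθ x l : X.functionField) = globalVal l.1 θ (x l) := by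
  have h := congrArg Subtype.val (sectionMap_apply θ 0 hθ x l)
  have e : ∀ m : Λ, m = l → (sectionMap θ 0 hθ x m : X.functionField) = sectionMap θ 0 hθ x l := by
    rintro m rfl; rfl
  exact (e _ (zero_add l)).symm.trans h

open Classical in
lemma sectionMap_of (θ : genericDual (toPMod F)) (hθ : MapsInto θ ((0 : Λ) : CDiv X)) (l : Λ)
    (x : gradedSections Λ F l) (h : coxPiece Λ l) (hx : globalVal l.1 θ x = h) :
    sectionMap θ 0 hθ (DirectSum.of (gradedSections Λ F) l x) = DirectSum.of (fun l : Λ => coxPiece Λ l) l h :=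
  (sectionMapHom_of θ 0 hθ l x).trans
    (DirectSum.of_eq_of_gradedMonoid_eq (Sigma.subtype_ext (zero_add l) hx))

open Classical in
/-- If a functional on `F` is zero on sections of degree `0` and surjective onto the Cox ring in all
other degrees, and `Γ_Λ(F)` is finitely generated, then the irrelevant ideal of the Cox ring is
generated by finitely many homogeneous elements. -/
lemma exists_generators (θ : genericDual (toPMod F)) (hθ : MapsInto θ ((0 : Λ) : CDiv X))
    (h0 : ∀ x : H0 (twist F 0), globalVal 0 θ x = 0)
    (hsurj : ∀ l : Λ, l ≠ 0 → ∀ h ∈ coxPiece Λ l, ∃ x : gradedSections Λ F l, globalVal l.1 θ x = h)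
    (hfin : Module.Finite (CoxRing Λ) (SectionModule Λ F)) :
    ∃ (κ : Type) (_ : Fintype κ) (l : κ → Λ) (h : ∀ k, coxPiece Λ (l k)),
      (∀ k, l k ≠ 0 ∧ (h k : X.functionField) ≠ 0) ∧
      ∀ m : Λ, m ≠ 0 → ∀ g : coxPiece Λ m, DirectSum.of (fun l : Λ => coxPiece Λ l) m g ∈
        Ideal.span (Set.range fun k => DirectSum.of (fun l : Λ => coxPiece Λ l) (l k) (h k)) := by
  -- The image is an ideal without components of degree 0 that contains all other graded pieces, and
  -- it inherits finite generation from the section module.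
  let J : Ideal (CoxRing Λ) := LinearMap.range (sectionMap θ 0 hθ)
  have hJ0 : ∀ s ∈ J, (s 0 : coxPiece Λ 0) = 0 := by
    rintro s ⟨x, rfl⟩
    exact Subtype.ext ((sectionMap_val θ hθ x 0).trans (h0 (x 0)))
  have hJ : ∀ m : Λ, m ≠ 0 → ∀ g : coxPiece Λ m, DirectSum.of (fun l : Λ => coxPiece Λ l) m g ∈ J := by
    intro m hm g
    obtain ⟨x, hx⟩ := hsurj m hm g.1 g.2
    exact ⟨_, sectionMap_of θ hθ m x g hx⟩
  have hJfg : J.FG := by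
    have : Submodule.FG (LinearMap.range (sectionMap θ 0 hθ)) := by
      rw [LinearMap.range_eq_map]; exact hfin.fg_top.map _
    exact this
  have key := exists_homogeneous_generators (coxPiece Λ) J hJfg
    (fun s hs => congrArg Subtype.val (hJ0 s hs)) hJ
  exact key

end Ideal
end CoxEuler
end

noncomputable section
namespace CoxEuler

/-! ### From generators of the irrelevant ideal to generators of the ring -/

section Graded
open DirectSum
variable {ι : Type} [DecidableEq ι] [AddGroup ι] {R : Type} [Ring R] {A : ι → AddSubgroup R}
  [SetLike.GradedMonoid A] {κ : Type} [Fintype κ] {l : κ → ι} {h : ∀ k, A (l k)}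

/-- Comparing components of degree m, only the part of the k-th coefficient in degree m - l_k
contributes. -/
lemma exists_coefficients {m : ι} {g : A m} (hg : DirectSum.of (fun i => A i) m g ∈
      Ideal.span (Set.range fun k => DirectSum.of (fun i => A i) (l k) (h k))) :
    ∃ c : ∀ k, A (m - l k), (g : R) = ∑ k, (c k : R) * h k := by
  obtain ⟨c, hc⟩ := (Submodule.mem_span_range_iff_exists_fun _).mp hg
  refine ⟨fun k => c k (m - l k), ?_⟩
  have h1 := congrArg (fun s : ⨁ i, A i => (s m : R)) hc
  simp only [DirectSum.of_eq_same] at h1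
  rw [← h1, DFinsupp.finsetSum_apply, AddSubgroup.val_finsetSum]
  refine Finset.sum_congr rfl fun k _ => ?_
  have h2 := DirectSum.coe_mul_of_apply_add A (c k) (h k) (m - l k)
  rwa [sub_add_cancel] at h2

/-- If the irrelevant ideal is generated by finitely many homogeneous elements, and there is a bound for
the degrees of their products, then these elements and those of degree `0` generate the ring. -/
lemma mem_of_generators (hgen : ∀ m, m ≠ 0 → ∀ g : A m, DirectSum.of (fun i => A i) m g ∈
      Ideal.span (Set.range fun k => DirectSum.of (fun i => A i) (l k) (h k)))
    (ν : ι → ℕ) (hν : ∀ d k m, d + l k = m → (∃ g : A m, (g : R) ≠ 0) → ν d < ν m)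
    (B : Subsemiring (⨁ i, A i)) (hB0 : ∀ g : A 0, DirectSum.of (fun i => A i) 0 g ∈ B)
    (hB : ∀ k, DirectSum.of (fun i => A i) (l k) (h k) ∈ B) (s : ⨁ i, A i) : s ∈ B := by
  have key : ∀ n m, ν m = n → ∀ g : A m, DirectSum.of (fun i => A i) m g ∈ B := by
    intro n
    induction n using Nat.strong_induction_on with
    | _ n ih =>
      intro m hm g
      -- The decrease of ν is only available in degrees with a nonzero element, so g = 0 is treated
      -- separately. Otherwise g = ∑ c_k h_k with coefficients in degrees of smaller ν.
      by_cases hg : (g : R) = 0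
      · rw [show g = 0 from Subtype.ext hg, map_zero]
        exact B.zero_mem
      by_cases hm0 : m = 0
      · subst hm0
        exact hB0 g
      obtain ⟨c, hc⟩ := exists_coefficients (hgen m hm0 g)
      have hmem : ∀ k, (c k : R) * h k ∈ A m := fun k => by
        have := SetLike.mul_mem_graded (c k).2 (h k).2
        rwa [sub_add_cancel] at this
      have e : DirectSum.of (fun i => A i) m g =
          ∑ k, DirectSum.of (fun i => A i) (m - l k) (c k) * DirectSum.of (fun i => A i) (l k) (h k) := by
        have h1 : ∀ k, DirectSum.of (fun i => A i) (m - l k) (c k) * DirectSum.of (fun i => A i) (l k) (h k) =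
            DirectSum.of (fun i => A i) m ⟨_, hmem k⟩ := fun k => by
          rw [DirectSum.of_mul_of]
          exact DirectSum.of_eq_of_gradedMonoid_eq (Sigma.subtype_ext (sub_add_cancel m (l k)) rfl)
        rw [Finset.sum_congr rfl fun k _ => h1 k, ← map_sum]
        congr 1
        refine Subtype.ext (hc.trans ?_)
        rw [AddSubgroup.val_finsetSum]
      rw [e]
      exact B.sum_mem fun k _ => B.mul_mem
        (ih _ (hm ▸ hν (m - l k) k m (sub_add_cancel m (l k)) ⟨g, hg⟩) _ rfl _) (hB k)
  induction s using DirectSum.induction_on with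
  | zero => exact B.zero_mem
  | add x y hx hy => exact B.add_mem hx hy
  | of m g => exact key _ m rfl g

end Graded

/-! ### Finite generation of the Cox ring -/

section FiniteType
variable {X : Scheme.{0}} [IsIntegral X] {Λ : AddSubgroup (CDiv X)} {f : X ⟶ Spec (.of ℂ)}
  [Module.Free ℤ Λ] [Module.Finite ℤ Λ]

omit [Module.Free ℤ Λ] [Module.Finite ℤ Λ] in
open Classical in
/-- If the irrelevant ideal of the Cox ring is generated by finitely many homogeneous elements of
nonzero degree, then the Cox ring is finitely generated. -/
lemma finiteType_of_generators (ch : ProjectiveCharts f) (hc1 : Function.Injective (c1 (Λ := Λ) f))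
    {κ : Type} [Fintype κ] {l : κ → Λ} {h : ∀ k, coxPiece Λ (l k)}
    (hk : ∀ k, l k ≠ 0 ∧ (h k : X.functionField) ≠ 0)
    (hgen : ∀ m : Λ, m ≠ 0 → ∀ g : coxPiece Λ m, DirectSum.of (fun l : Λ => coxPiece Λ l) m g ∈
        Ideal.span (Set.range fun k => DirectSum.of (fun l : Λ => coxPiece Λ l) (l k) (h k))) :
    (coxStructure Λ f).FiniteType := by
  have hν : ∀ k, ∃ ν : CDiv X → ℕ,
      (∀ D E g, g ∈ sectionSpace E → g ≠ 0 → ν D ≤ ν (D + E)) ∧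
      ∀ D, (∃ g ∈ sectionSpace (D + (l k).1), g ≠ 0) → ν D < ν (D + (l k).1) := by
    intro k
    -- The measure for k is taken at a zero of h_k, which exists because the degree of h_k is not 0.
    obtain ⟨x, hx⟩ := exists_zero hc1 (hk k).1 (Units.mk0 _ (hk k).2)
    obtain ⟨ν, hν, hν'⟩ := ch.exists_measure x
    exact ⟨ν, hν, fun D => hν' D _ _ (h k).2 (hk k).2 (vanishesAt_one (h k).2 _ rfl hx)⟩
  choose ν hν hν' using hν
  let := (coxStructure Λ f).toAlgebra
  let B := Algebra.adjoin ℂ (Set.range fun k => DirectSum.of (fun l : Λ => coxPiece Λ l) (l k) (h k))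
  suffices hB : ∀ s : CoxRing Λ, s ∈ B by
    exact ⟨Subalgebra.fg_def.mpr ⟨_, Set.finite_range _, top_le_iff.mp fun s _ => hB s⟩⟩
  -- Dividing by h_k increases none of the measures ν_j and strictly decreases ν_k, so the sum drops
  -- whichever generator is used.
  refine mem_of_generators hgen (fun m => ∑ j, ν j m.1) (fun d k m hm hg => ?_) B.toSubsemiring
    (fun g => ?_) fun k => Algebra.subset_adjoin ⟨k, rfl⟩
  · subst hm
    obtain ⟨g, hg⟩ := hg
    exact Finset.sum_lt_sum (fun j _ => hν j d.1 _ _ (h k).2 (hk k).2)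
      ⟨k, Finset.mem_univ k, hν' k d.1 ⟨g.1, g.2, hg⟩⟩
  · obtain ⟨z, hz⟩ := ch.exists_constFun_eq g.2
    have : DirectSum.of (fun l : Λ => coxPiece Λ l) 0 g = coxStructure Λ f z :=
      congrArg _ (Subtype.ext hz.symm)
    rw [this]
    exact B.algebraMap_mem z

lemma finiteType_of_finite (hf : IsProjective f) (hΩ : IsReflexive (Omega f))
    (hc1 : Function.Injective (c1 (Λ := Λ) f))
    (hfin : Module.Finite (CoxRing Λ) (SectionModule Λ (eulerSheaf f Λ))) :
    (coxStructure Λ f).FiniteType := by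
  obtain ⟨ch⟩ := exists_projectiveCharts hf
  obtain ⟨θ, hθ, h0, hsurj⟩ := exists_euler_functional f ch hΩ hc1
  obtain ⟨κ, _, l, h, hk, hgen⟩ := exists_generators θ hθ h0 hsurj hfin
  exact finiteType_of_generators ch hc1 hk hgen

end FiniteType
end CoxEuler
end

theorem mainTheorem4 (X : Scheme.{0}) [AlgebraicGeometry.IsIntegral X] (f : X ⟶ Spec (.of ℂ))
    (hprojective : CoxEuler.IsProjective f) (hnormal : CoxEuler.IsNormal X)
    (Λ : AddSubgroup (CoxEuler.CDiv X)) [Module.Free ℤ Λ] [Module.Finite ℤ Λ]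
    (hc1 : Function.Injective (CoxEuler.c1 (Λ := Λ) f))
    (hample : ∃ D ∈ Λ, CoxEuler.IsAmple D)
    (hreflexive : CoxEuler.IsReflexive (CoxEuler.Omega f)) :
    List.TFAE [
      (CoxEuler.coxStructure Λ f).FiniteType,
      Module.Finite (CoxEuler.CoxRing Λ) (CoxEuler.SectionModule Λ (CoxEuler.eulerSheaf f Λ)),
      ∀ F : X.Modules, CoxEuler.IsReflexive F →
        Module.Finite (CoxEuler.CoxRing Λ) (CoxEuler.SectionModule Λ F)] := by
  tfae_have 1 → 3 := fun h _ hF => CoxEuler.finite_sectionModule_of_isReflexive hprojective hample h hF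
  tfae_have 3 → 2 := fun h => h _ (CoxEuler.isReflexive_eulerSheaf f hreflexive)
  tfae_have 2 → 1 := CoxEuler.finiteType_of_finite hprojective hreflexive hc1
  tfae_finish
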